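/- **Setting.** Let $\mathcal T_0$ be a finite conforming partition into nondegenerate closed triangles (distinct triangles do not overlap and meet in the empty set, a common vertex or a common side), each triangle having one vertex labelled as its newest vertex, and let $\Omega\subset\mathbb R^2$ be the interior of the union of these triangles. Newest-vertex bisection halves a triangle by joining its newest vertex to the midpoint of the opposite side; the midpoint is the newest vertex of both children. Let $\mathcal T$ be obtained from $\mathcal T_0$ by finitely many newest-vertex bisections of single elements (hanging nodes are allowed). The nodes of $\mathcal T$ are the vertices of its triangles; a node is *proper* if it is a vertex of every triangle of $\mathcal T$ that contains it, and *hanging* otherwise. A hanging node $x$ is created by halving a segment with endpoints $x',x''$. The global index is $\lambda(x)=0$ for proper $x$ and $\lambda(x)=\max(\lambda(x'),\lambda(x''))+1$ for hanging $x$; $\mathcal T$ is *$\Lambda$-admissible* if $\lambda(x)\le\Lambda$ for all nodes $x$. For $E\in\mathcal T$, $\mathcal N_E$ is the set of nodes on $\partial E$, $\mathcal E_E$ is the set of edges of $E$ (segments on $\partial E$ between consecutive nodes), and $h_E=|E|^{1/2}$. The data $\mathcal D=(A,c,f)$ consist of a symmetric, uniformly positive definite $A\in L^\infty(\Omega)^{2\times2}$,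 a $c\in L^\infty(\Omega)$ with $c\ge0$, and an $f\in L^2(\Omega)$; they are constant on each $E\in\mathcal T$, with values $A_E,c_E,f_E$. Let $u\in H^1_0(\Omega)$ satisfy $\int_\Omega (A\nabla u)\cdot\nabla v+\int_\Omega c\,u\,v=\int_\Omega f v$ for all $v\in H^1_0(\Omega)$. For each $E\in\mathcal T$ let $\mathbb V_E\subset C^0(E)\cap H^1(E)$ be any linear space with $\dim\mathbb V_E=|\mathcal N_E|$ and $\mathbb P_1(E)\subseteq\mathbb V_E$, whose traces on $\partial E$ are exactly the continuous functions on $\partial E$ that are affine on each $e\in\mathcal E_E$, and such that, with $s_E(v,w)=\sum_{x\in\mathcal N_E}v(x)w(x)$, $$c_s|v|_{1,E}^2\le \min_{k\in\mathbb R}s_E(v-k,v-k)\le C_s|v|_{1,E}^2\qquad\forall v\in\mathbb V_E,$$ with constants $C_s\ge c_s>0$ independent of $E$ and $\mathcal T$. Put $\mathbb V_{\mathcal T}=\{v\in H^1_0(\Omega): v|_E\in\mathbb V_E\ \forall E\in\mathcal T\}$. Let $\mathcal I_E v\in\mathbb P_1$ be the affine interpolant of $v$ at the three vertices of $E$, let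 $\Pi^\nabla_Ev\in\mathbb P_1$ be given by $\int_E\nabla(v-\Pi^\nabla_Ev)\cdot\nabla w=0$ for all $w\in\mathbb P_1$ and $\int_{\partial E}(v-\Pi^\nabla_Ev)=0$, and let $S_{\mathcal T}(v,w)=\sum_{E\in\mathcal T}s_E(v-\mathcal I_Ev,w-\mathcal I_Ew)$. For $\gamma>0$ let $u_{\mathcal T}\in\mathbb V_{\mathcal T}$ satisfy, for all $v\in\mathbb V_{\mathcal T}$, $$\sum_{E\in\mathcal T}\int_E (A_E\nabla\Pi^\nabla_Eu_{\mathcal T})\cdot\nabla\Pi^\nabla_Ev+\gamma S_{\mathcal T}(u_{\mathcal T},v)+\sum_{E\in\mathcal T}c_E\int_E\Pi^\nabla_Eu_{\mathcal T}\,\Pi^\nabla_Ev=\sum_{E\in\mathcal T}f_E\int_E\Pi^\nabla_Ev .$$ The residual estimator is $$\eta_{\mathcal T}^2(u_{\mathcal T},\mathcal D)=\sum_{E\in\mathcal T}\Big(h_E^2\|f_E-c_E\Pi^\nabla_Eu_{\mathcal T}\|_{0,E}^2+\tfrac12\sum_{e\in\mathcal E_E}h_E\|j(e)\|_{0,e}^2\Big),$$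 where $j(e)=0$ if $e\subset\partial\Omega$, and otherwise $j(e)=(A_{E_1}\nabla\Pi^\nabla_{E_1}u_{\mathcal T})\cdot n_1+(A_{E_2}\nabla\Pi^\nabla_{E_2}u_{\mathcal T})\cdot n_2$ for the two elements $E_1,E_2$ sharing $e$, with $n_i$ the unit normal to $e$ pointing out of $E_i$. **Corollary 4.2 (global lower bound).** For all $\mathcal T_0$ (hence $\Omega$), every integer $\Lambda\ge1$, all $C_s\ge c_s>0$ and all $M$ there is a constant $c_{apost}>0$, depending only on these quantities, such that $$c_{apost}\,\eta_{\mathcal T}^2(u_{\mathcal T},\mathcal D)\le|u-u_{\mathcal T}|_{1,\Omega}^2+S_{\mathcal T}(u_{\mathcal T},u_{\mathcal T})$$ for every $\Lambda$-admissible $\mathcal T$ as above, all data $\mathcal D$ as above for which the entries of $A$ and the function $c$ are bounded by $M$ in absolute value a.e. in $\Omega$, all spaces $\mathbb V_E$ as above, every $\gamma>0$, and all $u$, $u_{\mathcal T}$ as above. In particular $c_{apost}$ depends on $\Lambda$ but is independent of $\gamma$, $\mathcal T$, $u$, $u_{\mathcal T}$ and $f$. -/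

import Mathlib

noncomputable section

namespace AVEM

open MeasureTheory Filter Topology
open scoped ContDiff

/-- The Euclidean plane. -/
abbrev Plane := EuclideanSpace ℝ (Fin 2)

/-! ### Sobolev spaces -/

/-- Smooth test functions with compact support in `U`. -/
def IsTest (U : Set Plane) (φ : Plane → ℝ) : Prop :=
  ContDiff ℝ ∞ φ ∧ HasCompactSupport φ ∧ tsupport φ ⊆ U

/-- `v ∈ L²(U)` has the weak gradient `g ∈ L²(U)` in the open set `U`. -/
structure HasWeakGrad (U : Set Plane) (v : Plane → ℝ) (g : Plane → Plane) : Prop where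
  memLp : MemLp v 2 (volume.restrict U)
  memLp_grad : MemLp g 2 (volume.restrict U)
  integral_eq : ∀ φ : Plane → ℝ, IsTest U φ →
    ∫ x in U, v x • gradient φ x = -∫ x in U, φ x • g x

/-- `v` belongs to `H¹(U)`. -/
def MemH1 (U : Set Plane) (v : Plane → ℝ) : Prop := ∃ g, HasWeakGrad U v g

open Classical in
/-- The weak gradient of `v ∈ H¹(U)`, which is unique up to null sets of `U`. -/
def weakGrad (U : Set Plane) (v : Plane → ℝ) : Plane → Plane :=
  if h : MemH1 U v then h.choose else 0

/-- `v` belongs to `H¹₀(U)`, the closure of the test functions in `H¹(U)`. -/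
def MemH10 (U : Set Plane) (v : Plane → ℝ) : Prop :=
  ∃ g : Plane → Plane, HasWeakGrad U v g ∧
    ∃ φ : ℕ → Plane → ℝ, (∀ n, IsTest U (φ n)) ∧
      Tendsto (fun n => eLpNorm (φ n - v) 2 (volume.restrict U)) atTop (𝓝 0) ∧
      Tendsto (fun n => eLpNorm (gradient (φ n) - g) 2 (volume.restrict U)) atTop (𝓝 0)

/-- The squared seminorm `|v|²_{1,U}`. -/
def semiH1sq (U : Set Plane) (v : Plane → ℝ) : ℝ := ∫ x in U, ‖weakGrad U v x‖ ^ 2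

/-- An affine function `x ↦ grad · x + const` of the plane, i.e. an element of `ℙ₁`. -/
@[ext] structure P1 where
  grad : Plane
  const : ℝ

/-- The value of an affine function. -/
def P1.eval (p : P1) (x : Plane) : ℝ := inner ℝ p.grad x + p.const

/-! ### Triangles and newest-vertex bisection -/

/-- A triangle with numbered vertices; vertex `0` is the newest vertex, so that the edge
between the vertices `1` and `2` is the one to be halved. -/
@[ext] structure Tri where
  vtx : Fin 3 → Plane

namespace Tri

/-- The closed triangle as a set of points. -/
def carrier (E : Tri) : Set Plane := convexHull ℝ (Set.range E.vtx)

/-- The point that newest-vertex bisection creates. -/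
def mid (E : Tri) : Plane := midpoint ℝ (E.vtx 1) (E.vtx 2)

/-- First child under newest-vertex bisection. -/
def child₁ (E : Tri) : Tri := ⟨![E.mid, E.vtx 0, E.vtx 1]⟩

/-- Second child under newest-vertex bisection. -/
def child₂ (E : Tri) : Tri := ⟨![E.mid, E.vtx 2, E.vtx 0]⟩

/-- `h_E = |E|^{1/2}`. -/
def h (E : Tri) : ℝ := Real.sqrt (volume.real E.carrier)

/-- The integral of `v` over `∂E` with respect to arc length. -/
def boundaryIntegral (E : Tri) (v : Plane → ℝ) : ℝ :=
  ∑ i : Fin 3, dist (E.vtx i) (E.vtx (i + 1)) *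
    ∫ t in (0 : ℝ)..1, v (AffineMap.lineMap (E.vtx i) (E.vtx (i + 1)) t)

end Tri

/-- A conforming partition into nondegenerate triangles: distinct triangles do not overlap, and
they meet in the empty set, in a common vertex or in a common full side. -/
structure IsConforming (T₀ : Finset Tri) : Prop where
  nondegenerate : ∀ E ∈ T₀, AffineIndependent ℝ E.vtx
  disjoint : ∀ E ∈ T₀, ∀ E' ∈ T₀, E ≠ E' → Disjoint (interior E.carrier) (interior E'.carrier)
  inter_eq : ∀ E ∈ T₀, ∀ E' ∈ T₀, E ≠ E' →
    E.carrier ∩ E'.carrier = convexHull ℝ (Set.range E.vtx ∩ Set.range E'.vtx)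

/-- The polygonal domain `Ω` triangulated by `T₀`: the interior of the union of the triangles. -/
def domain (T₀ : Finset Tri) : Set Plane := interior (⋃ E ∈ T₀, E.carrier)

open Classical in
/-- `T` arises from `T₀` by finitely many newest-vertex bisections of single elements. -/
inductive IsRefinement (T₀ : Finset Tri) : Finset Tri → Prop
  | refl : IsRefinement T₀ T₀
  | bisect (T : Finset Tri) (E : Tri) : IsRefinement T₀ T → E ∈ T →
      IsRefinement T₀ (insert E.child₁ (insert E.child₂ (T.erase E)))

/-- The infinite forest of all triangles obtained from `T₀` by newest-vertex bisection. -/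
inductive InForest (T₀ : Finset Tri) : Tri → Prop
  | root (E : Tri) : E ∈ T₀ → InForest T₀ E
  | left (E : Tri) : InForest T₀ E → InForest T₀ E.child₁
  | right (E : Tri) : InForest T₀ E → InForest T₀ E.child₂

/-! ### Nodes, edges and the global index -/

open Classical in
/-- The nodes of `T`: all vertices of its triangles. -/
def nodes (T : Finset Tri) : Finset Plane := T.biUnion fun E => Finset.univ.image E.vtx

/-- A node is proper if it is a vertex of all the triangles that contain it. -/
def IsProper (T : Finset Tri) (x : Plane) : Prop :=
  x ∈ nodes T ∧ ∀ E ∈ T, x ∈ E.carrier → x ∈ Set.range E.vtx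

/-- A hanging node is a node that is not proper. -/
def IsHanging (T : Finset Tri) (x : Plane) : Prop := x ∈ nodes T ∧ ¬ IsProper T x

/-- `x` is created by halving the edge with endpoints `y` and `z`. -/
def Halves (T₀ : Finset Tri) (x y z : Plane) : Prop :=
  ∃ K, InForest T₀ K ∧ x = K.mid ∧ y = K.vtx 1 ∧ z = K.vtx 2

/-- `GlobalIndex T₀ T x n` says that the node `x` of `T` has the global index `n`. -/
inductive GlobalIndex (T₀ T : Finset Tri) : Plane → ℕ → Prop
  | proper (x : Plane) : IsProper T x → GlobalIndex T₀ T x 0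
  | hanging (x y z : Plane) (m n : ℕ) : IsHanging T x → Halves T₀ x y z →
      GlobalIndex T₀ T y m → GlobalIndex T₀ T z n → GlobalIndex T₀ T x (max m n + 1)

/-- `T` is `Λ`-admissible: all the global indices of its nodes are at most `Λ`. -/
def IsAdmissible (T₀ T : Finset Tri) (Λ : ℕ) : Prop :=
  ∀ x ∈ nodes T, ∃ n ≤ Λ, GlobalIndex T₀ T x n

open Classical in
/-- The nodes of `T` that sit on `∂E`. -/
def nodesOf (T : Finset Tri) (E : Tri) : Finset Plane :=
  (nodes T).filter fun x => x ∈ frontier E.carrier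

/-- The closed segment spanned by an unordered pair of points. -/
def seg (e : Sym2 Plane) : Set Plane := convexHull ℝ {x | x ∈ e}

/-- The length of a segment. -/
def len (e : Sym2 Plane) : ℝ := Metric.diam (seg e)

open Classical in
/-- The edges of `E` as a polygon: segments on `∂E` between two consecutive nodes. -/
def edgesOf (T : Finset Tri) (E : Tri) : Finset (Sym2 Plane) :=
  (nodesOf T E).sym2.filter fun e =>
    ¬ e.IsDiag ∧ seg e ⊆ frontier E.carrier ∧ ∀ x ∈ nodesOf T E, x ∈ seg e → x ∈ e

/-- `n` is the unit normal vector to the edge `e` of `E` pointing out of `E`. -/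
def IsOutwardNormal (E : Tri) (e : Sym2 Plane) (n : Plane) : Prop :=
  ‖n‖ = 1 ∧ ∀ x ∈ e, ∀ y ∈ E.carrier, inner ℝ n (y - x) ≤ 0

open Classical in
/-- The (unique) outward unit normal to the edge `e` of `E`. -/
def normal (E : Tri) (e : Sym2 Plane) : Plane :=
  if h : ∃ n, IsOutwardNormal E e n then h.choose else 0

/-! ### Data and the continuous problem -/

/-- The coefficients and the right-hand side, as functions. -/
structure Coeffs where
  A : Plane → Matrix (Fin 2) (Fin 2) ℝ
  c : Plane → ℝ
  f : Plane → ℝ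

/-- The product of a matrix and a vector. -/
def mulV (B : Matrix (Fin 2) (Fin 2) ℝ) (ξ : Plane) : Plane := Matrix.toEuclideanLin B ξ

/-- `A ∈ L^∞(Ω)` is symmetric and uniformly positive definite, `c ∈ L^∞(Ω)` is non-negative and
`f ∈ L²(Ω)`; moreover the entries of `A` and `c` are bounded by `M`. -/
structure Coeffs.IsData (D : Coeffs) (Ω : Set Plane) (M : ℝ) : Prop where
  measurable_A : ∀ i j, AEStronglyMeasurable (fun x => D.A x i j) (volume.restrict Ω)
  bounded_A : ∀ᵐ x ∂volume.restrict Ω, ∀ i j, |D.A x i j| ≤ M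
  symm_A : ∀ᵐ x ∂volume.restrict Ω, (D.A x).IsSymm
  posDef_A : ∃ α : ℝ, 0 < α ∧
    ∀ᵐ x ∂volume.restrict Ω, ∀ ξ : Plane, α * ‖ξ‖ ^ 2 ≤ inner ℝ (mulV (D.A x) ξ) ξ
  measurable_c : AEStronglyMeasurable D.c (volume.restrict Ω)
  nonneg_c : ∀ᵐ x ∂volume.restrict Ω, 0 ≤ D.c x
  bounded_c : ∀ᵐ x ∂volume.restrict Ω, D.c x ≤ M
  memLp_f : MemLp D.f 2 (volume.restrict Ω)

/-- The values `(A_E, c_E, f_E)` of elementwise constant data. -/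
structure ElemCoeffs where
  A : Tri → Matrix (Fin 2) (Fin 2) ℝ
  c : Tri → ℝ
  f : Tri → ℝ

/-- The data `D` are constant in each element `E` of `T`, with the values given by `d`. -/
def Coeffs.IsPiecewiseConst (D : Coeffs) (T : Finset Tri) (d : ElemCoeffs) : Prop :=
  ∀ E ∈ T, ∀ᵐ x ∂volume.restrict E.carrier, D.A x = d.A E ∧ D.c x = d.c E ∧ D.f x = d.f E

/-- The bilinear form `ℬ(u, v) = ∫_Ω (A∇u)·∇v + ∫_Ω c u v`. -/
def formB (Ω : Set Plane) (D : Coeffs) (u v : Plane → ℝ) : ℝ :=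
  (∫ x in Ω, inner ℝ (mulV (D.A x) (weakGrad Ω u x)) (weakGrad Ω v x)) +
    ∫ x in Ω, D.c x * u x * v x

/-- `u` is the weak solution of `-∇·(A∇u) + c u = f` in `Ω`, `u = 0` on `∂Ω`. -/
def IsWeakSolution (Ω : Set Plane) (D : Coeffs) (u : Plane → ℝ) : Prop :=
  MemH10 Ω u ∧ ∀ v, MemH10 Ω v → formB Ω D u v = ∫ x in Ω, D.f x * v x

/-! ### Local virtual element spaces and projections -/

/-- `g` restricted to `∂E` is continuous, and affine on each edge of `E`. -/
def IsBoundaryFunction (T : Finset Tri) (E : Tri) (g : Plane → ℝ) : Prop :=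
  ContinuousOn g (frontier E.carrier) ∧ ∀ e ∈ edgesOf T E, ∃ p : P1, Set.EqOn g p.eval (seg e)

/-- `V` is a local virtual element space on `E`: it consists of continuous functions on the closed
triangle `E` which belong to `H¹(E)`, its dimension is the number of nodes on `∂E`, it contains the
affine functions, and its traces on `∂E` are exactly the continuous functions that are affine on
each edge. -/
structure IsLocalSpace (T : Finset Tri) (E : Tri) (V : Submodule ℝ (E.carrier → ℝ)) : Prop where
  continuous : ∀ w ∈ V, Continuous w
  memH1 : ∀ v : Plane → ℝ, E.carrier.domRestrict v ∈ V → MemH1 (interior E.carrier) v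
  finrank_eq : Module.finrank ℝ V = (nodesOf T E).card
  affine_mem : ∀ p : P1, E.carrier.domRestrict p.eval ∈ V
  trace_mem : ∀ v : Plane → ℝ, E.carrier.domRestrict v ∈ V → IsBoundaryFunction T E v
  trace_surj : ∀ g : Plane → ℝ, IsBoundaryFunction T E g →
    ∃ v : Plane → ℝ, E.carrier.domRestrict v ∈ V ∧ Set.EqOn v g (frontier E.carrier)

/-- The form `s_E(v, w) = ∑ v(x_i) w(x_i)`, the sum being over the nodes on `∂E`. -/
def stab (T : Finset Tri) (E : Tri) (v w : Plane → ℝ) : ℝ := ∑ x ∈ nodesOf T E, v x * w x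

/-- Stable lifting: `c_s |v|²_{1,E} ≤ s_E(v,v) ≤ C_s |v|²_{1,E}` on `V / ℝ`. Since `s_E` does not
vanish on constants, its value at a class of `V / ℝ` is the least value of `s_E(v - k, v - k)` over
the constants `k`. -/
def IsStable (T : Finset Tri) (E : Tri) (V : Submodule ℝ (E.carrier → ℝ)) (cs Cs : ℝ) : Prop :=
  ∀ v : Plane → ℝ, E.carrier.domRestrict v ∈ V →
    (∀ k : ℝ, cs * semiH1sq (interior E.carrier) v
      ≤ stab T E (fun x => v x - k) (fun x => v x - k)) ∧
    ∃ k : ℝ, stab T E (fun x => v x - k) (fun x => v x - k)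
      ≤ Cs * semiH1sq (interior E.carrier) v

/-- `p = Π^∇_E v`: `(∇(v - p), ∇w)_E = 0` for all `w ∈ ℙ₁` and `∫_{∂E} (v - p) = 0`. -/
def IsPiNabla (E : Tri) (v : Plane → ℝ) (p : P1) : Prop :=
  (∀ w : P1, ∫ x in interior E.carrier,
    inner ℝ (weakGrad (interior E.carrier) v x - p.grad) w.grad = 0) ∧
  E.boundaryIntegral (fun x => v x - p.eval x) = 0

open Classical in
/-- The projection `Π^∇_E v`. -/
def piNabla (E : Tri) (v : Plane → ℝ) : P1 :=
  if h : ∃ p, IsPiNabla E v p then h.choose else ⟨0, 0⟩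

open Classical in
/-- The affine Lagrange interpolant `𝓘_E v` at the vertices of `E`. -/
def interp (E : Tri) (v : Plane → ℝ) : P1 :=
  if h : ∃ p : P1, ∀ i, p.eval (E.vtx i) = v (E.vtx i) then h.choose else ⟨0, 0⟩

/-! ### The discrete problem -/

/-- The global virtual element space: functions of `H¹₀(Ω)` whose restriction to each closed
element `E` belongs to `V E`. -/
def MemVT (Ω : Set Plane) (T : Finset Tri) (V : ∀ E : Tri, Submodule ℝ (E.carrier → ℝ))
    (v : Plane → ℝ) : Prop :=
  MemH10 Ω v ∧ ∀ E ∈ T, E.carrier.domRestrict v ∈ V E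

/-- `a_T(v, w)`. -/
def formA (T : Finset Tri) (d : ElemCoeffs) (v w : Plane → ℝ) : ℝ :=
  ∑ E ∈ T, ∫ _x in E.carrier, inner ℝ (mulV (d.A E) (piNabla E v).grad) (piNabla E w).grad

/-- `m_T(v, w)`. -/
def formM (T : Finset Tri) (d : ElemCoeffs) (v w : Plane → ℝ) : ℝ :=
  ∑ E ∈ T, d.c E * ∫ x in E.carrier, (piNabla E v).eval x * (piNabla E w).eval x

/-- The stabilization `S_T(v, w) = ∑_E s_E(v - 𝓘_E v, w - 𝓘_E w)`. -/
def formS (T : Finset Tri) (v w : Plane → ℝ) : ℝ :=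
  ∑ E ∈ T, stab T E (fun x => v x - (interp E v).eval x) (fun x => w x - (interp E w).eval x)

/-- The discrete load `𝓕_T(v)`. -/
def load (T : Finset Tri) (d : ElemCoeffs) (v : Plane → ℝ) : ℝ :=
  ∑ E ∈ T, d.f E * ∫ x in E.carrier, (piNabla E v).eval x

/-- `uT` is the Galerkin solution for the stabilization parameter `γ`. -/
def IsGalerkin (Ω : Set Plane) (T : Finset Tri) (d : ElemCoeffs)
    (V : ∀ E : Tri, Submodule ℝ (E.carrier → ℝ)) (γ : ℝ) (uT : Plane → ℝ) : Prop :=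
  MemVT Ω T V uT ∧ ∀ v, MemVT Ω T V v →
    formA T d uT v + γ * formS T uT v + formM T d uT v = load T d v

/-! ### The residual estimator -/

open Classical in
/-- The jump residual over `e`: the sum of the normal fluxes `(A_E ∇Π^∇_E v)·n_E` from the two
elements sharing the edge `e`, and `0` if `e` lies on `∂Ω`. It is a constant on `e`. -/
def jump (Ω : Set Plane) (T : Finset Tri) (d : ElemCoeffs) (v : Plane → ℝ) (e : Sym2 Plane) : ℝ :=
  if seg e ⊆ frontier Ω then 0
  else ∑ E ∈ T with e ∈ edgesOf T E, inner ℝ (mulV (d.A E) (piNabla E v).grad) (normal E e)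

/-- The local estimator `h_E² ‖f_E - c_E Π^∇_E v‖²_{0,E} + ½ ∑_e h_E ‖j(e)‖²_{0,e}`; the jump is
constant on `e`, so its squared norm is the length of `e` times its square. -/
def etaSqLocal (Ω : Set Plane) (T : Finset Tri) (d : ElemCoeffs) (v : Plane → ℝ) (E : Tri) : ℝ :=
  E.h ^ 2 * (∫ x in E.carrier, (d.f E - d.c E * (piNabla E v).eval x) ^ 2) +
    1 / 2 * ∑ e ∈ edgesOf T E, E.h * (len e * jump Ω T d v e ^ 2)

/-- The squared global residual estimator `η_T²(v, 𝒟)`. -/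
def etaSq (Ω : Set Plane) (T : Finset Tri) (d : ElemCoeffs) (v : Plane → ℝ) : ℝ :=
  ∑ E ∈ T, etaSqLocal Ω T d v E

end AVEM

end

open AVEM

noncomputable section

namespace AVEM

open MeasureTheory Filter Topology
open scoped ContDiff

/-! ### Barycentric coordinates of a triangle -/

/-! The proof is the residual argument with localized test functions, where smooth bumps play the
role of polynomial bubbles. Write p_E for the projection Π^∇_E u_T and r_E = f_E − c_E p_E for the
element residual, which is affine. Subtracting the contribution of the p_E from the weak equation
gives, for every smooth φ with compact support in Ω, Σ_E [∫_E A_E(∇u − ∇p_E)·∇φ + c_E ∫_E (u −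
p_E)φ] = Σ_E [∫_E r_E φ − ∫_E A_E∇p_E·∇φ] (`ErrorBounds.sum_errorAction`). If φ is r_E times a bump
supported inside E, the flux term vanishes and the right side is a weighted square norm of r_E
(`ErrorBounds.exists_elemResidual_bound`). If φ is a bump around the midpoint of an interior edge,
the divergence theorem in a half plane turns the fluxes into the jump times a line integral of the
bump, and the element residuals are already under control (`ErrorBounds.exists_jump_bound`). Both
times the left side is bounded by the size of φ and its gradient times the square root of a local
error, which consists of the energy and L² norms of u − u_T on E and of the stabilization term of E
(`ErrorBounds.abs_errorAction_le`).

That bound needs control of u_T − p_E by the stabilization (`exists_local_bound`). The interpolation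
error w = u_T − I_E u_T lies in the local space, so stability bounds its gradient by its nodal
values; being affine on each edge, its trace is bounded by the nodal values too
(`IsBoundaryFunction.sq_le`). Only pairings of w with smooth functions occur. Writing such a
function as a directional derivative on E and integrating by parts reduces the pairing to the
gradient and the trace of w (`exists_trace_bound`, `exists_pairing_bound`). The passage from I_E to
Π^∇_E uses that the latter has the best constant gradient and the right boundary mean.

Admissibility enters through geometry. A hanging node inside a side of E halves a segment that lies
on this very side (`IsConforming.halves`, a statement about dyadic intervals). By induction on the
global index, the nodes divide a side at multiples of 2^(−Λ) (`GlobalIndex.exists_int`). Hence an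
element has boundedly many edges, each edge is comparable to its element, elements sharing an edge
have comparable size, and a disc around the midpoint of an interior edge is cut by exactly two
elements into half discs (`exists_neighbour`, `IsAdmissible.edgePatch`).

In the sum over the mesh each local error is charged boundedly often, and the L² norm of u − u_T is
absorbed by Poincaré's inequality in Ω. The constants involve shape regularity, the largest size in
the initial mesh, Λ, M, c_s and the Poincaré constant, but neither γ nor f. -/

/-- The cross product of the plane. -/
def cross (u v : Plane) : ℝ := u 0 * v 1 - u 1 * v 0

lemma inner_plane (u v : Plane) : inner ℝ u v = u 0 * v 0 + u 1 * v 1 := by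
  simp [PiLp.inner_apply, Fin.sum_univ_two, mul_comm]

lemma norm_sq_plane (u : Plane) : ‖u‖ ^ 2 = u 0 ^ 2 + u 1 ^ 2 := by
  simp [EuclideanSpace.norm_sq_eq, Fin.sum_univ_two]

lemma P1.eval_sub (p : P1) (x y : Plane) : p.eval x - p.eval y = inner ℝ p.grad (x - y) := by
  simp [P1.eval, inner_sub_right]

lemma P1.eval_lineMap (p : P1) (x y : Plane) (t : ℝ) :
    p.eval (AffineMap.lineMap x y t) = (1 - t) * p.eval x + t * p.eval y := by
  simp only [P1.eval, AffineMap.lineMap_apply_module, inner_add_right, inner_smul_right]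
  ring

lemma P1.continuous_eval (p : P1) : Continuous p.eval := by
  unfold P1.eval; fun_prop

lemma P1.contDiff_eval (p : P1) : ContDiff ℝ ∞ p.eval :=
  (contDiff_const.inner ℝ contDiff_id).add contDiff_const

namespace Tri

/-- Twice the signed area. -/
def det (E : Tri) : ℝ := cross (E.vtx 1 - E.vtx 0) (E.vtx 2 - E.vtx 0)

/-- The sum of the squares of the two sides at the newest vertex. -/
def sizeSq (E : Tri) : ℝ := ‖E.vtx 1 - E.vtx 0‖ ^ 2 + ‖E.vtx 2 - E.vtx 0‖ ^ 2

/-- The size of a triangle. -/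
def size (E : Tri) : ℝ := Real.sqrt E.sizeSq

/-- The vector of the side opposite to vertex `i`. -/
def side (E : Tri) (i : Fin 3) : Plane := E.vtx (i + 2) - E.vtx (i + 1)

/-- The gradient of the barycentric coordinate number `i`. -/
def baryGrad (E : Tri) (i : Fin 3) : Plane := (E.det)⁻¹ • !₂[-(E.side i 1), E.side i 0]

/-- The barycentric coordinate number `i` as an affine function. -/
def baryP (E : Tri) (i : Fin 3) : P1 :=
  ⟨E.baryGrad i, -inner ℝ (E.baryGrad i) (E.vtx (i + 1))⟩

/-- The barycentric coordinate number `i`. -/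
def bary (E : Tri) (i : Fin 3) (x : Plane) : ℝ := (E.baryP i).eval x

/-- The rotated side in `baryGrad` turns the inner product into a cross product, so a coordinate is
a quotient of signed areas. The identities below thereby become polynomial identities in the vertex
coordinates. -/
lemma bary_eq (E : Tri) (i : Fin 3) (x : Plane) :
    E.bary i x = cross (E.side i) (x - E.vtx (i + 1)) / E.det := by
  simp only [bary, baryP, P1.eval, baryGrad, inner_plane, cross]
  simp
  ring

lemma bary_sub (E : Tri) (i : Fin 3) (x y : Plane) :
    E.bary i x - E.bary i y = inner ℝ (E.baryGrad i) (x - y) :=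
  P1.eval_sub _ _ _

lemma continuous_bary (E : Tri) (i : Fin 3) : Continuous (E.bary i) := P1.continuous_eval _

lemma bary_lineMap (E : Tri) (i : Fin 3) (x y : Plane) (t : ℝ) :
    E.bary i (AffineMap.lineMap x y t) = (1 - t) * E.bary i x + t * E.bary i y :=
  P1.eval_lineMap _ _ _ _

lemma norm_baryGrad (E : Tri) (i : Fin 3) : ‖E.baryGrad i‖ = ‖E.side i‖ / |E.det| := by
  rw [baryGrad, norm_smul, norm_inv, Real.norm_eq_abs, div_eq_inv_mul]
  congr 1
  rw [← sq_eq_sq₀ (norm_nonneg _) (norm_nonneg _), norm_sq_plane, norm_sq_plane]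
  simp
  ring

variable {E : Tri}

lemma sum_bary (hE : E.det ≠ 0) (x : Plane) : E.bary 0 x + E.bary 1 x + E.bary 2 x = 1 := by
  simp only [bary_eq, side, det, cross] at *
  rw [← add_div, ← add_div, div_eq_one_iff_eq hE]
  simp
  ring

lemma sum_bary_smul (hE : E.det ≠ 0) (x : Plane) :
    E.bary 0 x • E.vtx 0 + E.bary 1 x • E.vtx 1 + E.bary 2 x • E.vtx 2 = x := by
  simp only [bary_eq, side, det, cross] at *
  ext k
  fin_cases k <;> simp at hE ⊢ <;> field_simp <;> ring

lemma bary_vtx_self (hE : E.det ≠ 0) (i : Fin 3) : E.bary i (E.vtx i) = 1 := by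
  rw [bary_eq, div_eq_one_iff_eq hE]
  fin_cases i <;> simp [side, det, cross] <;> ring

lemma bary_vtx_ne {i j : Fin 3} (h : j ≠ i) : E.bary i (E.vtx j) = 0 := by
  rw [bary_eq]
  fin_cases i <;> fin_cases j <;> simp [side, cross] at h ⊢ <;> left <;> ring

lemma carrier_eq (hE : E.det ≠ 0) : E.carrier = {x | ∀ i, 0 ≤ E.bary i x} := by
  apply Set.Subset.antisymm
  · refine convexHull_min ?_ ?_
    · rintro _ ⟨j, rfl⟩ i
      by_cases h : j = i
      · subst h; rw [bary_vtx_self hE]; norm_num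
      · rw [bary_vtx_ne h]
    · intro x hx y hy a b ha hb hab i
      have : a • x + b • y = AffineMap.lineMap (k := ℝ) x y b := by
        rw [AffineMap.lineMap_apply_module, ← hab, add_sub_cancel_right]
      rw [this, bary_lineMap, ← hab, add_sub_cancel_right]
      have := hx i; have := hy i; positivity
  · intro x hx
    rw [← sum_bary_smul hE x]
    have := (convex_convexHull ℝ (Set.range E.vtx)).sum_mem (t := Finset.univ)
      (w := fun i => E.bary i x) (z := E.vtx) (fun i _ => hx i)
      (by rw [Fin.sum_univ_three]; exact sum_bary hE x)
      (fun i _ => subset_convexHull ℝ _ ⟨i, rfl⟩)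
    rwa [Fin.sum_univ_three] at this

lemma vtx_mem (E : Tri) (i : Fin 3) : E.vtx i ∈ E.carrier := subset_convexHull ℝ _ ⟨i, rfl⟩

lemma convex_carrier (E : Tri) : Convex ℝ E.carrier := convex_convexHull ℝ _

lemma isCompact_carrier (E : Tri) : IsCompact E.carrier :=
  Set.Finite.isCompact_convexHull (𝕜 := ℝ) (Set.finite_range _)

lemma isClosed_carrier (E : Tri) : IsClosed E.carrier := E.isCompact_carrier.isClosed

lemma interior_eq (hE : E.det ≠ 0) : interior E.carrier = {x | ∀ i, 0 < E.bary i x} := by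
  apply Set.Subset.antisymm
  · intro x hx i
    -- Move `x` slightly away from vertex `i`. The new point is still in the triangle and its
    -- coordinate is (1 + t) times the old one minus t, which forces the old one to be positive.
    have hc : ContinuousAt (fun t : ℝ => AffineMap.lineMap x (E.vtx i) (-t)) 0 := by
      simp only [AffineMap.lineMap_apply_module]; fun_prop
    have h0 : AffineMap.lineMap (k := ℝ) x (E.vtx i) (-(0 : ℝ)) = x := by simp
    have h1 : ∀ᶠ t : ℝ in 𝓝 0, AffineMap.lineMap x (E.vtx i) (-t) ∈ E.carrier := by
      apply hc.eventually_mem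
      rw [h0]; exact mem_interior_iff_mem_nhds.1 hx
    have h2 : ∀ᶠ t : ℝ in 𝓝[>] 0, AffineMap.lineMap x (E.vtx i) (-t) ∈ E.carrier ∧ 0 < t :=
      (h1.filter_mono nhdsWithin_le_nhds).and self_mem_nhdsWithin
    obtain ⟨t, ht, ht0⟩ := h2.exists
    rw [carrier_eq hE] at ht
    have := ht i
    rw [bary_lineMap, bary_vtx_self hE] at this
    have : 0 < (1 + t) * E.bary i x := by linarith
    exact pos_of_mul_pos_right this (by linarith)
  · refine interior_maximal (fun x hx => ?_) ?_
    · rw [carrier_eq hE]; exact fun i => (hx i).le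
    · simp only [Set.ofPred_forall]
      exact isOpen_iInter_of_finite fun i => isOpen_lt continuous_const (E.continuous_bary i)

lemma mem_frontier_iff (hE : E.det ≠ 0) (x : Plane) :
    x ∈ frontier E.carrier ↔ x ∈ E.carrier ∧ ∃ i, E.bary i x = 0 := by
  rw [E.isClosed_carrier.frontier_eq, interior_eq hE, Set.mem_sdiff, carrier_eq hE]
  constructor
  · rintro ⟨h1, h2⟩
    simp only [Set.mem_ofPred_eq, not_forall, not_lt] at h2
    obtain ⟨i, hi⟩ := h2
    exact ⟨h1, i, le_antisymm hi (h1 i)⟩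
  · rintro ⟨h1, i, hi⟩
    exact ⟨h1, fun h => (h i).ne' hi⟩

lemma det_ne_zero (h : AffineIndependent ℝ E.vtx) : E.det ≠ 0 := by
  intro h0
  rw [affineIndependent_iff] at h
  have key : ∀ s t : ℝ, s • (E.vtx 1 - E.vtx 0) + t • (E.vtx 2 - E.vtx 0) = 0 → s = 0 ∧ t = 0 := by
    intro s t hst
    have := h Finset.univ ![-(s + t), s, t] (by simp [Fin.sum_univ_three])
      (by rw [Fin.sum_univ_three]; simp; rw [← hst]; module)
    exact ⟨by simpa using this 1 (Finset.mem_univ _), by simpa using this 2 (Finset.mem_univ _)⟩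
  simp only [det, cross] at h0
  set a := E.vtx 1 - E.vtx 0
  set b := E.vtx 2 - E.vtx 0
  -- With vanishing cross product both b₀a − a₀b and b₁a − a₁b are zero. Independence kills all four
  -- coordinates, so a + b = 0 is a nontrivial relation.
  obtain ⟨h1, h2⟩ := key (b 0) (-(a 0)) (by ext k; fin_cases k <;> simp <;> linarith)
  obtain ⟨h3, h4⟩ := key (b 1) (-(a 1)) (by ext k; fin_cases k <;> simp <;> linarith)
  have := key 1 1 (by ext k; fin_cases k <;> simp <;> linarith)
  norm_num at this


lemma ext_bary (hE : E.det ≠ 0) {x y : Plane} (h : ∀ i, E.bary i x = E.bary i y) : x = y := by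
  rw [← sum_bary_smul hE x, ← sum_bary_smul hE y, h, h, h]

lemma sum_bary' (hE : E.det ≠ 0) (i : Fin 3) (x : Plane) :
    E.bary i x + E.bary (i + 1) x + E.bary (i + 2) x = 1 := by
  have := sum_bary hE x
  fin_cases i <;> simp <;> linarith

/-! ### Metric properties of shape regular triangles -/

/-- The triangle is nondegenerate and its aspect ratio is controlled by `ρ`. -/
structure IsShape (ρ : ℝ) (E : Tri) : Prop where
  det_ne : E.det ≠ 0
  le : E.sizeSq ≤ ρ * |E.det|

lemma sizeSq_nonneg (E : Tri) : 0 ≤ E.sizeSq := by unfold sizeSq; positivity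

lemma size_sq (E : Tri) : E.size ^ 2 = E.sizeSq := Real.sq_sqrt E.sizeSq_nonneg

lemma size_nonneg (E : Tri) : 0 ≤ E.size := Real.sqrt_nonneg _

lemma abs_det_le (E : Tri) : 2 * |E.det| ≤ E.sizeSq := by
  unfold sizeSq det cross
  rw [norm_sq_plane, norm_sq_plane]
  set a := E.vtx 1 - E.vtx 0
  set b := E.vtx 2 - E.vtx 0
  rcases abs_cases (a 0 * b 1 - a 1 * b 0) with ⟨h, _⟩ | ⟨h, _⟩ <;> rw [h]
  · nlinarith [sq_nonneg (a 0 - b 1), sq_nonneg (a 1 + b 0)]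
  · nlinarith [sq_nonneg (a 0 + b 1), sq_nonneg (a 1 - b 0)]

lemma size_pos (hE : E.det ≠ 0) : 0 < E.size := by
  apply Real.sqrt_pos.2
  have := abs_det_le E
  have := abs_pos.2 hE
  linarith

lemma IsShape.two_le {ρ : ℝ} (h : IsShape ρ E) : 2 ≤ ρ := by
  have := abs_det_le E
  have := h.le
  have := abs_pos.2 h.det_ne
  by_contra! hh
  nlinarith

lemma norm_side_le (E : Tri) (i : Fin 3) : ‖E.side i‖ ≤ 2 * E.size := by
  have h1 : ‖E.vtx 1 - E.vtx 0‖ ≤ E.size := by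
    apply Real.le_sqrt_of_sq_le; unfold sizeSq; nlinarith [sq_nonneg ‖E.vtx 2 - E.vtx 0‖]
  have h2 : ‖E.vtx 2 - E.vtx 0‖ ≤ E.size := by
    apply Real.le_sqrt_of_sq_le; unfold sizeSq; nlinarith [sq_nonneg ‖E.vtx 1 - E.vtx 0‖]
  have h0 := E.size_nonneg
  fin_cases i <;> simp [side]
  · calc ‖E.vtx 2 - E.vtx 1‖ = ‖(E.vtx 2 - E.vtx 0) - (E.vtx 1 - E.vtx 0)‖ := by congr 1; abel
      _ ≤ _ := norm_sub_le _ _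
      _ ≤ _ := by linarith
  · rw [norm_sub_rev]; linarith
  · linarith

lemma carrier_subset_closedBall (E : Tri) : E.carrier ⊆ Metric.closedBall (E.vtx 0) E.size := by
  refine convexHull_min ?_ (convex_closedBall _ _)
  rintro _ ⟨i, rfl⟩
  rw [Metric.mem_closedBall, dist_eq_norm]
  apply Real.le_sqrt_of_sq_le; unfold sizeSq
  fin_cases i <;> simp <;> positivity

lemma dist_le (E : Tri) {x y : Plane} (hx : x ∈ E.carrier) (hy : y ∈ E.carrier) :
    dist x y ≤ 2 * E.size := by
  have h1 := E.carrier_subset_closedBall hx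
  have h2 := E.carrier_subset_closedBall hy
  rw [Metric.mem_closedBall] at h1 h2
  linarith [dist_triangle_right x y (E.vtx 0)]

variable {ρ : ℝ}

lemma IsShape.norm_baryGrad_le (h : IsShape ρ E) (i : Fin 3) :
    ‖E.baryGrad i‖ ≤ 2 * ρ / E.size := by
  have h0 := size_pos h.det_ne
  have hd := abs_pos.2 h.det_ne
  rw [norm_baryGrad, div_le_div_iff₀ hd h0]
  have := h.le
  rw [← size_sq] at this
  nlinarith [norm_side_le E i]

lemma IsShape.abs_bary_sub_le (h : IsShape ρ E) (i : Fin 3) (x y : Plane) :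
    |E.bary i x - E.bary i y| ≤ 2 * ρ / E.size * dist x y := by
  rw [bary_sub, dist_eq_norm]
  exact (abs_real_inner_le_norm _ _).trans
    (mul_le_mul_of_nonneg_right (h.norm_baryGrad_le i) (norm_nonneg _))

/-- Coordinates are Lipschitz with constant 2ρ/size. Used with τ = 1/3 at the barycenter for the
inscribed disc, and with τ = 2^(−Λ−1) at edge midpoints for the half discs. -/
lemma IsShape.pos_of_near (h : IsShape ρ E) {x y : Plane} {τ : ℝ} {i : Fin 3}
    (hx : τ ≤ E.bary i x) (hy : dist y x < τ * E.size / (2 * ρ)) : 0 < E.bary i y := by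
  have h1 := h.abs_bary_sub_le i y x
  have h0 := size_pos h.det_ne
  have h2 := h.two_le
  rw [lt_div_iff₀ (by linarith)] at hy
  have : 2 * ρ / E.size * dist y x < τ := by
    rw [div_mul_eq_mul_div, div_lt_iff₀ h0]; linarith
  linarith [abs_le.1 h1]

/-- The barycenter. -/
def center (E : Tri) : Plane := (1 / 3 : ℝ) • (E.vtx 0 + E.vtx 1 + E.vtx 2)

lemma bary_center (hE : E.det ≠ 0) (i : Fin 3) : E.bary i E.center = 1 / 3 := by
  rw [bary_eq, div_eq_div_iff hE (by norm_num)]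
  fin_cases i <;> simp [side, det, cross, center] <;> ring

lemma IsShape.ball_subset (h : IsShape ρ E) :
    Metric.ball E.center (E.size / (6 * ρ)) ⊆ interior E.carrier := by
  intro y hy
  rw [interior_eq h.det_ne]
  intro i
  refine h.pos_of_near (τ := 1 / 3) (bary_center h.det_ne i).ge ?_
  rw [Metric.mem_ball] at hy
  convert hy using 1
  have := h.two_le
  field_simp
  ring

/-! ### Areas and null boundaries of triangles -/

/-- The area of the unit disc. -/
def discArea : ℝ := volume.real (Metric.ball (0 : Plane) 1)

lemma discArea_pos : 0 < discArea :=
  ENNReal.toReal_pos (Metric.measure_ball_pos _ _ one_pos).ne' measure_ball_lt_top.ne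

lemma volume_real_ball (x : Plane) {r : ℝ} (hr : 0 ≤ r) :
    volume.real (Metric.ball x r) = r ^ 2 * discArea := by
  rw [Measure.real, Measure.addHaar_ball _ _ hr]
  simp [discArea, Measure.real, hr]

lemma volume_carrier_lt_top (E : Tri) : volume E.carrier < ⊤ := E.isCompact_carrier.measure_lt_top

lemma volume_carrier_le (E : Tri) : volume.real E.carrier ≤ E.size ^ 2 * discArea := by
  refine (measureReal_mono E.carrier_subset_closedBall
    (isCompact_closedBall _ _).measure_lt_top.ne).trans ?_
  rw [Measure.addHaar_real_closedBall _ _ E.size_nonneg]; simp [discArea]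

lemma IsShape.le_volume_carrier (h : IsShape ρ E) :
    (E.size / (6 * ρ)) ^ 2 * discArea ≤ volume.real E.carrier := by
  have := h.two_le
  have h0 := size_pos h.det_ne
  rw [← volume_real_ball E.center (by positivity)]
  exact measureReal_mono (h.ball_subset.trans interior_subset) E.volume_carrier_lt_top.ne

lemma volume_frontier (E : Tri) : volume (frontier E.carrier) = 0 :=
  E.convex_carrier.addHaar_frontier _

lemma interior_ae_eq (E : Tri) : interior E.carrier =ᵐ[volume] E.carrier :=
  interior_ae_eq_of_null_frontier E.volume_frontier

lemma restrict_interior (E : Tri) :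
    (volume : Measure Plane).restrict (interior E.carrier) = volume.restrict E.carrier :=
  Measure.restrict_congr_set E.interior_ae_eq

lemma closure_interior (hE : E.det ≠ 0) : closure (interior E.carrier) = E.carrier := by
  rw [E.convex_carrier.closure_interior_eq_closure_of_nonempty_interior,
    E.isClosed_carrier.closure_eq]
  refine ⟨E.center, ?_⟩
  rw [interior_eq hE]
  intro i; rw [bary_center hE]; norm_num

end Tri

end AVEM

namespace AVEM

open MeasureTheory Filter Topology
open scoped ContDiff

namespace Tri

/-! ### Bisection in barycentric coordinates -/

variable {E : Tri} {ρ : ℝ}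

lemma det_child₁ (E : Tri) : E.child₁.det = E.det / 2 := by
  simp [det, child₁, mid, cross, midpoint_eq_smul_add]; ring

lemma det_child₂ (E : Tri) : E.child₂.det = E.det / 2 := by
  simp [det, child₂, mid, cross, midpoint_eq_smul_add]; ring

lemma sizeSq_child₁ (E : Tri) : E.child₁.sizeSq = E.sizeSq / 2 := by
  simp [sizeSq, child₁, mid, norm_sq_plane, midpoint_eq_smul_add]; ring

lemma sizeSq_child₂ (E : Tri) : E.child₂.sizeSq = E.sizeSq / 2 := by
  simp [sizeSq, child₂, mid, norm_sq_plane, midpoint_eq_smul_add]; ring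

lemma IsShape.child₁ (h : IsShape ρ E) : IsShape ρ E.child₁ := by
  refine ⟨by rw [det_child₁]; exact div_ne_zero h.det_ne two_ne_zero, ?_⟩
  rw [det_child₁, sizeSq_child₁, abs_div, abs_two]; linarith [h.le]

lemma IsShape.child₂ (h : IsShape ρ E) : IsShape ρ E.child₂ := by
  refine ⟨by rw [det_child₂]; exact div_ne_zero h.det_ne two_ne_zero, ?_⟩
  rw [det_child₂, sizeSq_child₂, abs_div, abs_two]; linarith [h.le]

lemma bary_child₁ (hE : E.det ≠ 0) (x : Plane) :
    E.child₁.bary 0 x = 2 * E.bary 2 x ∧ E.child₁.bary 1 x = E.bary 0 x ∧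
      E.child₁.bary 2 x = E.bary 1 x - E.bary 2 x := by
  simp only [bary_eq, det_child₁]
  refine ⟨?_, ?_, ?_⟩ <;> field_simp <;>
    simp [side, Tri.child₁, mid, cross, midpoint_eq_smul_add] <;> ring

lemma bary_child₂ (hE : E.det ≠ 0) (x : Plane) :
    E.child₂.bary 0 x = 2 * E.bary 1 x ∧ E.child₂.bary 1 x = E.bary 2 x - E.bary 1 x ∧
      E.child₂.bary 2 x = E.bary 0 x := by
  simp only [bary_eq, det_child₂]
  refine ⟨?_, ?_, ?_⟩ <;> field_simp <;>
    simp [side, Tri.child₂, mid, cross, midpoint_eq_smul_add] <;> ring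

lemma det_child₁_ne (hE : E.det ≠ 0) : E.child₁.det ≠ 0 := by
  rw [det_child₁]; exact div_ne_zero hE two_ne_zero

lemma det_child₂_ne (hE : E.det ≠ 0) : E.child₂.det ≠ 0 := by
  rw [det_child₂]; exact div_ne_zero hE two_ne_zero

lemma child₁_subset (hE : E.det ≠ 0) : E.child₁.carrier ⊆ E.carrier := by
  intro x
  rw [carrier_eq hE, carrier_eq (det_child₁_ne hE)]
  simp only [Set.mem_ofPred_eq, Fin.forall_fin_succ, Fin.isValue, IsEmpty.forall_iff, and_true]
  obtain ⟨h0, h1, h2⟩ := bary_child₁ hE x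
  simp [h0, h1, h2]
  intro _ _ _; exact ⟨by linarith, by linarith, by linarith⟩

lemma child₂_subset (hE : E.det ≠ 0) : E.child₂.carrier ⊆ E.carrier := by
  intro x
  rw [carrier_eq hE, carrier_eq (det_child₂_ne hE)]
  simp only [Set.mem_ofPred_eq, Fin.forall_fin_succ, Fin.isValue, IsEmpty.forall_iff, and_true]
  obtain ⟨h0, h1, h2⟩ := bary_child₂ hE x
  simp [h0, h1, h2]
  intro _ _ _; exact ⟨by linarith, by linarith, by linarith⟩

lemma carrier_eq_union (hE : E.det ≠ 0) :
    E.carrier = E.child₁.carrier ∪ E.child₂.carrier := by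
  apply Set.Subset.antisymm _ (Set.union_subset (child₁_subset hE) (child₂_subset hE))
  intro x
  rw [carrier_eq hE, carrier_eq (det_child₁_ne hE), carrier_eq (det_child₂_ne hE)]
  simp only [Set.mem_union, Set.mem_ofPred_eq, Fin.forall_fin_succ, Fin.isValue,
    IsEmpty.forall_iff, and_true]
  obtain ⟨h0, h1, h2⟩ := bary_child₁ hE x
  obtain ⟨h3, h4, h5⟩ := bary_child₂ hE x
  simp [h0, h1, h2, h3, h4, h5]
  intro _ _ _
  rcases le_total (E.bary 2 x) (E.bary 1 x) with h | h
  · left; exact ⟨by linarith, by linarith, by linarith⟩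
  · right; exact ⟨by linarith, by linarith, by linarith⟩

lemma bary_of_mem_children (hE : E.det ≠ 0) {x : Plane} (h₁ : x ∈ E.child₁.carrier)
    (h₂ : x ∈ E.child₂.carrier) : E.child₁.bary 2 x = 0 ∧ E.child₂.bary 1 x = 0 := by
  rw [carrier_eq (det_child₁_ne hE)] at h₁
  rw [carrier_eq (det_child₂_ne hE)] at h₂
  have h1 := h₁ 2
  have h2 := h₂ 1
  rw [(bary_child₁ hE x).2.2] at h1 ⊢
  rw [(bary_child₂ hE x).2.1] at h2 ⊢
  constructor <;> linarith

lemma disjoint_children (hE : E.det ≠ 0) :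
    Disjoint (interior E.child₁.carrier) (interior E.child₂.carrier) := by
  rw [Set.disjoint_left]
  intro x h1 h2
  have := (bary_of_mem_children hE (interior_subset h1) (interior_subset h2)).1
  rw [interior_eq (det_child₁_ne hE)] at h1
  exact (h1 2).ne' this

lemma interior_nonempty (hE : E.det ≠ 0) : (interior E.carrier).Nonempty := by
  refine ⟨E.center, ?_⟩
  rw [interior_eq hE]
  intro i; rw [bary_center hE]; norm_num

/-- Side `i` joins the vertices `i + 1` and `i + 2` cyclically. These facts replace case
distinctions over the three sides. -/
lemma fin_three_cases (k i : Fin 3) : i = k ∨ i = k + 1 ∨ i = k + 2 := by decide +revert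

lemma fin_ne_add_one (k : Fin 3) : k ≠ k + 1 := by decide +revert

lemma fin_ne_add_two (k : Fin 3) : k ≠ k + 2 := by decide +revert

lemma fin_add_one_ne_add_two (k : Fin 3) : k + 1 ≠ k + 2 := by decide +revert

/-- A vertex of a triangle that lies in a subtriangle is a vertex of it. -/
lemma vtx_mem_range {P : Tri} (hP : P.det ≠ 0) (hE : E.det ≠ 0) (hEP : E.carrier ⊆ P.carrier)
    {k : Fin 3} (h : P.vtx k ∈ E.carrier) : P.vtx k ∈ Set.range E.vtx := by
  -- On the subtriangle the function `P.bary k` is at most 1, with equality only at `P.vtx k`. A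
  -- convex combination of its values at the vertices of `E` can equal 1 only if one of these values
  -- does.
  have hle : ∀ y ∈ E.carrier, P.bary k y ≤ 1 := by
    intro y hy
    have := hEP hy
    rw [carrier_eq hP] at this
    have h1 := sum_bary' hP k y
    linarith [this (k + 1), this (k + 2)]
  have huniq : ∀ y ∈ E.carrier, P.bary k y = 1 → y = P.vtx k := by
    intro y hy hy1
    have hm := hEP hy
    rw [carrier_eq hP] at hm
    have h1 := sum_bary' hP k y
    have h2 := hm (k + 1); have h3 := hm (k + 2)
    refine ext_bary hP fun i => ?_
    rcases fin_three_cases k i with rfl | rfl | rfl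
    · rw [hy1, bary_vtx_self hP]
    · rw [bary_vtx_ne (fin_ne_add_one k)]; linarith
    · rw [bary_vtx_ne (fin_ne_add_two k)]; linarith
  have hs : P.bary k (P.vtx k) = E.bary 0 (P.vtx k) * P.bary k (E.vtx 0)
      + E.bary 1 (P.vtx k) * P.bary k (E.vtx 1) + E.bary 2 (P.vtx k) * P.bary k (E.vtx 2) := by
    conv_lhs => rw [← sum_bary_smul hE (P.vtx k)]
    have := sum_bary hE (P.vtx k)
    simp only [bary, P1.eval, inner_add_right, inner_smul_right] at this ⊢
    linear_combination -(P.baryP k).const * this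
  rw [bary_vtx_self hP] at hs
  have hb := h
  rw [carrier_eq hE] at hb
  have hsum := sum_bary hE (P.vtx k)
  by_contra hne
  have hlt : ∀ j, P.bary k (E.vtx j) < 1 := fun j =>
    lt_of_le_of_ne (hle _ (E.vtx_mem j)) fun h1 => hne ⟨j, huniq _ (E.vtx_mem j) h1⟩
  have h0 := hb 0; have h1 := hb 1; have h2 := hb 2
  have l0 := hlt 0; have l1 := hlt 1; have l2 := hlt 2
  have m0 := mul_nonneg h0 (sub_nonneg.2 l0.le)
  have m1 := mul_nonneg h1 (sub_nonneg.2 l1.le)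
  have m2 := mul_nonneg h2 (sub_nonneg.2 l2.le)
  have z0 : E.bary 0 (P.vtx k) = 0 :=
    (mul_eq_zero.1 (le_antisymm (by linarith) m0)).resolve_right (sub_pos.2 l0).ne'
  have z1 : E.bary 1 (P.vtx k) = 0 :=
    (mul_eq_zero.1 (le_antisymm (by linarith) m1)).resolve_right (sub_pos.2 l1).ne'
  have z2 : E.bary 2 (P.vtx k) = 0 :=
    (mul_eq_zero.1 (le_antisymm (by linarith) m2)).resolve_right (sub_pos.2 l2).ne'
  linarith

end Tri

/-! ### The forest -/

variable {T₀ T : Finset Tri}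

/-- A forest with a single root expresses descent: `InForest {P} K` means that `K` is `P` or a
descendant of `P`. -/
lemma InForest.self (E : Tri) : InForest {E} E := .root E (Finset.mem_singleton_self _)

lemma InForest.exists_root {K : Tri} (h : InForest T₀ K) : ∃ P ∈ T₀, InForest {P} K := by
  induction h with
  | root K hK => exact ⟨K, hK, .self K⟩
  | left K _ ih => obtain ⟨P, hP, h⟩ := ih; exact ⟨P, hP, h.left⟩
  | right K _ ih => obtain ⟨P, hP, h⟩ := ih; exact ⟨P, hP, h.right⟩

/-- The constructors expose the last bisection; this exposes the first one. -/
lemma InForest.cases_child {P E : Tri} (h : InForest {P} E) :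
    E = P ∨ InForest {P.child₁} E ∨ InForest {P.child₂} E := by
  induction h with
  | root K hK => exact Or.inl (Finset.mem_singleton.1 hK)
  | left K _ ih =>
    rcases ih with rfl | h | h
    · exact Or.inr (Or.inl (.self _))
    · exact Or.inr (Or.inl h.left)
    · exact Or.inr (Or.inr h.left)
  | right K _ ih =>
    rcases ih with rfl | h | h
    · exact Or.inr (Or.inr (.self _))
    · exact Or.inr (Or.inl h.right)
    · exact Or.inr (Or.inr h.right)

/-- Follow the two lines of descent from the root until they part. Either one never leaves the
other, or they part at some `Q`, whose two children then separate them. -/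
lemma InForest.nested_or {P E K : Tri} (hK : InForest {P} K) (hE : InForest {P} E) :
    InForest {K} E ∨ InForest {E} K ∨ ∃ Q, InForest {P} Q ∧
      ((InForest {Q.child₁} K ∧ InForest {Q.child₂} E) ∨
        (InForest {Q.child₂} K ∧ InForest {Q.child₁} E)) := by
  induction hK with
  | root K hK => rw [Finset.mem_singleton.1 hK]; exact Or.inl hE
  | left K hKP ih =>
    rcases ih with h | h | ⟨Q, hQ, ⟨h1, h2⟩ | ⟨h1, h2⟩⟩
    · rcases h.cases_child with rfl | h | h
      · exact Or.inr (Or.inl (InForest.self _).left)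
      · exact Or.inl h
      · exact Or.inr (Or.inr ⟨K, hKP, Or.inl ⟨.self _, h⟩⟩)
    · exact Or.inr (Or.inl h.left)
    · exact Or.inr (Or.inr ⟨Q, hQ, Or.inl ⟨h1.left, h2⟩⟩)
    · exact Or.inr (Or.inr ⟨Q, hQ, Or.inr ⟨h1.left, h2⟩⟩)
  | right K hKP ih =>
    rcases ih with h | h | ⟨Q, hQ, ⟨h1, h2⟩ | ⟨h1, h2⟩⟩
    · rcases h.cases_child with rfl | h | h
      · exact Or.inr (Or.inl (InForest.self _).right)
      · exact Or.inr (Or.inr ⟨K, hKP, Or.inr ⟨.self _, h⟩⟩)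
      · exact Or.inl h
    · exact Or.inr (Or.inl h.right)
    · exact Or.inr (Or.inr ⟨Q, hQ, Or.inl ⟨h1.right, h2⟩⟩)
    · exact Or.inr (Or.inr ⟨Q, hQ, Or.inr ⟨h1.right, h2⟩⟩)

lemma InForest.det_ne {P K : Tri} (h : InForest {P} K) (hP : P.det ≠ 0) : K.det ≠ 0 := by
  induction h with
  | root K hK => rwa [Finset.mem_singleton.1 hK]
  | left K _ ih => exact Tri.det_child₁_ne ih
  | right K _ ih => exact Tri.det_child₂_ne ih

lemma InForest.subset {P K : Tri} (h : InForest {P} K) (hP : P.det ≠ 0) :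
    K.carrier ⊆ P.carrier := by
  induction h with
  | root K hK => rw [Finset.mem_singleton.1 hK]
  | left K h ih => exact (Tri.child₁_subset (h.det_ne hP)).trans ih
  | right K h ih => exact (Tri.child₂_subset (h.det_ne hP)).trans ih

lemma IsConforming.det_ne (hT₀ : IsConforming T₀) {P : Tri} (hP : P ∈ T₀) : P.det ≠ 0 :=
  Tri.det_ne_zero (hT₀.nondegenerate P hP)

/-- Newest-vertex bisection is shape regular. -/
lemma IsConforming.exists_shape (hT₀ : IsConforming T₀) :
    ∃ ρ L : ℝ, 2 ≤ ρ ∧ 0 < L ∧ ∀ K, InForest T₀ K → K.IsShape ρ ∧ K.size ≤ L := by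
  have hr : ∃ ρ : ℝ, 2 ≤ ρ ∧ ∀ P ∈ T₀, P.sizeSq / |P.det| ≤ ρ := by
    obtain ⟨ρ, h⟩ := (T₀.image fun P => P.sizeSq / |P.det|).exists_le
    refine ⟨max ρ 2, le_max_right _ _, fun P hP => (h _ ?_).trans (le_max_left _ _)⟩
    exact Finset.mem_image_of_mem _ hP
  have hL : ∃ L : ℝ, 0 < L ∧ ∀ P ∈ T₀, P.sizeSq ≤ L ^ 2 := by
    obtain ⟨L, h⟩ := (T₀.image fun P => P.size).exists_le
    refine ⟨max L 1, by positivity, fun P hP => ?_⟩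
    rw [← P.size_sq]
    have := (h _ (Finset.mem_image_of_mem _ hP)).trans (le_max_left L 1)
    gcongr
    exact P.size_nonneg
  obtain ⟨ρ, hρ, h1⟩ := hr
  obtain ⟨L, hL, h2⟩ := hL
  refine ⟨ρ, L, hρ, hL, fun K hK => ?_⟩
  suffices K.IsShape ρ ∧ K.sizeSq ≤ L ^ 2 from ⟨this.1, Real.sqrt_le_iff.2 ⟨hL.le, this.2⟩⟩
  -- Bisection halves both `sizeSq` and `det`, so their ratio, and with it the shape constant, is
  -- inherited unchanged from the roots.
  induction hK with
  | root K hK =>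
    have hd := hT₀.det_ne hK
    exact ⟨⟨hd, (div_le_iff₀ (abs_pos.2 hd)).1 (h1 K hK)⟩, h2 K hK⟩
  | left K _ ih =>
    refine ⟨ih.1.child₁, ?_⟩
    rw [Tri.sizeSq_child₁]; linarith [K.sizeSq_nonneg, ih.2]
  | right K _ ih =>
    refine ⟨ih.1.child₂, ?_⟩
    rw [Tri.sizeSq_child₂]; linarith [K.sizeSq_nonneg, ih.2]

/-! ### Refinements are tilings -/

/-- `T` is a tiling of the closure of `domain T₀` by triangles of the forest. -/
structure IsTiling (T₀ T : Finset Tri) : Prop where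
  inForest : ∀ E ∈ T, InForest T₀ E
  disjoint : ∀ E ∈ T, ∀ E' ∈ T, E ≠ E' → Disjoint (interior E.carrier) (interior E'.carrier)
  union_eq : ⋃ E ∈ T, E.carrier = ⋃ E ∈ T₀, E.carrier

lemma InForest.det_ne' (hT₀ : IsConforming T₀) {K : Tri} (h : InForest T₀ K) : K.det ≠ 0 := by
  obtain ⟨P, hP, h⟩ := h.exists_root
  exact h.det_ne (hT₀.det_ne hP)

/-- Everything later about the mesh starts from these three invariants rather than from the sequence
of bisections. -/
lemma IsRefinement.isTiling (hT₀ : IsConforming T₀) (h : IsRefinement T₀ T) :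
    IsTiling T₀ T := by
  classical
  induction h with
  | refl => exact ⟨fun E hE => .root E hE, hT₀.disjoint, rfl⟩
  | bisect T E _ hE ih =>
    have hd := (ih.inForest E hE).det_ne' hT₀
    have hs1 := interior_mono (Tri.child₁_subset hd)
    have hs2 := interior_mono (Tri.child₂_subset hd)
    refine ⟨?_, ?_, ?_⟩
    · intro K hK
      simp only [Finset.mem_insert, Finset.mem_erase] at hK
      rcases hK with rfl | rfl | ⟨_, hK⟩
      · exact (ih.inForest E hE).left
      · exact (ih.inForest E hE).right
      · exact ih.inForest K hK
    · have hc := Tri.disjoint_children hd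
      intro K hK K' hK' hne
      simp only [Finset.mem_insert, Finset.mem_erase] at hK hK'
      rcases hK with rfl | rfl | ⟨h1, h2⟩ <;> rcases hK' with rfl | rfl | ⟨h3, h4⟩
      · exact absurd rfl hne
      · exact hc
      · exact (ih.disjoint E hE K' h4 (Ne.symm h3)).mono_left hs1
      · exact hc.symm
      · exact absurd rfl hne
      · exact (ih.disjoint E hE K' h4 (Ne.symm h3)).mono_left hs2
      · exact (ih.disjoint K h2 E hE h1).mono_right hs1
      · exact (ih.disjoint K h2 E hE h1).mono_right hs2
      · exact ih.disjoint K h2 K' h4 hne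
    · rw [← ih.union_eq, Finset.set_biUnion_insert, Finset.set_biUnion_insert, ← Set.union_assoc,
        ← Tri.carrier_eq_union hd]
      conv_rhs => rw [← Finset.insert_erase hE, Finset.set_biUnion_insert]

lemma IsTiling.interior_subset (h : IsTiling T₀ T) {E : Tri} (hE : E ∈ T) :
    interior E.carrier ⊆ domain T₀ := by
  unfold domain
  rw [← h.union_eq]
  exact interior_mono (Set.subset_biUnion_of_mem (u := fun E : Tri => E.carrier) hE)

lemma isOpen_domain (T₀ : Finset Tri) : IsOpen (domain T₀) := isOpen_interior

lemma isBounded_domain (T₀ : Finset Tri) : Bornology.IsBounded (domain T₀) := by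
  refine Bornology.IsBounded.subset ?_ interior_subset
  exact (Bornology.isBounded_biUnion_finset T₀).2 fun E _ => E.isCompact_carrier.isBounded

/-- The boundaries of finitely many triangles are null sets. This lets integrals over the domain be
taken over disjoint open sets. -/
lemma IsTiling.domain_ae_eq (h : IsTiling T₀ T) :
    domain T₀ =ᵐ[volume] ⋃ E ∈ T, interior E.carrier := by
  refine Filter.EventuallyLE.antisymm ?_ ?_
  · have h0 : volume (⋃ E ∈ T, frontier E.carrier) = 0 :=
      (measure_biUnion_null_iff T.countable_toSet).2 fun E _ => E.volume_frontier
    have : ∀ᵐ x : Plane, x ∉ ⋃ E ∈ T, frontier E.carrier := measure_eq_zero_iff_ae_notMem.1 h0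
    filter_upwards [this] with x hx hxΩ
    have hxu : x ∈ ⋃ E ∈ T, E.carrier := by rw [h.union_eq]; exact _root_.interior_subset hxΩ
    simp only [Set.mem_iUnion, exists_prop] at hxu hx
    obtain ⟨E, hE, hxE⟩ := hxu
    change x ∈ ⋃ E ∈ T, interior E.carrier
    simp only [Set.mem_iUnion, exists_prop]
    refine ⟨E, hE, ?_⟩
    by_contra hni
    exact hx ⟨E, hE, by rw [E.isClosed_carrier.frontier_eq]; exact ⟨hxE, hni⟩⟩
  · exact Filter.Eventually.of_forall (Set.iUnion₂_subset fun E hE => h.interior_subset hE)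

/-- An integral over the domain is the sum of the integrals over the elements. -/
lemma IsTiling.integral_domain (h : IsTiling T₀ T) {f : Plane → ℝ}
    (hf : IntegrableOn f (domain T₀)) :
    ∫ x in domain T₀, f x = ∑ E ∈ T, ∫ x in interior E.carrier, f x := by
  rw [setIntegral_congr_set h.domain_ae_eq]
  refine integral_biUnion_finset T (fun E _ => isOpen_interior.measurableSet) ?_
    fun E hE => hf.mono_set (h.interior_subset hE)
  intro E hE E' hE' hne
  exact h.disjoint E hE E' hE' hne

end AVEM

namespace AVEM

open MeasureTheory Filter Topology
open scoped ContDiff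

/-! ### Dyadic intervals -/

/-- `s` and `t` are the endpoints of a dyadic interval. -/
def IsDyadicPair (s t : ℝ) : Prop :=
  ∃ (n : ℕ) (a : ℤ), (s = a / 2 ^ n ∧ t = (a + 1) / 2 ^ n) ∨ (s = (a + 1) / 2 ^ n ∧ t = a / 2 ^ n)

lemma IsDyadicPair.symm {s t : ℝ} (h : IsDyadicPair s t) : IsDyadicPair t s := by
  obtain ⟨n, a, h | h⟩ := h
  · exact ⟨n, a, Or.inr ⟨h.2, h.1⟩⟩
  · exact ⟨n, a, Or.inl ⟨h.2, h.1⟩⟩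

lemma isDyadicPair_zero_one : IsDyadicPair 0 1 := ⟨0, 0, Or.inl (by simp)⟩

/-- Needed when two triangles traverse their common side in opposite directions. -/
lemma IsDyadicPair.one_sub {s t : ℝ} (h : IsDyadicPair s t) : IsDyadicPair (1 - s) (1 - t) := by
  obtain ⟨n, a, ⟨rfl, rfl⟩ | ⟨rfl, rfl⟩⟩ := h
  · refine ⟨n, 2 ^ n - a - 1, Or.inr ⟨?_, ?_⟩⟩ <;> push_cast <;> field_simp <;> ring
  · refine ⟨n, 2 ^ n - a - 1, Or.inl ⟨?_, ?_⟩⟩ <;> push_cast <;> field_simp <;> ring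

lemma IsDyadicPair.midpoint {s t : ℝ} (h : IsDyadicPair s t) : IsDyadicPair ((s + t) / 2) t := by
  obtain ⟨n, a, ⟨rfl, rfl⟩ | ⟨rfl, rfl⟩⟩ := h
  · refine ⟨n + 1, 2 * a + 1, Or.inl ⟨?_, ?_⟩⟩ <;> push_cast <;> field_simp <;> ring
  · refine ⟨n + 1, 2 * a, Or.inr ⟨?_, ?_⟩⟩ <;> push_cast <;> field_simp <;> ring

/-- A dyadic interval whose midpoint is inside another dyadic interval is a part of it. -/
lemma dyadic_subset {n m : ℕ} {a b : ℤ} (h₁ : (a : ℝ) / 2 ^ n < (2 * b + 1) / 2 ^ (m + 1))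
    (h₂ : (2 * b + 1 : ℝ) / 2 ^ (m + 1) < (a + 1) / 2 ^ n) :
    (a : ℝ) / 2 ^ n ≤ b / 2 ^ m ∧ (b + 1 : ℝ) / 2 ^ m ≤ (a + 1) / 2 ^ n := by
  rw [div_lt_div_iff₀ (by positivity) (by positivity)] at h₁ h₂
  rw [div_le_div_iff₀ (by positivity) (by positivity),
    div_le_div_iff₀ (by positivity) (by positivity)]
  rcases le_or_gt n m with h | h
  -- The second interval is not longer than the first. In units of half its length the midpoint is
  -- odd and the ends of the first interval are even, so the strict inequalities leave room for a
  -- whole second interval.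
  · obtain ⟨k, rfl⟩ := Nat.exists_eq_add_of_le h
    have hp : (0 : ℝ) < 2 ^ n := by positivity
    rw [pow_succ, pow_add] at h₁ h₂
    rw [pow_add]
    have e1 : (a : ℝ) * 2 ^ k * 2 < 2 * b + 1 := by nlinarith
    have e2 : (2 * b + 1 : ℝ) < (a + 1) * 2 ^ k * 2 := by nlinarith
    have e3 : a * 2 ^ k * 2 < 2 * b + 1 := by exact_mod_cast e1
    have e4 : 2 * b + 1 < (a + 1) * 2 ^ k * 2 := by exact_mod_cast e2
    have e5 : a * 2 ^ k ≤ b := by omega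
    have e6 : b + 1 ≤ (a + 1) * 2 ^ k := by omega
    have e7 : (a : ℝ) * 2 ^ k ≤ b := by exact_mod_cast e5
    have e8 : (b + 1 : ℝ) ≤ (a + 1) * 2 ^ k := by exact_mod_cast e6
    constructor <;> nlinarith
  · exfalso
    -- If the second interval were longer, its midpoint would be an integer in units of the first
    -- one, strictly between the consecutive integers a and a + 1.
    obtain ⟨k, rfl⟩ := Nat.exists_eq_add_of_lt h
    have hp : (0 : ℝ) < 2 ^ (m + 1) := by positivity
    have hk : (2 : ℝ) ^ (m + k + 1) = 2 ^ k * 2 ^ (m + 1) := by ring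
    rw [hk] at h₁ h₂
    have e1 : (a : ℝ) < (2 * b + 1) * 2 ^ k := by nlinarith
    have e2 : (2 * b + 1 : ℝ) * 2 ^ k < a + 1 := by nlinarith
    have e3 : a < (2 * b + 1) * 2 ^ k := by exact_mod_cast e1
    have e4 : (2 * b + 1) * 2 ^ k < a + 1 := by exact_mod_cast e2
    omega

/-- The parameter τ in (0, 1) puts the midpoint strictly inside the second interval, so
`dyadic_subset` applies. Only the endpoint `s` is treated; `t` follows by exchanging the two. -/
lemma IsDyadicPair.mem_of_midpoint {s t s' t' τ : ℝ} (h : IsDyadicPair s t)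
    (h' : IsDyadicPair s' t') (hτ : 0 < τ) (hτ1 : τ < 1)
    (hx : (s + t) / 2 = (1 - τ) * s' + τ * t') :
    ∃ σ : ℝ, 0 ≤ σ ∧ σ ≤ 1 ∧ s = (1 - σ) * s' + σ * t' := by
  suffices H : s' ≠ t' ∧ ((s' ≤ s ∧ s ≤ t') ∨ (t' ≤ s ∧ s ≤ s')) by
    have hne := sub_ne_zero.2 H.1.symm
    refine ⟨(s - s') / (t' - s'), ?_, ?_, by field_simp; ring⟩
    · rcases H.2 with h | h
      · exact div_nonneg (by linarith) (by linarith)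
      · exact div_nonneg_of_nonpos (by linarith) (by linarith)
    · rcases H.2 with h | h
      · exact div_le_one_of_le₀ (by linarith) (by linarith)
      · exact div_le_one_of_ge (by linarith) (by linarith)
  obtain ⟨m, b, hb⟩ := h
  obtain ⟨n, a, ha⟩ := h'
  have hlt : (a : ℝ) / 2 ^ n < (a + 1) / 2 ^ n := by gcongr; linarith
  have hltb : (b : ℝ) / 2 ^ m < (b + 1) / 2 ^ m := by gcongr; linarith
  have hmid : (s + t) / 2 = (2 * b + 1 : ℝ) / 2 ^ (m + 1) := by
    rcases hb with ⟨rfl, rfl⟩ | ⟨rfl, rfl⟩ <;> field_simp <;> ring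
  rw [hmid] at hx
  obtain ⟨h1, h2⟩ := dyadic_subset (n := n) (m := m) (a := a) (b := b)
    (by rw [hx]; rcases ha with ⟨rfl, rfl⟩ | ⟨rfl, rfl⟩ <;> nlinarith)
    (by rw [hx]; rcases ha with ⟨rfl, rfl⟩ | ⟨rfl, rfl⟩ <;> nlinarith)
  rcases ha with ⟨rfl, rfl⟩ | ⟨rfl, rfl⟩
  · refine ⟨hlt.ne, Or.inl ?_⟩
    rcases hb with ⟨rfl, rfl⟩ | ⟨rfl, rfl⟩ <;> constructor <;> linarith
  · refine ⟨hlt.ne', Or.inr ?_⟩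
    rcases hb with ⟨rfl, rfl⟩ | ⟨rfl, rfl⟩ <;> constructor <;> linarith

/-! ### Sides of the triangles of the forest -/

namespace Tri

variable {E P Q K : Tri}

lemma eval_eq_sum_bary (hE : E.det ≠ 0) (p : P1) (x : Plane) :
    p.eval x = E.bary 0 x * p.eval (E.vtx 0) + E.bary 1 x * p.eval (E.vtx 1)
      + E.bary 2 x * p.eval (E.vtx 2) := by
  have h := sum_bary hE x
  conv_lhs => rw [← sum_bary_smul hE x]
  simp only [P1.eval, inner_add_right, inner_smul_right]
  linear_combination -p.const * h

lemma eval_eq_sum_bary' (hE : E.det ≠ 0) (i : Fin 3) (p : P1) (x : Plane) :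
    p.eval x = E.bary i x * p.eval (E.vtx i) + E.bary (i + 1) x * p.eval (E.vtx (i + 1))
      + E.bary (i + 2) x * p.eval (E.vtx (i + 2)) := by
  rw [eval_eq_sum_bary hE p x]
  fin_cases i <;> simp <;> ring

lemma eval_mid (p : P1) (K : Tri) : p.eval K.mid = (p.eval (K.vtx 1) + p.eval (K.vtx 2)) / 2 := by
  simp only [P1.eval, mid, midpoint_eq_smul_add, inner_add_right, inner_smul_right]
  simp; ring

lemma bary_nonneg (hE : E.det ≠ 0) {x : Plane} (hx : x ∈ E.carrier) (i : Fin 3) :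
    0 ≤ E.bary i x := by
  rw [carrier_eq hE] at hx; exact hx i

/-- If the midpoint of the refinement edge lies on a side of `P`, so does the refinement edge. -/
lemma bary_vtx_of_mid (hP : P.det ≠ 0) (hKP : K.carrier ⊆ P.carrier) {r : Fin 3}
    (h : P.bary r K.mid = 0) : P.bary r (K.vtx 1) = 0 ∧ P.bary r (K.vtx 2) = 0 := by
  have h1 := bary_nonneg hP (hKP (K.vtx_mem 1)) r
  have h2 := bary_nonneg hP (hKP (K.vtx_mem 2)) r
  have h3 : P.bary r K.mid = (P.bary r (K.vtx 1) + P.bary r (K.vtx 2)) / 2 := eval_mid _ _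
  constructor <;> linarith

/-- A triangle does not lie on a line. -/
lemma not_forall_bary_eq_zero (hP : P.det ≠ 0) (hK : K.det ≠ 0) {r : Fin 3}
    (h0 : P.bary r (K.vtx 0) = 0) (h1 : P.bary r (K.vtx 1) = 0) (h2 : P.bary r (K.vtx 2) = 0) :
    False := by
  have := eval_eq_sum_bary hK (P.baryP r) (P.vtx r)
  change P.bary r _ = _ * P.bary r _ + _ * P.bary r _ + _ * P.bary r _ at this
  rw [h0, h1, h2, bary_vtx_self hP] at this
  norm_num at this

/-- The sides of the descendants of `P` that lie on a side of `P` are dyadic parts of it. -/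
lemma isDyadicPair_of_inForest (hP : P.det ≠ 0) (r : Fin 3) (hK : InForest {P} K) :
    ∀ j l : Fin 3, j ≠ l → P.bary r (K.vtx j) = 0 → P.bary r (K.vtx l) = 0 →
      IsDyadicPair (P.bary (r + 2) (K.vtx j)) (P.bary (r + 2) (K.vtx l)) := by
  induction hK with
  | root K hK =>
    rw [Finset.mem_singleton.1 hK]
    intro j l hjl hj hl
    have e1 : P.bary (r + 2) (P.vtx (r + 1)) = 0 := bary_vtx_ne (fin_add_one_ne_add_two r)
    have e2 : P.bary (r + 2) (P.vtx (r + 2)) = 1 := bary_vtx_self hP _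
    rcases fin_three_cases r j with rfl | rfl | rfl
    · rw [bary_vtx_self hP] at hj; norm_num at hj
    · rcases fin_three_cases r l with rfl | rfl | rfl
      · rw [bary_vtx_self hP] at hl; norm_num at hl
      · exact absurd rfl hjl
      · rw [e1, e2]; exact isDyadicPair_zero_one
    · rcases fin_three_cases r l with rfl | rfl | rfl
      · rw [bary_vtx_self hP] at hl; norm_num at hl
      · rw [e1, e2]; exact isDyadicPair_zero_one.symm
      · exact absurd rfl hjl
  | left K hK ih =>
    -- The bisecting segment cannot lie on a side of `P`: with its foot the whole refinement edge
    -- would lie there, and `K` would be degenerate. The remaining sides of a child are a side of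
    -- `K` or half of its refinement edge.
    have hm : P.bary r K.mid = 0 → P.bary r (K.vtx 0) = 0 → False := fun h h0 =>
      not_forall_bary_eq_zero hP (hK.det_ne hP) h0 (bary_vtx_of_mid hP (hK.subset hP) h).1
        (bary_vtx_of_mid hP (hK.subset hP) h).2
    have hd : P.bary r K.mid = 0 →
        IsDyadicPair (P.bary (r + 2) K.mid) (P.bary (r + 2) (K.vtx 1)) := by
      intro h
      obtain ⟨h1, h2⟩ := bary_vtx_of_mid hP (hK.subset hP) h
      have e : P.bary (r + 2) K.mid = (P.bary (r + 2) (K.vtx 2) + P.bary (r + 2) (K.vtx 1)) / 2 :=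
        (eval_mid _ _).trans (by rw [add_comm]; rfl)
      rw [e]
      exact (ih 2 1 (by decide) h2 h1).midpoint
    intro j l hjl
    fin_cases j <;> fin_cases l <;> simp [Tri.child₁] at hjl ⊢ <;> intro hj hl
    · exact (hm hj hl).elim
    · exact hd hj
    · exact (hm hl hj).elim
    · exact ih 0 1 (by decide) hj hl
    · exact (hd hl).symm
    · exact ih 1 0 (by decide) hj hl
  | right K hK ih =>
    have hm : P.bary r K.mid = 0 → P.bary r (K.vtx 0) = 0 → False := fun h h0 =>
      not_forall_bary_eq_zero hP (hK.det_ne hP) h0 (bary_vtx_of_mid hP (hK.subset hP) h).1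
        (bary_vtx_of_mid hP (hK.subset hP) h).2
    have hd : P.bary r K.mid = 0 →
        IsDyadicPair (P.bary (r + 2) K.mid) (P.bary (r + 2) (K.vtx 2)) := by
      intro h
      obtain ⟨h1, h2⟩ := bary_vtx_of_mid hP (hK.subset hP) h
      have e : P.bary (r + 2) K.mid = (P.bary (r + 2) (K.vtx 1) + P.bary (r + 2) (K.vtx 2)) / 2 :=
        eval_mid _ _
      rw [e]
      exact (ih 1 2 (by decide) h1 h2).midpoint
    intro j l hjl
    fin_cases j <;> fin_cases l <;> simp [Tri.child₂] at hjl ⊢ <;> intro hj hl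
    · exact hd hj
    · exact (hm hj hl).elim
    · exact (hd hl).symm
    · exact ih 2 0 (by decide) hj hl
    · exact (hm hl hj).elim
    · exact ih 0 2 (by decide) hj hl

/-- Side `r` of `P` coincides with side `s` of `Q`. -/
def SharesSide (P : Tri) (r : Fin 3) (Q : Tri) (s : Fin 3) : Prop :=
  (P.vtx (r + 1) = Q.vtx (s + 1) ∧ P.vtx (r + 2) = Q.vtx (s + 2)) ∨
    (P.vtx (r + 1) = Q.vtx (s + 2) ∧ P.vtx (r + 2) = Q.vtx (s + 1))

/-- On the line through the common side an affine function is determined by its values at the two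
common vertices. The parameters of the two triangles therefore agree or are reflections of each
other. -/
lemma SharesSide.transfer {r s : Fin 3} (h : SharesSide P r Q s) (hP : P.det ≠ 0)
    (hQ : Q.det ≠ 0) :
    (∀ y, Q.bary s y = 0 → P.bary r y = 0) ∧
      ((∀ y, Q.bary s y = 0 → P.bary (r + 2) y = Q.bary (s + 2) y) ∨
        ∀ y, Q.bary s y = 0 → P.bary (r + 2) y = 1 - Q.bary (s + 2) y) := by
  have key : ∀ i y, Q.bary s y = 0 → P.bary i y = Q.bary (s + 1) y * P.bary i (Q.vtx (s + 1))
      + Q.bary (s + 2) y * P.bary i (Q.vtx (s + 2)) := by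
    intro i y hy
    have := eval_eq_sum_bary' hQ s (P.baryP i) y
    rw [hy, zero_mul, zero_add] at this
    exact this
  have z1 : P.bary r (P.vtx (r + 1)) = 0 := bary_vtx_ne (fin_ne_add_one r).symm
  have z2 : P.bary r (P.vtx (r + 2)) = 0 := bary_vtx_ne (fin_ne_add_two r).symm
  have e1 : P.bary (r + 2) (P.vtx (r + 1)) = 0 := bary_vtx_ne (fin_add_one_ne_add_two r)
  have e2 : P.bary (r + 2) (P.vtx (r + 2)) = 1 := bary_vtx_self hP _
  rcases h with ⟨h1, h2⟩ | ⟨h1, h2⟩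
  · rw [h1] at z1 e1; rw [h2] at z2 e2
    refine ⟨fun y hy => by rw [key r y hy, z1, z2]; ring, Or.inl fun y hy => ?_⟩
    rw [key _ y hy, e1, e2]; ring
  · rw [h1] at z1 e1; rw [h2] at z2 e2
    refine ⟨fun y hy => by rw [key r y hy, z1, z2]; ring, Or.inr fun y hy => ?_⟩
    rw [key _ y hy, e1, e2]
    linarith [sum_bary' hQ s y]

/-- Two coordinates determine a point on the side `r` of `P`. -/
lemma eq_lineMap_of_bary (hP : P.det ≠ 0) {r : Fin 3} {y a b : Plane} {σ : ℝ}
    (hy : P.bary r y = 0) (ha : P.bary r a = 0) (hb : P.bary r b = 0)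
    (h : P.bary (r + 2) y = (1 - σ) * P.bary (r + 2) a + σ * P.bary (r + 2) b) :
    y = AffineMap.lineMap a b σ := by
  have e0 : P.bary r y = P.bary r (AffineMap.lineMap a b σ) := by
    rw [bary_lineMap, hy, ha, hb]; ring
  have e2 : P.bary (r + 2) y = P.bary (r + 2) (AffineMap.lineMap a b σ) := by
    rw [bary_lineMap, h]
  refine ext_bary hP fun i => ?_
  rcases fin_three_cases r i with rfl | rfl | rfl
  · exact e0
  · linarith [sum_bary' hP r y, sum_bary' hP r (AffineMap.lineMap a b σ)]
  · exact e2

lemma bary_pos_of_notMem_range (hE : E.det ≠ 0) {x : Plane} {i : Fin 3} (hx : x ∈ E.carrier)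
    (hi : E.bary i x = 0) (hxv : x ∉ Set.range E.vtx) :
    0 < E.bary (i + 1) x ∧ 0 < E.bary (i + 2) x := by
  have hs := sum_bary' hE i x
  have h1 := bary_nonneg hE hx (i + 1)
  have h2 := bary_nonneg hE hx (i + 2)
  have e : ∀ k l : Fin 3, E.bary k x = 1 → E.bary l x = 0 → E.bary i x = 0 →
      k ≠ l → k ≠ i → l ≠ i → False := by
    intro k l hk hl hi' hkl hki hli
    apply hxv
    refine ⟨k, ext_bary hE fun j => ?_⟩
    by_cases hj : k = j
    · subst hj; rw [bary_vtx_self hE, hk]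
    · rw [bary_vtx_ne hj]
      have : j = l ∨ j = i := by clear * - hkl hki hli hj; decide +revert
      rcases this with rfl | rfl
      · exact hl.symm
      · exact hi.symm
  constructor
  · refine lt_of_le_of_ne h1 fun h => e (i + 2) (i + 1) (by linarith) h.symm hi ?_ ?_ ?_
    · exact (fin_add_one_ne_add_two i).symm
    · exact (fin_ne_add_two i).symm
    · exact (fin_ne_add_one i).symm
  · refine lt_of_le_of_ne h2 fun h => e (i + 1) (i + 2) (by linarith) h.symm hi ?_ ?_ ?_
    · exact fin_add_one_ne_add_two i
    · exact (fin_ne_add_one i).symm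
    · exact (fin_ne_add_two i).symm

lemma mem_side_of_lineMap {i : Fin 3} {σ : ℝ} (h0 : 0 ≤ σ) (h1 : σ ≤ 1)
    {y : Plane} (hy : y = AffineMap.lineMap (E.vtx (i + 1)) (E.vtx (i + 2)) σ) :
    y ∈ E.carrier ∧ E.bary i y = 0 := by
  constructor
  · rw [hy]
    exact E.convex_carrier.segment_subset (E.vtx_mem _) (E.vtx_mem _)
      (by rw [segment_eq_image_lineMap]; exact ⟨σ, ⟨h0, h1⟩, rfl⟩)
  · rw [hy, bary_lineMap, bary_vtx_ne (fin_ne_add_one i).symm,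
      bary_vtx_ne (fin_ne_add_two i).symm]; ring

lemma SharesSide.symm {r s : Fin 3} (h : SharesSide P r Q s) : SharesSide Q s P r := by
  rcases h with h | h
  · exact Or.inl ⟨h.1.symm, h.2.symm⟩
  · exact Or.inr ⟨h.2.symm, h.1.symm⟩

/-- The refinement edge of a descendant of `Q` whose midpoint is inside a side of a descendant of
the neighbour `P` is a part of that side. -/
lemma SharesSide.halves {r s : Fin 3} (h : SharesSide P r Q s) (hP : P.det ≠ 0)
    (hQ : Q.det ≠ 0) (hE : InForest {P} E) (hK : InForest {Q} K)
    (hr : P.bary r K.mid = 0) (hs : Q.bary s K.mid = 0) {i : Fin 3} (hx : K.mid ∈ E.carrier)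
    (hi : E.bary i K.mid = 0) (hxv : K.mid ∉ Set.range E.vtx) :
    (K.vtx 1 ∈ E.carrier ∧ E.bary i (K.vtx 1) = 0) ∧
      (K.vtx 2 ∈ E.carrier ∧ E.bary i (K.vtx 2) = 0) := by
  have hEd := hE.det_ne hP
  obtain ⟨p1, p2⟩ := bary_pos_of_notMem_range hEd hx hi hxv
  have key : ∀ k, P.bary k K.mid = E.bary (i + 1) K.mid * P.bary k (E.vtx (i + 1))
      + E.bary (i + 2) K.mid * P.bary k (E.vtx (i + 2)) := by
    intro k
    have := eval_eq_sum_bary' hEd i (P.baryP k) K.mid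
    rw [hi, zero_mul, zero_add] at this
    exact this
  -- The coordinate `P.bary r` is nonnegative at both ends of side `i` of `E` and vanishes at a
  -- point strictly between them. Thus the entire side lies on side `r` of `P`.
  have n1 := bary_nonneg hP (hE.subset hP (E.vtx_mem (i + 1))) r
  have n2 := bary_nonneg hP (hE.subset hP (E.vtx_mem (i + 2))) r
  have hkr := key r
  rw [hr] at hkr
  have m1 := mul_nonneg p1.le n1
  have m2 := mul_nonneg p2.le n2
  have e1 : P.bary r (E.vtx (i + 1)) = 0 :=
    (mul_eq_zero.1 (by linarith : E.bary (i + 1) K.mid * _ = 0)).resolve_left p1.ne'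
  have e2 : P.bary r (E.vtx (i + 2)) = 0 :=
    (mul_eq_zero.1 (by linarith : E.bary (i + 2) K.mid * _ = 0)).resolve_left p2.ne'
  have dE := isDyadicPair_of_inForest hP r hE (i + 1) (i + 2) (fin_add_one_ne_add_two i) e1 e2
  obtain ⟨k1, k2⟩ := bary_vtx_of_mid hQ (hK.subset hQ) hs
  have dK := isDyadicPair_of_inForest hQ s hK 1 2 (by decide) k1 k2
  obtain ⟨t0, t1⟩ := h.transfer hP hQ
  -- Express both segments in the parameter of `P` along the common side. There both are dyadic and
  -- the midpoint of one is inside the other.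
  have dK' : IsDyadicPair (P.bary (r + 2) (K.vtx 1)) (P.bary (r + 2) (K.vtx 2)) := by
    rcases t1 with t1 | t1
    · rw [t1 _ k1, t1 _ k2]; exact dK
    · rw [t1 _ k1, t1 _ k2]; exact dK.one_sub
  have hsum := sum_bary' hEd i K.mid
  have hmid : (P.bary (r + 2) (K.vtx 1) + P.bary (r + 2) (K.vtx 2)) / 2
      = (1 - E.bary (i + 2) K.mid) * P.bary (r + 2) (E.vtx (i + 1))
        + E.bary (i + 2) K.mid * P.bary (r + 2) (E.vtx (i + 2)) := by
    have h1 : P.bary (r + 2) K.mid = (P.bary (r + 2) (K.vtx 1) + P.bary (r + 2) (K.vtx 2)) / 2 :=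
      eval_mid _ _
    rw [← h1, key]
    have : E.bary (i + 1) K.mid = 1 - E.bary (i + 2) K.mid := by linarith
    rw [this]
  obtain ⟨σ, h0, h1, hσ⟩ := dK'.mem_of_midpoint dE p2 (by linarith) hmid
  obtain ⟨σ', h0', h1', hσ'⟩ := dK'.symm.mem_of_midpoint dE p2 (by linarith)
    (by rw [add_comm]; exact hmid)
  exact ⟨mem_side_of_lineMap h0 h1 (eq_lineMap_of_bary hP (t0 _ k1) e1 e2 hσ),
    mem_side_of_lineMap h0' h1' (eq_lineMap_of_bary hP (t0 _ k2) e1 e2 hσ')⟩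

lemma sharesSide_children (Q : Tri) : SharesSide Q.child₁ 2 Q.child₂ 1 := by
  right; simp [child₁, child₂]

lemma bary_eq_zero_of_convexHull {s : Set Plane} {r : Fin 3} (h : ∀ y ∈ s, P.bary r y = 0)
    {x : Plane} (hx : x ∈ convexHull ℝ s) : P.bary r x = 0 := by
  have : convexHull ℝ s ⊆ {y | P.bary r y = 0} := by
    refine convexHull_min h ?_
    intro y hy z hz a b ha hb hab
    have e : a • y + b • z = AffineMap.lineMap (k := ℝ) y z b := by
      rw [AffineMap.lineMap_apply_module, ← hab, add_sub_cancel_right]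
    have h1 : P.bary r y = 0 := hy
    have h2 : P.bary r z = 0 := hz
    change P.bary r _ = 0
    rw [e, bary_lineMap, h1, h2]; ring
  exact this hx

end Tri

open Tri in
/-- If the midpoint of the refinement edge of `K` is inside a side of `E`, then the
refinement edge is a part of that side. -/
lemma IsConforming.halves {T₀ : Finset Tri} (hT₀ : IsConforming T₀) {E K : Tri}
    (hE : InForest T₀ E) (hK : InForest T₀ K) {i : Fin 3} (hx : K.mid ∈ E.carrier)
    (hi : E.bary i K.mid = 0) (hxv : K.mid ∉ Set.range E.vtx) :
    (K.vtx 1 ∈ E.carrier ∧ E.bary i (K.vtx 1) = 0) ∧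
      (K.vtx 2 ∈ E.carrier ∧ E.bary i (K.vtx 2) = 0) := by
  obtain ⟨P, hP, hE⟩ := hE.exists_root
  obtain ⟨Q, hQ, hK⟩ := hK.exists_root
  have hPd := hT₀.det_ne hP
  have hQd := hT₀.det_ne hQ
  have hEd := hE.det_ne hPd
  have hKd := hK.det_ne hQd
  have hxK : K.mid ∈ K.carrier :=
    K.convex_carrier.segment_subset (K.vtx_mem 1) (K.vtx_mem 2) (midpoint_mem_segment _ _)
  -- A vertex of an ancestor of `E` that lies in `E` is a vertex of `E`, which is excluded for the
  -- midpoint.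
  have hvtx : ∀ R : Tri, R.det ≠ 0 → InForest {R} E → ∀ k, K.mid ≠ R.vtx k := by
    intro R hR hER k hk
    rw [hk] at hx hxv
    exact hxv (vtx_mem_range hR hEd (hER.subset hR) hx)
  by_cases hPQ : P = Q
  · subst hPQ
    rcases hK.nested_or hE with h | h | ⟨R, hR, ⟨h1, h2⟩ | ⟨h1, h2⟩⟩
    -- If `E` is a proper descendant of `K`, it descends from a child, whose vertex 0 is the
    -- midpoint; this is impossible. Only `E = K` remains.
    · rcases h.cases_child with rfl | h | h
      · obtain ⟨h1, h2⟩ := bary_vtx_of_mid hEd subset_rfl hi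
        exact ⟨⟨E.vtx_mem 1, h1⟩, E.vtx_mem 2, h2⟩
      · exact absurd rfl (hvtx _ (det_child₁_ne hKd) h 0)
      · exact absurd rfl (hvtx _ (det_child₂_ne hKd) h 0)
    · have hs := h.subset hEd
      obtain ⟨h1, h2⟩ := bary_vtx_of_mid hEd hs hi
      exact ⟨⟨hs (K.vtx_mem 1), h1⟩, hs (K.vtx_mem 2), h2⟩
    · have hRd := hR.det_ne hPd
      have d1 := det_child₁_ne hRd
      have d2 := det_child₂_ne hRd
      obtain ⟨b1, b2⟩ := bary_of_mem_children hRd (h1.subset d1 hxK) (h2.subset d2 hx)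
      exact (sharesSide_children R).symm.halves d2 d1 h2 h1 b2 b1 hx hi hxv
    · have hRd := hR.det_ne hPd
      have d1 := det_child₁_ne hRd
      have d2 := det_child₂_ne hRd
      obtain ⟨b1, b2⟩ := bary_of_mem_children hRd (h2.subset d1 hx) (h1.subset d2 hxK)
      exact (sharesSide_children R).halves d1 d2 h2 h1 b1 b2 hx hi hxv
  -- Different roots: by conformity the midpoint is in the hull of the common vertices. Three common
  -- vertices would make the roots overlap, and at most one would make the midpoint a vertex of `P`.
  -- Hence the roots share exactly a side.
  · have hxS : K.mid ∈ convexHull ℝ (Set.range P.vtx ∩ Set.range Q.vtx) := by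
      rw [← hT₀.inter_eq P hP Q hQ hPQ]
      exact ⟨hE.subset hPd hx, hK.subset hQd hxK⟩
    have hr : ∃ r, P.vtx r ∉ Set.range Q.vtx := by
      by_contra! hall
      have hsub : P.carrier ⊆ Q.carrier :=
        convexHull_mono (by rintro _ ⟨k, rfl⟩; exact hall k)
      have := hT₀.disjoint P hP Q hQ hPQ
      obtain ⟨y, hy⟩ := interior_nonempty hPd
      exact Set.disjoint_left.1 this hy (interior_mono hsub hy)
    obtain ⟨r, hr⟩ := hr
    have hnot : ∀ k, ¬ (Set.range P.vtx ∩ Set.range Q.vtx ⊆ {P.vtx k}) := by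
      intro k hk
      have := convexHull_mono hk hxS
      rw [convexHull_singleton] at this
      exact hvtx P hPd hE k this
    have hsub : Set.range P.vtx ∩ Set.range Q.vtx ⊆ {P.vtx (r + 1), P.vtx (r + 2)} := by
      rintro _ ⟨⟨k, rfl⟩, hk⟩
      rcases fin_three_cases r k with rfl | rfl | rfl
      · exact absurd hk hr
      · exact Or.inl rfl
      · exact Or.inr rfl
    have m1 : P.vtx (r + 1) ∈ Set.range Q.vtx := by
      by_contra hm
      refine hnot (r + 2) fun y hy => ?_
      rcases hsub hy with rfl | h
      · exact absurd hy.2 hm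
      · exact h
    have m2 : P.vtx (r + 2) ∈ Set.range Q.vtx := by
      by_contra hm
      refine hnot (r + 1) fun y hy => ?_
      rcases hsub hy with h | rfl
      · exact h
      · exact absurd hy.2 hm
    obtain ⟨j, hj⟩ := m1
    obtain ⟨l, hl⟩ := m2
    have hjl : j ≠ l := by
      rintro rfl
      have h1 : P.bary (r + 1) (P.vtx (r + 1)) = 1 := bary_vtx_self hPd _
      rw [← hj, hl, bary_vtx_ne (fin_add_one_ne_add_two r).symm] at h1
      norm_num at h1
    have hs : ∃ s, (j = s + 1 ∧ l = s + 2) ∨ (j = s + 2 ∧ l = s + 1) := by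
      clear * - hjl; decide +revert
    obtain ⟨s, hs⟩ := hs
    have hsh : SharesSide P r Q s := by
      rcases hs with ⟨rfl, rfl⟩ | ⟨rfl, rfl⟩
      · exact Or.inl ⟨hj.symm, hl.symm⟩
      · exact Or.inr ⟨hj.symm, hl.symm⟩
    have hbr : P.bary r K.mid = 0 := by
      refine bary_eq_zero_of_convexHull (fun y hy => ?_) hxS
      rcases hsub hy with rfl | rfl
      · exact bary_vtx_ne (fin_ne_add_one r).symm
      · exact bary_vtx_ne (fin_ne_add_two r).symm
    exact hsh.halves hPd hQd hE hK hbr ((hsh.symm.transfer hQd hPd).1 _ hbr) hx hi hxv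

end AVEM

namespace AVEM

open MeasureTheory Filter Topology
open scoped ContDiff

open Tri

variable {T₀ T : Finset Tri} {E E' : Tri} {Λ : ℕ} {ρ : ℝ}

/-! ### Nodes on the boundary of an element -/

lemma mem_nodesOf {x : Plane} : x ∈ nodesOf T E ↔ x ∈ nodes T ∧ x ∈ frontier E.carrier := by
  simp [nodesOf]

lemma vtx_mem_nodes (hE : E ∈ T) (i : Fin 3) : E.vtx i ∈ nodes T := by
  simp only [nodes, Finset.mem_biUnion, Finset.mem_image, Finset.mem_univ, true_and]
  exact ⟨E, hE, i, rfl⟩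

lemma vtx_mem_nodesOf (hE : E ∈ T) (hd : E.det ≠ 0) (i : Fin 3) : E.vtx i ∈ nodesOf T E :=
  mem_nodesOf.2 ⟨vtx_mem_nodes hE i, (mem_frontier_iff hd _).2
    ⟨E.vtx_mem i, i + 1, bary_vtx_ne (fin_ne_add_one i)⟩⟩

/-- Induction on the index. A proper node on the side is a vertex of `E`, with parameter 0 or 1. A
node inside the side is the midpoint of two points which, by `IsConforming.halves`, lie on the same
side, so each increase of the index costs one factor 2. -/
lemma GlobalIndex.exists_int (hT₀ : IsConforming T₀) (hT : IsTiling T₀ T) (hE : E ∈ T) (i : Fin 3)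
    {x : Plane} {n : ℕ} (h : GlobalIndex T₀ T x n) (hx : x ∈ E.carrier) (hi : E.bary i x = 0) :
    ∃ k : ℤ, E.bary (i + 2) x * 2 ^ n = k := by
  have hd := (hT.inForest E hE).det_ne' hT₀
  have hv : ∀ {x : Plane} {n : ℕ}, x ∈ Set.range E.vtx →
      ∃ k : ℤ, E.bary (i + 2) x * 2 ^ n = k := by
    rintro _ n ⟨j, rfl⟩
    by_cases hj : j = i + 2
    · subst hj; rw [bary_vtx_self hd]; exact ⟨2 ^ n, by push_cast; ring⟩
    · rw [bary_vtx_ne hj]; exact ⟨0, by push_cast; ring⟩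
  induction h with
  | proper x hx' => exact hv (hx'.2 E hE hx)
  | hanging x y z m n _ hh _ _ ihy ihz =>
    by_cases hxv : x ∈ Set.range E.vtx
    · exact hv hxv
    obtain ⟨K, hK, rfl, rfl, rfl⟩ := hh
    obtain ⟨⟨y1, y2⟩, z1, z2⟩ := hT₀.halves (hT.inForest E hE) hK hx hi hxv
    obtain ⟨a, ha⟩ := ihy y1 y2
    obtain ⟨b, hb⟩ := ihz z1 z2
    have e : E.bary (i + 2) K.mid = (E.bary (i + 2) (K.vtx 1) + E.bary (i + 2) (K.vtx 2)) / 2 :=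
      eval_mid _ _
    refine ⟨a * 2 ^ (max m n - m) + b * 2 ^ (max m n - n), ?_⟩
    push_cast
    rw [← ha, ← hb, e, mul_assoc, mul_assoc, ← pow_add, ← pow_add,
      Nat.add_sub_cancel' (le_max_left m n), Nat.add_sub_cancel' (le_max_right m n)]
    ring

lemma IsAdmissible.exists_int (hA : IsAdmissible T₀ T Λ) (hT₀ : IsConforming T₀)
    (hT : IsTiling T₀ T) (hE : E ∈ T) (i : Fin 3) {x : Plane} (hx : x ∈ nodesOf T E)
    (hi : E.bary i x = 0) : ∃ k : ℤ, E.bary (i + 2) x * 2 ^ Λ = k := by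
  obtain ⟨hxn, hxf⟩ := mem_nodesOf.1 hx
  obtain ⟨n, hn, hg⟩ := hA x hxn
  obtain ⟨k, hk⟩ := hg.exists_int hT₀ hT hE i (E.isClosed_carrier.frontier_subset hxf) hi
  refine ⟨k * 2 ^ (Λ - n), ?_⟩
  push_cast
  rw [← hk, mul_assoc, ← pow_add, Nat.add_sub_cancel' hn]

/-- Each side offers only the 2^Λ + 1 positions given by the multiples of 2^(−Λ). -/
lemma IsAdmissible.card_nodesOf_le (hA : IsAdmissible T₀ T Λ) (hT₀ : IsConforming T₀)
    (hT : IsTiling T₀ T) (hE : E ∈ T) : (nodesOf T E).card ≤ 3 * (2 ^ Λ + 1) := by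
  classical
  have hd := (hT.inForest E hE).det_ne' hT₀
  have hsub : nodesOf T E ⊆ ((Finset.univ : Finset (Fin 3)) ×ˢ Finset.range (2 ^ Λ + 1)).image
      fun a => AffineMap.lineMap (E.vtx (a.1 + 1)) (E.vtx (a.1 + 2)) ((a.2 : ℝ) / 2 ^ Λ) := by
    intro x hx
    obtain ⟨hxE, i, hi⟩ := (mem_frontier_iff hd x).1 (mem_nodesOf.1 hx).2
    obtain ⟨k, hk⟩ := hA.exists_int hT₀ hT hE i hx hi
    have h1 := bary_nonneg hd hxE (i + 1)
    have h2 := bary_nonneg hd hxE (i + 2)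
    have h3 := sum_bary' hd i x
    have hp : (0 : ℝ) < 2 ^ Λ := by positivity
    have hk0 : (0 : ℝ) ≤ k := by rw [← hk]; positivity
    have hk1 : (k : ℝ) ≤ 2 ^ Λ := by rw [← hk]; nlinarith
    lift k to ℕ using (by exact_mod_cast hk0)
    have hk2 : k ≤ 2 ^ Λ := by exact_mod_cast hk1
    simp only [Finset.mem_image, Finset.mem_product, Finset.mem_univ, Finset.mem_range, true_and]
    refine ⟨(i, k), Nat.lt_succ_of_le hk2, ?_⟩
    have e : (k : ℝ) / 2 ^ Λ = E.bary (i + 2) x := by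
      rw [div_eq_iff hp.ne', hk]; simp
    refine (eq_lineMap_of_bary hd hi (bary_vtx_ne (fin_ne_add_one i).symm)
      (bary_vtx_ne (fin_ne_add_two i).symm) ?_).symm
    rw [bary_vtx_self hd, bary_vtx_ne (fin_add_one_ne_add_two i), e]; ring
  refine (Finset.card_le_card hsub).trans (Finset.card_image_le.trans ?_)
  simp

/-! ### Edges -/

lemma seg_mk (p q : Plane) : seg s(p, q) = segment ℝ p q := by
  unfold seg
  rw [← convexHull_pair]
  congr 1
  ext x; simp

lemma len_mk (p q : Plane) : len s(p, q) = dist p q := by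
  unfold len
  rw [seg_mk, ← convexHull_pair, convexHull_diam, Metric.diam_pair]

lemma mem_edgesOf {p q : Plane} : s(p, q) ∈ edgesOf T E ↔ p ∈ nodesOf T E ∧ q ∈ nodesOf T E ∧
    p ≠ q ∧ segment ℝ p q ⊆ frontier E.carrier ∧
      ∀ x ∈ nodesOf T E, x ∈ segment ℝ p q → x = p ∨ x = q := by
  simp [edgesOf, seg_mk, and_assoc]

lemma card_edgesOf_le (T : Finset Tri) (E : Tri) :
    (edgesOf T E).card ≤ ((nodesOf T E).card + 1) ^ 2 := by
  classical
  refine (Finset.card_filter_le _ _).trans ?_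
  rw [Finset.card_sym2, Nat.choose_two_right]
  refine (Nat.div_le_self _ _).trans ?_
  simp; nlinarith

/-- An edge lies on a side. -/
lemma exists_side_of_edge (hd : E.det ≠ 0) {p q : Plane} (h : s(p, q) ∈ edgesOf T E) :
    ∃ i, E.bary i p = 0 ∧ E.bary i q = 0 := by
  obtain ⟨hp, hq, -, hs, -⟩ := mem_edgesOf.1 h
  have hm := hs (midpoint_mem_segment p q)
  obtain ⟨-, i, hi⟩ := (mem_frontier_iff hd _).1 hm
  refine ⟨i, ?_⟩
  have h1 := bary_nonneg hd (E.isClosed_carrier.frontier_subset (mem_nodesOf.1 hp).2) i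
  have h2 := bary_nonneg hd (E.isClosed_carrier.frontier_subset (mem_nodesOf.1 hq).2) i
  have h3 : E.bary i (midpoint ℝ p q) = (1 - 2⁻¹) * E.bary i p + 2⁻¹ * E.bary i q := by
    rw [midpoint, bary_lineMap]; simp
  constructor <;> linarith

lemma bary_midpoint (E : Tri) (i : Fin 3) (p q : Plane) :
    E.bary i (midpoint ℝ p q) = (E.bary i p + E.bary i q) / 2 := by
  rw [midpoint, bary_lineMap]; simp; ring

/-- In an admissible mesh the edges are not short in comparison with the sides. -/
lemma IsAdmissible.edge_long (hA : IsAdmissible T₀ T Λ) (hT₀ : IsConforming T₀)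
    (hT : IsTiling T₀ T) (hE : E ∈ T) {p q : Plane} (h : s(p, q) ∈ edgesOf T E) {i : Fin 3}
    (hp : E.bary i p = 0) (hq : E.bary i q = 0) :
    1 / 2 ^ Λ ≤ |E.bary (i + 2) p - E.bary (i + 2) q| := by
  have hd := (hT.inForest E hE).det_ne' hT₀
  obtain ⟨hpn, hqn, hne, -, -⟩ := mem_edgesOf.1 h
  obtain ⟨k, hk⟩ := hA.exists_int hT₀ hT hE i hpn hp
  obtain ⟨l, hl⟩ := hA.exists_int hT₀ hT hE i hqn hq
  have hkl : k ≠ l := by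
    rintro rfl
    have h2 : E.bary (i + 2) p = E.bary (i + 2) q := by
      have : (0 : ℝ) < 2 ^ Λ := by positivity
      exact mul_right_cancel₀ this.ne' (hk.trans hl.symm)
    apply hne
    refine ext_bary hd fun j => ?_
    rcases fin_three_cases i j with rfl | rfl | rfl
    · rw [hp, hq]
    · linarith [sum_bary' hd i p, sum_bary' hd i q]
    · exact h2
  have h1 : (1 : ℝ) ≤ |(k : ℝ) - l| := by
    have : 1 ≤ |k - l| := Int.one_le_abs (sub_ne_zero.2 hkl)
    exact_mod_cast this
  rw [← hk, ← hl, ← sub_mul, abs_mul, abs_of_pos (by positivity : (0 : ℝ) < 2 ^ Λ)] at h1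
  rwa [div_le_iff₀ (by positivity)]

/-- The endpoints of the edge differ by at least 2^(−Λ) in either coordinate along the side, and
these coordinates are nonnegative, so the midpoint keeps half of that distance from both ends of the
side. -/
lemma IsAdmissible.le_bary_midpoint (hA : IsAdmissible T₀ T Λ) (hT₀ : IsConforming T₀)
    (hT : IsTiling T₀ T) (hE : E ∈ T) {p q : Plane} (h : s(p, q) ∈ edgesOf T E) {i : Fin 3}
    (hp : E.bary i p = 0) (hq : E.bary i q = 0) :
    1 / 2 ^ (Λ + 1) ≤ E.bary (i + 1) (midpoint ℝ p q) ∧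
      1 / 2 ^ (Λ + 1) ≤ E.bary (i + 2) (midpoint ℝ p q) := by
  have hd := (hT.inForest E hE).det_ne' hT₀
  have hl := hA.edge_long hT₀ hT hE h hp hq
  obtain ⟨hpn, hqn, -⟩ := mem_edgesOf.1 h
  have hpE := E.isClosed_carrier.frontier_subset (mem_nodesOf.1 hpn).2
  have hqE := E.isClosed_carrier.frontier_subset (mem_nodesOf.1 hqn).2
  have a1 := bary_nonneg hd hpE (i + 1)
  have a2 := bary_nonneg hd hpE (i + 2)
  have b1 := bary_nonneg hd hqE (i + 1)
  have b2 := bary_nonneg hd hqE (i + 2)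
  have sp := sum_bary' hd i p
  have sq := sum_bary' hd i q
  have e : (1 : ℝ) / 2 ^ (Λ + 1) = 1 / 2 ^ Λ / 2 := by field_simp; ring
  rw [bary_midpoint, bary_midpoint, e]
  rcases abs_cases (E.bary (i + 2) p - E.bary (i + 2) q) with ⟨h, _⟩ | ⟨h, _⟩ <;>
    rw [h] at hl <;> constructor <;> linarith

lemma IsAdmissible.le_len (hA : IsAdmissible T₀ T Λ) (hT₀ : IsConforming T₀)
    (hT : IsTiling T₀ T) (hE : E ∈ T) (hsh : E.IsShape ρ) {p q : Plane}
    (h : s(p, q) ∈ edgesOf T E) : E.size / (2 ^ (Λ + 1) * ρ) ≤ dist p q := by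
  obtain ⟨i, hp, hq⟩ := exists_side_of_edge hsh.det_ne h
  have h1 := hA.edge_long hT₀ hT hE h hp hq
  have h2 := hsh.abs_bary_sub_le (i + 2) p q
  have h3 := h1.trans h2
  have h4 := hsh.two_le
  have h5 := size_pos hsh.det_ne
  rw [div_le_iff₀ (by positivity)] at h3 ⊢
  have : 2 * ρ / E.size * dist p q * 2 ^ Λ * E.size = dist p q * (2 ^ (Λ + 1) * ρ) := by
    field_simp; ring
  nlinarith

lemma len_le {p q : Plane} (h : s(p, q) ∈ edgesOf T E) : dist p q ≤ 2 * E.size := by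
  obtain ⟨hpn, hqn, -⟩ := mem_edgesOf.1 h
  exact E.dist_le (E.isClosed_carrier.frontier_subset (mem_nodesOf.1 hpn).2)
    (E.isClosed_carrier.frontier_subset (mem_nodesOf.1 hqn).2)

/-- A boundary function is controlled by its values at the nodes. -/
lemma IsBoundaryFunction.sq_le {g : Plane → ℝ} (hg : IsBoundaryFunction T E g) (hE : E ∈ T)
    (hd : E.det ≠ 0) {y : Plane} (hy : y ∈ frontier E.carrier) :
    g y ^ 2 ≤ ∑ x ∈ nodesOf T E, g x ^ 2 := by
  classical
  obtain ⟨hyE, i, hi⟩ := (mem_frontier_iff hd y).1 hy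
  have h1 := bary_nonneg hd hyE (i + 1)
  have h2 := bary_nonneg hd hyE (i + 2)
  have h3 := sum_bary' hd i y
  set S := (nodesOf T E).filter fun x => E.bary i x = 0 with hS
  have inj : ∀ {x z}, E.bary i x = 0 → E.bary i z = 0 → E.bary (i + 2) x = E.bary (i + 2) z →
      x = z := by
    intro x z hx hz hxz
    refine ext_bary hd fun j => ?_
    rcases fin_three_cases i j with rfl | rfl | rfl
    · rw [hx, hz]
    · linarith [sum_bary' hd i x, sum_bary' hd i z]
    · exact hxz
  -- Take the nearest nodes on the side before and after `y`; the vertices of `E` show that there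
  -- are some. If they differ they span an edge, on which the function is affine.
  obtain ⟨p, hp, hpmax⟩ := (S.filter fun x => E.bary (i + 2) x ≤ E.bary (i + 2) y).exists_max_image
    (E.bary (i + 2)) ⟨E.vtx (i + 1), by
      simp only [hS, Finset.mem_filter]
      refine ⟨⟨vtx_mem_nodesOf hE hd _, bary_vtx_ne (fin_ne_add_one i).symm⟩, ?_⟩
      rwa [bary_vtx_ne (fin_add_one_ne_add_two i)]⟩
  obtain ⟨q, hq, hqmin⟩ := (S.filter fun x => E.bary (i + 2) y ≤ E.bary (i + 2) x).exists_min_image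
    (E.bary (i + 2)) ⟨E.vtx (i + 2), by
      simp only [hS, Finset.mem_filter]
      refine ⟨⟨vtx_mem_nodesOf hE hd _, bary_vtx_ne (fin_ne_add_two i).symm⟩, ?_⟩
      rw [bary_vtx_self hd]; linarith⟩
  simp only [hS, Finset.mem_filter] at hp hq hpmax hqmin
  obtain ⟨⟨hpn, hpi⟩, hpy⟩ := hp
  obtain ⟨⟨hqn, hqi⟩, hyq⟩ := hq
  by_cases hpq : p = q
  · subst hpq
    have : y = p := inj hi hpi (le_antisymm hyq hpy)
    rw [this]
    exact Finset.single_le_sum (f := fun x => g x ^ 2) (fun x _ => sq_nonneg _) hpn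
  have hlt : E.bary (i + 2) p < E.bary (i + 2) q :=
    lt_of_le_of_ne (hpy.trans hyq) fun h => hpq (inj hpi hqi h)
  have hseg : ∀ x ∈ segment ℝ p q, E.bary i x = 0 ∧ x ∈ E.carrier ∧
      E.bary (i + 2) p ≤ E.bary (i + 2) x ∧ E.bary (i + 2) x ≤ E.bary (i + 2) q := by
    intro x hx
    have hxE := E.convex_carrier.segment_subset
      (E.isClosed_carrier.frontier_subset (mem_nodesOf.1 hpn).2)
      (E.isClosed_carrier.frontier_subset (mem_nodesOf.1 hqn).2) hx
    rw [segment_eq_image_lineMap] at hx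
    obtain ⟨t, ⟨ht0, ht1⟩, rfl⟩ := hx
    rw [bary_lineMap, bary_lineMap, hpi, hqi]
    refine ⟨by ring, hxE, ?_, ?_⟩ <;> nlinarith
  have he : s(p, q) ∈ edgesOf T E := by
    refine mem_edgesOf.2 ⟨hpn, hqn, hpq, fun x hx => ?_, fun x hxn hx => ?_⟩
    · obtain ⟨a, b, -⟩ := hseg x hx
      exact (mem_frontier_iff hd x).2 ⟨b, i, a⟩
    · obtain ⟨a, -, c, d⟩ := hseg x hx
      rcases le_total (E.bary (i + 2) x) (E.bary (i + 2) y) with h | h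
      · exact Or.inl (inj a hpi (le_antisymm (hpmax x ⟨⟨hxn, a⟩, h⟩) c))
      · exact Or.inr (inj a hqi (le_antisymm d (hqmin x ⟨⟨hxn, a⟩, h⟩)))
  set σ := (E.bary (i + 2) y - E.bary (i + 2) p) / (E.bary (i + 2) q - E.bary (i + 2) p) with hσ
  have hpos : 0 < E.bary (i + 2) q - E.bary (i + 2) p := by linarith
  have hσ0 : 0 ≤ σ := div_nonneg (by linarith) hpos.le
  have hσ1 : σ ≤ 1 := div_le_one_of_le₀ (by linarith) hpos.le
  have hyl : y = AffineMap.lineMap p q σ := by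
    refine eq_lineMap_of_bary hd hi hpi hqi ?_
    rw [hσ]; field_simp; ring
  obtain ⟨a, ha⟩ := hg.2 _ he
  rw [seg_mk] at ha
  have hys : y ∈ segment ℝ p q := by
    rw [segment_eq_image_lineMap]; exact ⟨σ, ⟨hσ0, hσ1⟩, hyl.symm⟩
  have e1 := ha hys
  have e2 := ha (left_mem_segment ℝ p q)
  have e3 := ha (right_mem_segment ℝ p q)
  have e4 : g y = (1 - σ) * g p + σ * g q := by rw [e1, e2, e3, hyl, P1.eval_lineMap]
  -- Convexity of the square bounds the left side by the weighted mean of the two squares.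
  have e5 : g y ^ 2 ≤ g p ^ 2 + g q ^ 2 := by
    rw [e4]
    nlinarith [mul_nonneg (mul_nonneg hσ0 (sub_nonneg.2 hσ1)) (sq_nonneg (g p - g q)),
      mul_nonneg hσ0 (sq_nonneg (g p)), mul_nonneg (sub_nonneg.2 hσ1) (sq_nonneg (g q))]
  refine e5.trans ?_
  rw [← Finset.sum_pair hpq (f := fun x => g x ^ 2)]
  refine Finset.sum_le_sum_of_subset_of_nonneg ?_ fun x _ _ => sq_nonneg _
  intro x hx
  rcases Finset.mem_insert.1 hx with rfl | hx
  · exact hpn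
  · rw [Finset.mem_singleton.1 hx]; exact hqn

end AVEM

namespace AVEM

open MeasureTheory Filter Topology
open scoped ContDiff

open Tri

variable {T₀ T : Finset Tri} {E E' : Tri} {Λ : ℕ} {ρ : ℝ}

/-! ### Neighbours across an edge -/

/-- A triangle is the closure of its interior, so an open set that meets it also meets its interior.
-/
lemma IsTiling.notMem_interior (hT : IsTiling T₀ T) (hE : E ∈ T) (hE' : E' ∈ T) (hne : E' ≠ E)
    (hd : E.det ≠ 0) {y : Plane} (hy : y ∈ E.carrier) : y ∉ interior E'.carrier := by
  intro hy'
  rw [← closure_interior hd] at hy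
  obtain ⟨z, hz, hz'⟩ := mem_closure_iff.1 hy _ isOpen_interior hy'
  exact Set.disjoint_left.1 (hT.disjoint E' hE' E hE hne) hz hz'

/-- One endpoint of an edge of `E` that meets the interior of a side of `E'` lies in `E'`. -/
lemma endpoint_mem (hE' : E' ∈ T) (hd' : E'.det ≠ 0) {p q y : Plane} {i : Fin 3}
    (hedge : s(p, q) ∈ edgesOf T E) {t : ℝ} (ht0 : 0 < t) (ht1 : t < 1)
    (hy : y = AffineMap.lineMap p q t) (hp : E'.bary i p = 0) (hq : E'.bary i q = 0)
    (hy1 : 0 < E'.bary (i + 1) y) (hy2 : 0 < E'.bary (i + 2) y) : p ∈ E'.carrier := by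
  obtain ⟨-, -, hne, hseg, hnodes⟩ := mem_edgesOf.1 hedge
  have hsp := sum_bary' hd' i p
  have hsq := sum_bary' hd' i q
  rw [hp] at hsp
  rw [hq] at hsq
  -- a vertex of `E'` on the segment has to be an endpoint
  have hv : ∀ k : Fin 3, E'.bary i (E'.vtx k) = 0 → ∀ s : ℝ, 0 < s → s < t →
      E'.bary (i + 2) (E'.vtx k) = (1 - s) * E'.bary (i + 2) p + s * E'.bary (i + 2) q →
      False := by
    intro k hk s hs0 hst hks
    have e := eq_lineMap_of_bary hd' hk hp hq hks
    have hmem : E'.vtx k ∈ segment ℝ p q := by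
      rw [segment_eq_image_lineMap]; exact ⟨s, ⟨hs0.le, (hst.trans ht1).le⟩, e.symm⟩
    have hn : E'.vtx k ∈ nodesOf T E := mem_nodesOf.2 ⟨vtx_mem_nodes hE' k, hseg hmem⟩
    rcases hnodes _ hn hmem with h | h
    · rw [e, AffineMap.lineMap_eq_left_iff] at h
      exact h.elim hne hs0.ne'
    · rw [e, AffineMap.lineMap_eq_right_iff] at h
      exact h.elim hne (hst.trans ht1).ne
  have hby1 : E'.bary (i + 1) y = (1 - t) * E'.bary (i + 1) p + t * E'.bary (i + 1) q := by
    rw [hy, bary_lineMap]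
  have hby2 : E'.bary (i + 2) y = (1 - t) * E'.bary (i + 2) p + t * E'.bary (i + 2) q := by
    rw [hy, bary_lineMap]
  rw [carrier_eq hd']
  intro j
  rcases fin_three_cases i j with rfl | rfl | rfl
  · exact hp.ge
  · by_contra! hlt
    have hpos : 0 < E'.bary (i + 1) y - E'.bary (i + 1) p := by linarith
    -- If coordinate `i + 1` were negative at `p`, it would vanish at this parameter between `p` and
    -- `y`. On the line the zero is the vertex `i + 2` of `E'`, a node strictly inside the edge.
    set s := t * (-E'.bary (i + 1) p / (E'.bary (i + 1) y - E'.bary (i + 1) p)) with hs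
    have hs1 : -E'.bary (i + 1) p / (E'.bary (i + 1) y - E'.bary (i + 1) p) < 1 := by
      rw [div_lt_one hpos]; linarith
    have hs0 : 0 < -E'.bary (i + 1) p / (E'.bary (i + 1) y - E'.bary (i + 1) p) :=
      div_pos (by linarith) hpos
    refine hv (i + 2) (bary_vtx_ne (fin_ne_add_two i).symm) s (mul_pos ht0 hs0)
      (by rw [hs]; nlinarith) ?_
    rw [bary_vtx_self hd']
    have e : E'.bary (i + 2) p = 1 - E'.bary (i + 1) p := by linarith
    have e' : E'.bary (i + 2) q = 1 - E'.bary (i + 1) q := by linarith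
    have hmul : s * (E'.bary (i + 1) q - E'.bary (i + 1) p) = -E'.bary (i + 1) p := by
      have : t * (E'.bary (i + 1) q - E'.bary (i + 1) p)
          = E'.bary (i + 1) y - E'.bary (i + 1) p := by rw [hby1]; ring
      rw [hs, mul_comm t, mul_assoc, this, div_mul_cancel₀ _ hpos.ne']
    rw [e, e']; linarith
  · by_contra! hlt
    have hpos : 0 < E'.bary (i + 2) y - E'.bary (i + 2) p := by linarith
    set s := t * (-E'.bary (i + 2) p / (E'.bary (i + 2) y - E'.bary (i + 2) p)) with hs
    have hs1 : -E'.bary (i + 2) p / (E'.bary (i + 2) y - E'.bary (i + 2) p) < 1 := by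
      rw [div_lt_one hpos]; linarith
    have hs0 : 0 < -E'.bary (i + 2) p / (E'.bary (i + 2) y - E'.bary (i + 2) p) :=
      div_pos (by linarith) hpos
    refine hv (i + 1) (bary_vtx_ne (fin_ne_add_one i).symm) s (mul_pos ht0 hs0)
      (by rw [hs]; nlinarith) ?_
    rw [bary_vtx_ne (fin_add_one_ne_add_two i)]
    have hmul : s * (E'.bary (i + 2) q - E'.bary (i + 2) p) = -E'.bary (i + 2) p := by
      have : t * (E'.bary (i + 2) q - E'.bary (i + 2) p)
          = E'.bary (i + 2) y - E'.bary (i + 2) p := by rw [hby2]; ring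
      rw [hs, mul_comm t, mul_assoc, this, div_mul_cancel₀ _ hpos.ne']
    linarith

/-- If `E` and `E'` do not overlap, then near a common point of an edge of `E` and a side of `E'`
these are collinear. -/
lemma collinear_of_common (hd : E.det ≠ 0) (hd' : E'.det ≠ 0)
    (hdisj : Disjoint (interior E.carrier) (interior E'.carrier)) {p q y : Plane} {i : Fin 3}
    (hp : p ∈ E.carrier) (hq : q ∈ E.carrier) {t : ℝ} (ht0 : 0 < t) (ht1 : t < 1)
    (hy : y = AffineMap.lineMap p q t) (hyi : E'.bary i y = 0)
    (hy1 : 0 < E'.bary (i + 1) y) (hy2 : 0 < E'.bary (i + 2) y) :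
    E'.bary i p = 0 ∧ E'.bary i q = 0 := by
  have hdisj' : Disjoint (interior E.carrier) E'.carrier := by
    rw [← closure_interior hd']
    exact hdisj.closure_right isOpen_interior
  -- Separate the two triangles by a line. The common point `y` lies on it and is inside the segment
  -- `p q` as well as inside a side of `E'`. Each of them stays on one side of the line, so both are
  -- contained in it.
  obtain ⟨f, u, hf1, hf2⟩ := geometric_hahn_banach_open E.convex_carrier.interior isOpen_interior
    E'.convex_carrier hdisj'
  set g : P1 := ⟨(InnerProductSpace.toDual ℝ Plane).symm f, 0⟩ with hg
  have hgf : ∀ x, g.eval x = f x := by intro x; simp [hg, P1.eval]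
  have hfE : ∀ x ∈ E.carrier, f x ≤ u := by
    intro x hx
    rw [← closure_interior hd] at hx
    exact closure_minimal (fun z hz => (hf1 z hz).le) (isClosed_le f.continuous continuous_const) hx
  have hyE : y ∈ E.carrier := by
    rw [hy]
    exact E.convex_carrier.segment_subset hp hq
      (by rw [segment_eq_image_lineMap]; exact ⟨t, ⟨ht0.le, ht1.le⟩, rfl⟩)
  have hyE' : y ∈ E'.carrier := by
    rw [carrier_eq hd']
    intro j
    rcases fin_three_cases i j with rfl | rfl | rfl
    exacts [hyi.ge, hy1.le, hy2.le]
  have hfy : f y = u := le_antisymm (hfE y hyE) (hf2 y hyE')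
  have e1 : g.eval y = (1 - t) * g.eval p + t * g.eval q := by rw [hy, P1.eval_lineMap]
  rw [hgf, hgf, hgf] at e1
  have hfp := hfE p hp
  have hfq := hfE q hq
  have hfp' : f p = u := by
    refine le_antisymm hfp ?_
    nlinarith
  have hfq' : f q = u := by
    refine le_antisymm hfq ?_
    nlinarith
  have key : ∀ x, f x - u = E'.bary i x * (f (E'.vtx i) - u)
      + E'.bary (i + 1) x * (f (E'.vtx (i + 1)) - u)
      + E'.bary (i + 2) x * (f (E'.vtx (i + 2)) - u) := by
    intro x
    have h1 := eval_eq_sum_bary' hd' i g x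
    rw [hgf, hgf, hgf, hgf] at h1
    have h2 := sum_bary' hd' i x
    linear_combination h1 + u * h2
  have v1 := hf2 _ (E'.vtx_mem (i + 1))
  have v2 := hf2 _ (E'.vtx_mem (i + 2))
  have ky := key y
  rw [hfy, hyi] at ky
  have m1 := mul_nonneg hy1.le (sub_nonneg.2 v1)
  have m2 := mul_nonneg hy2.le (sub_nonneg.2 v2)
  have z1 : f (E'.vtx (i + 1)) - u = 0 :=
    (mul_eq_zero.1 (by linarith : E'.bary (i + 1) y * _ = 0)).resolve_left hy1.ne'
  have z2 : f (E'.vtx (i + 2)) - u = 0 :=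
    (mul_eq_zero.1 (by linarith : E'.bary (i + 2) y * _ = 0)).resolve_left hy2.ne'
  -- Otherwise f would equal u at all vertices of `E'`, hence on the whole plane, against the strict
  -- inequality in the interior of `E`. Therefore f − u is a nonzero multiple of `E'.bary i`.
  have hvi : f (E'.vtx i) - u ≠ 0 := by
    intro h0
    obtain ⟨x, hx⟩ := interior_nonempty hd
    have := key x
    rw [h0, z1, z2] at this
    linarith [hf1 x hx]
  have kp := key p
  have kq := key q
  rw [hfp', z1, z2] at kp
  rw [hfq', z1, z2] at kq
  constructor
  · exact (mul_eq_zero.1 (by linarith : E'.bary i p * _ = 0)).resolve_right hvi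
  · exact (mul_eq_zero.1 (by linarith : E'.bary i q * _ = 0)).resolve_right hvi

/-- An edge lies in the closure of the domain, so a point of it off the boundary is in the domain.
As the domain is open, the parameter can be moved off 0 and 1. -/
lemma edge_inner_point (hT : IsTiling T₀ T) (hE : E ∈ T) (hd : E.det ≠ 0) {p q : Plane}
    (h : s(p, q) ∈ edgesOf T E) (hΩ : ¬ seg s(p, q) ⊆ frontier (domain T₀)) :
    ∃ t : ℝ, 0 < t ∧ t < 1 ∧ AffineMap.lineMap p q t ∈ domain T₀ := by
  obtain ⟨-, -, -, hseg, -⟩ := mem_edgesOf.1 h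
  rw [seg_mk] at hΩ
  obtain ⟨y, hy, hyf⟩ := Set.not_subset.1 hΩ
  have hyE := E.isClosed_carrier.frontier_subset (hseg hy)
  rw [← closure_interior hd] at hyE
  have hyc := closure_mono (hT.interior_subset hE) hyE
  have hyΩ : y ∈ domain T₀ := by
    by_contra hn
    rw [(isOpen_domain T₀).frontier_eq] at hyf
    exact hyf ⟨hyc, hn⟩
  rw [segment_eq_image_lineMap] at hy
  obtain ⟨t, ht, rfl⟩ := hy
  have hcont : Continuous fun t : ℝ => AffineMap.lineMap (k := ℝ) p q t := by
    simp only [AffineMap.lineMap_apply_module]; fun_prop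
  have htc : t ∈ closure (Set.Ioo (0 : ℝ) 1) := by rwa [closure_Ioo zero_ne_one]
  obtain ⟨s, hs, hs'⟩ := mem_closure_iff.1 htc _ ((isOpen_domain T₀).preimage hcont) hyΩ
  exact ⟨s, hs'.1, hs'.2, hs⟩

/-- An edge that is not part of the boundary of the domain belongs to a second element. -/
lemma exists_neighbour (hT₀ : IsConforming T₀) (hT : IsTiling T₀ T) (hE : E ∈ T) {p q : Plane}
    (h : s(p, q) ∈ edgesOf T E) (hΩ : ¬ seg s(p, q) ⊆ frontier (domain T₀)) :
    ∃ E' ∈ T, E' ≠ E ∧ s(p, q) ∈ edgesOf T E' := by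
  have hd := (hT.inForest E hE).det_ne' hT₀
  obtain ⟨t, ht0, ht1, hyΩ⟩ := edge_inner_point hT hE hd h hΩ
  obtain ⟨hpn, hqn, hne, hseg, hnodes⟩ := mem_edgesOf.1 h
  set y : Plane := AffineMap.lineMap p q t with hy
  have hys : y ∈ segment ℝ p q := by
    rw [segment_eq_image_lineMap]; exact ⟨t, ⟨ht0.le, ht1.le⟩, rfl⟩
  obtain ⟨hyE, i, hi⟩ := (mem_frontier_iff hd y).1 (hseg hys)
  -- `y` belongs to another element
  have hex : ∃ E' ∈ T, E' ≠ E ∧ y ∈ E'.carrier := by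
    by_contra! hcon
    -- Otherwise the other elements, a closed set, avoid a neighbourhood of `y`. Pushing `y`
    -- slightly away from vertex `i` makes coordinate `i` negative and so leaves `E`, although the
    -- point stays in the domain and must be covered.
    have hcl : IsClosed (⋃ E' ∈ (T : Set Tri) \ {E}, E'.carrier) :=
      (T.finite_toSet.subset Set.sdiff_subset).isClosed_biUnion fun E' _ => E'.isClosed_carrier
    have hyn : y ∈ (⋃ E' ∈ (T : Set Tri) \ {E}, E'.carrier)ᶜ := by
      simp only [Set.mem_compl_iff, Set.mem_iUnion, exists_prop, not_exists, not_and]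
      exact fun E' hE' => hcon E' hE'.1 hE'.2
    have hU : IsOpen (domain T₀ ∩ (⋃ E' ∈ (T : Set Tri) \ {E}, E'.carrier)ᶜ) :=
      (isOpen_domain T₀).inter hcl.isOpen_compl
    have hc : ContinuousAt (fun s : ℝ => AffineMap.lineMap y (E.vtx i) (-s)) 0 := by
      simp only [AffineMap.lineMap_apply_module]; fun_prop
    have h0 : AffineMap.lineMap (k := ℝ) y (E.vtx i) (-(0 : ℝ)) = y := by simp
    have h1 := hc.eventually_mem (by rw [h0]; exact hU.mem_nhds ⟨hyΩ, hyn⟩)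
    obtain ⟨s, hs, hs0⟩ := ((h1.filter_mono nhdsWithin_le_nhds).and
      (self_mem_nhdsWithin : Set.Ioi (0 : ℝ) ∈ 𝓝[>] 0)).exists
    have hu : AffineMap.lineMap (k := ℝ) y (E.vtx i) (-s) ∈ ⋃ E ∈ T, E.carrier := by
      rw [hT.union_eq]; exact interior_subset hs.1
    simp only [Set.mem_iUnion, exists_prop] at hu
    obtain ⟨E', hE', hu⟩ := hu
    by_cases hEE : E' = E
    · subst hEE
      have := bary_nonneg hd hu i
      rw [bary_lineMap, hi, bary_vtx_self hd] at this
      have : (0 : ℝ) < s := hs0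
      linarith
    · exact hs.2 (Set.mem_biUnion (show E' ∈ (T : Set Tri) \ {E} from ⟨hE', hEE⟩) hu)
  obtain ⟨E', hE', hEE, hyE'⟩ := hex
  have hd' := (hT.inForest E' hE').det_ne' hT₀
  have hyf' : y ∈ frontier E'.carrier := by
    rw [E'.isClosed_carrier.frontier_eq]
    exact ⟨hyE', hT.notMem_interior hE hE' hEE hd hyE⟩
  obtain ⟨-, j, hj⟩ := (mem_frontier_iff hd' y).1 hyf'
  -- A vertex of `E'` is a node, and an edge has no nodes between its endpoints.
  have hyv : y ∉ Set.range E'.vtx := by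
    rintro ⟨k, hk⟩
    have hn : y ∈ nodesOf T E := mem_nodesOf.2 ⟨hk ▸ vtx_mem_nodes hE' k, hseg hys⟩
    rcases hnodes y hn hys with e | e
    · rw [hy, AffineMap.lineMap_eq_left_iff] at e
      exact e.elim hne ht0.ne'
    · rw [hy, AffineMap.lineMap_eq_right_iff] at e
      exact e.elim hne ht1.ne
  obtain ⟨y1, y2⟩ := bary_pos_of_notMem_range hd' hyE' hj hyv
  have hpE := E.isClosed_carrier.frontier_subset (mem_nodesOf.1 hpn).2
  have hqE := E.isClosed_carrier.frontier_subset (mem_nodesOf.1 hqn).2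
  obtain ⟨bp, bq⟩ := collinear_of_common hd hd' (hT.disjoint E hE E' hE' (Ne.symm hEE)) hpE hqE
    ht0 ht1 hy hj y1 y2
  have hpE' := endpoint_mem hE' hd' h ht0 ht1 hy bp bq y1 y2
  have hqE' := endpoint_mem (t := 1 - t) hE' hd' (by rwa [Sym2.eq_swap]) (by linarith)
    (by linarith) (by rw [hy, AffineMap.lineMap_apply_one_sub]) bq bp y1 y2
  refine ⟨E', hE', hEE, mem_edgesOf.2 ⟨mem_nodesOf.2 ⟨(mem_nodesOf.1 hpn).1,
    (mem_frontier_iff hd' p).2 ⟨hpE', j, bp⟩⟩, mem_nodesOf.2 ⟨(mem_nodesOf.1 hqn).1,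
    (mem_frontier_iff hd' q).2 ⟨hqE', j, bq⟩⟩, hne, fun x hx => ?_, fun x hx hxs => ?_⟩⟩
  · refine (mem_frontier_iff hd' x).2 ⟨E'.convex_carrier.segment_subset hpE' hqE' hx, j, ?_⟩
    rw [segment_eq_image_lineMap] at hx
    obtain ⟨s, -, rfl⟩ := hx
    rw [bary_lineMap, bp, bq]; ring
  · exact hnodes x (mem_nodesOf.2 ⟨(mem_nodesOf.1 hx).1, hseg hxs⟩) hxs

/-! ### Normals -/

lemma exists_outwardNormal (hd : E.det ≠ 0) {p q : Plane} (h : s(p, q) ∈ edgesOf T E) :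
    ∃ n, IsOutwardNormal E s(p, q) n := by
  obtain ⟨i, hp, hq⟩ := exists_side_of_edge hd h
  have hg : E.baryGrad i ≠ 0 := by
    intro h0
    have := E.bary_sub i (E.vtx i) p
    rw [h0, inner_zero_left, bary_vtx_self hd, hp] at this
    norm_num at this
  refine ⟨-(‖E.baryGrad i‖⁻¹ • E.baryGrad i), ?_, ?_⟩
  · rw [norm_neg, norm_smul, norm_inv, norm_norm, inv_mul_cancel₀ (norm_ne_zero_iff.2 hg)]
  · intro x hx y hy
    have hx0 : E.bary i x = 0 := by
      rcases Sym2.mem_iff.1 hx with rfl | rfl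
      exacts [hp, hq]
    rw [inner_neg_left, inner_smul_left, ← E.bary_sub, hx0]
    have := bary_nonneg hd hy i
    simp
    positivity

lemma normal_spec (hd : E.det ≠ 0) {p q : Plane} (h : s(p, q) ∈ edgesOf T E) :
    IsOutwardNormal E s(p, q) (normal E s(p, q)) := by
  have hex := exists_outwardNormal hd h
  rw [normal, dif_pos hex]
  exact hex.choose_spec

/-- Two unit vectors with the same orthogonal direction agree up to sign. -/
lemma eq_or_eq_neg_of_orthogonal {n m d : Plane} (hn : ‖n‖ = 1) (hm : ‖m‖ = 1) (hd : d ≠ 0)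
    (h1 : inner ℝ n d = 0) (h2 : inner ℝ m d = 0) : m = n ∨ m = -n := by
  rw [inner_plane] at h1 h2
  have hn' : n 0 ^ 2 + n 1 ^ 2 = 1 := by rw [← norm_sq_plane, hn]; norm_num
  have hm' : m 0 ^ 2 + m 1 ^ 2 = 1 := by rw [← norm_sq_plane, hm]; norm_num
  have hc : n 0 * m 1 - n 1 * m 0 = 0 := by
    by_contra hc
    apply hd
    have a0 : (n 0 * m 1 - n 1 * m 0) * d 0 = 0 := by linear_combination m 1 * h1 - n 1 * h2
    have a1 : (n 0 * m 1 - n 1 * m 0) * d 1 = 0 := by linear_combination n 0 * h2 - m 0 * h1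
    ext k
    fin_cases k
    · exact (mul_eq_zero.1 a0).resolve_left hc
    · exact (mul_eq_zero.1 a1).resolve_left hc
  -- Lagrange's identity: for unit vectors the squares of the inner and the cross product add up to
  -- 1, and the cross product vanishes.
  have hsq : (n 0 * m 0 + n 1 * m 1 - 1) * (n 0 * m 0 + n 1 * m 1 + 1) = 0 := by
    linear_combination (m 0 ^ 2 + m 1 ^ 2) * hn' + hm' - (n 0 * m 1 - n 1 * m 0) * hc
  rcases mul_eq_zero.1 hsq with h | h
  · left
    ext k
    fin_cases k
    · change m 0 = n 0
      linear_combination n 0 * h - m 0 * hn' - n 1 * hc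
    · change m 1 = n 1
      linear_combination n 1 * h - m 1 * hn' + n 0 * hc
  · right
    ext k
    fin_cases k
    · change m 0 = -n 0
      linear_combination n 0 * h - m 0 * hn' - n 1 * hc
    · change m 1 = -n 1
      linear_combination n 1 * h - m 1 * hn' + n 0 * hc

/-- Both endpoints belong to `E`, so the defining inequality at each endpoint can be tested with the
other one. -/
lemma IsOutwardNormal.orthogonal {p q n : Plane} (h : s(p, q) ∈ edgesOf T E)
    (hn : IsOutwardNormal E s(p, q) n) : inner ℝ n (q - p) = 0 := by
  obtain ⟨hpn, hqn, -⟩ := mem_edgesOf.1 h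
  have hpE := E.isClosed_carrier.frontier_subset (mem_nodesOf.1 hpn).2
  have hqE := E.isClosed_carrier.frontier_subset (mem_nodesOf.1 hqn).2
  have h1 := hn.2 p (by simp) q hqE
  have h2 := hn.2 q (by simp) p hpE
  rw [← neg_sub q p, inner_neg_right] at h2
  linarith

/-- The radius of a disc around the midpoint of an edge in which `E` looks like a half plane. -/
def edgeRadius (ρ : ℝ) (Λ : ℕ) (E : Tri) : ℝ := 1 / 2 ^ (Λ + 1) * E.size / (2 * ρ)

/-- Near the midpoint of an edge the element is a half disc. -/
lemma IsAdmissible.half_disc (hA : IsAdmissible T₀ T Λ) (hT₀ : IsConforming T₀)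
    (hT : IsTiling T₀ T) (hE : E ∈ T) (hsh : E.IsShape ρ) {p q n : Plane}
    (h : s(p, q) ∈ edgesOf T E) (hn : IsOutwardNormal E s(p, q) n) {y : Plane}
    (hy : dist y (midpoint ℝ p q) < edgeRadius ρ Λ E) :
    (y ∈ E.carrier ↔ inner ℝ n (y - midpoint ℝ p q) ≤ 0) ∧
      (y ∈ interior E.carrier ↔ inner ℝ n (y - midpoint ℝ p q) < 0) := by
  have hd := hsh.det_ne
  obtain ⟨hpn, hqn, hne, -⟩ := mem_edgesOf.1 h
  obtain ⟨i, hp, hq⟩ := exists_side_of_edge hd h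
  obtain ⟨m1, m2⟩ := hA.le_bary_midpoint hT₀ hT hE h hp hq
  -- In the disc the two coordinates along the side remain positive. Membership in `E` is decided by
  -- the sign of coordinate `i` alone, which is a negative multiple of the normal component.
  have y1 := hsh.pos_of_near m1 hy
  have y2 := hsh.pos_of_near m2 hy
  have hm0 : E.bary i (midpoint ℝ p q) = 0 := by rw [bary_midpoint, hp, hq]; norm_num
  have hg1 : inner ℝ (E.baryGrad i) (q - p) = 0 := by rw [← E.bary_sub, hp, hq]; norm_num
  have hg : E.baryGrad i ≠ 0 := by
    intro h0
    have := E.bary_sub i (E.vtx i) p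
    rw [h0, inner_zero_left, bary_vtx_self hd, hp] at this
    norm_num at this
  have hgp := norm_pos_iff.2 hg
  -- the gradient of the barycentric coordinate is antiparallel to the normal
  have hpar : E.baryGrad i = -(‖E.baryGrad i‖ • n) := by
    have hpq : q - p ≠ 0 := sub_ne_zero.2 hne.symm
    have hu : ‖‖E.baryGrad i‖⁻¹ • E.baryGrad i‖ = 1 := by
      rw [norm_smul, norm_inv, norm_norm, inv_mul_cancel₀ hgp.ne']
    rcases eq_or_eq_neg_of_orthogonal hn.1 hu hpq (hn.orthogonal h)
      (by rw [inner_smul_left, hg1, mul_zero]) with e | e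
    · exfalso
      have h1 := hn.2 p (by simp) _ (E.vtx_mem i)
      rw [← e, inner_smul_left, ← E.bary_sub, bary_vtx_self hd, hp] at h1
      simp at h1
      exact hg h1
    · rw [← smul_neg, ← e, smul_smul, mul_inv_cancel₀ hgp.ne', one_smul]
  have hb : E.bary i y = -(‖E.baryGrad i‖ * inner ℝ n (y - midpoint ℝ p q)) := by
    have := E.bary_sub i y (midpoint ℝ p q)
    rw [hm0, sub_zero] at this
    rw [this]
    conv_lhs => rw [hpar]
    rw [inner_neg_left, inner_smul_left]; rfl
  have hall : ∀ P : ℝ → Prop, P (E.bary (i + 1) y) → P (E.bary (i + 2) y) →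
      ((∀ j, P (E.bary j y)) ↔ P (E.bary i y)) := by
    intro P h1 h2
    refine ⟨fun h => h i, fun h j => ?_⟩
    rcases fin_three_cases i j with rfl | rfl | rfl
    exacts [h, h1, h2]
  constructor
  · rw [carrier_eq hd]
    refine (hall (fun s => 0 ≤ s) y1.le y2.le).trans ?_
    rw [hb, neg_nonneg]
    exact ⟨fun h => by by_contra! hc; nlinarith [mul_pos hgp hc],
      fun h => mul_nonpos_of_nonneg_of_nonpos hgp.le h⟩
  · rw [interior_eq hd]
    refine (hall (fun s => 0 < s) y1 y2).trans ?_
    rw [hb, neg_pos]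
    exact ⟨fun h => by by_contra! hc; nlinarith [mul_nonneg hgp.le hc],
      fun h => mul_neg_of_pos_of_neg hgp h⟩

/-- The geometry of two elements that share the edge with the endpoints `p` and `q`. -/
structure EdgePatch (T : Finset Tri) (E E' : Tri) (p q n : Plane) (r : ℝ) : Prop where
  pos : 0 < r
  norm_eq : ‖n‖ = 1
  normal_eq : normal E s(p, q) = n
  normal_eq' : normal E' s(p, q) = -n
  mem_iff : ∀ y, dist y (midpoint ℝ p q) < r →
    (y ∈ interior E.carrier ↔ inner ℝ n (y - midpoint ℝ p q) < 0)
  mem_iff' : ∀ y, dist y (midpoint ℝ p q) < r →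
    (y ∈ interior E'.carrier ↔ 0 < inner ℝ n (y - midpoint ℝ p q))
  subset : Metric.ball (midpoint ℝ p q) r ⊆ E.carrier ∪ E'.carrier

lemma IsAdmissible.edgePatch (hA : IsAdmissible T₀ T Λ) (hT₀ : IsConforming T₀)
    (hT : IsTiling T₀ T) (hE : E ∈ T) (hE' : E' ∈ T) (hne : E' ≠ E) (hsh : E.IsShape ρ)
    (hsh' : E'.IsShape ρ) {p q : Plane} (h : s(p, q) ∈ edgesOf T E) (h' : s(p, q) ∈ edgesOf T E')
    {r : ℝ} (hr : 0 < r) (hr1 : r ≤ edgeRadius ρ Λ E) (hr2 : r ≤ edgeRadius ρ Λ E') :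
    EdgePatch T E E' p q (normal E s(p, q)) r := by
  have hd := hsh.det_ne
  have hd' := hsh'.det_ne
  have hn := normal_spec hd h
  have hn' := normal_spec hd' h'
  obtain ⟨-, -, hpq, -⟩ := mem_edgesOf.1 h
  have H : ∀ y, dist y (midpoint ℝ p q) < r → _ := fun y hy =>
    hA.half_disc hT₀ hT hE hsh h hn (hy.trans_le hr1)
  have H' : ∀ y, dist y (midpoint ℝ p q) < r → _ := fun y hy =>
    hA.half_disc hT₀ hT hE' hsh' h' hn' (hy.trans_le hr2)
  have hneg : normal E' s(p, q) = -normal E s(p, q) := by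
    rcases eq_or_eq_neg_of_orthogonal hn.1 hn'.1 (sub_ne_zero.2 hpq.symm) (hn.orthogonal h)
      (hn'.orthogonal h') with e | e
    · exfalso
      -- Equal normals would put the point at distance r/2 from the midpoint in direction −n into
      -- the interior of both elements.
      set n := normal E s(p, q) with hnn
      have hdist : dist (midpoint ℝ p q - (r / 2) • n) (midpoint ℝ p q) < r := by
        rw [dist_eq_norm, sub_sub_cancel_left, norm_neg, norm_smul, hn.1, Real.norm_eq_abs,
          abs_of_pos (by positivity)]
        linarith
      have hin : inner ℝ n (midpoint ℝ p q - (r / 2) • n - midpoint ℝ p q) < 0 := by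
        rw [sub_sub_cancel_left, inner_neg_right, inner_smul_right, real_inner_self_eq_norm_sq,
          hn.1]
        linarith
      have a1 := (H _ hdist).2.2 hin
      have a2 := (H' _ hdist).2.2 (by rw [e]; exact hin)
      exact Set.disjoint_left.1 (hT.disjoint E hE E' hE' (Ne.symm hne)) a1 a2
    · exact e
  refine ⟨hr, hn.1, rfl, hneg, fun y hy => (H y hy).2, fun y hy => ?_, fun y hy => ?_⟩
  · rw [(H' y hy).2, hneg, inner_neg_left, neg_lt_zero]
  · rcases le_total (inner ℝ (normal E s(p, q)) (y - midpoint ℝ p q)) 0 with h0 | h0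
    · exact Or.inl ((H y hy).1.2 h0)
    · refine Or.inr ((H' y hy).1.2 ?_)
      rw [hneg, inner_neg_left]; linarith

lemma EdgePatch.subset_domain {p q n : Plane} {r : ℝ} (h : EdgePatch T E E' p q n r)
    (hT : IsTiling T₀ T) (hE : E ∈ T) (hE' : E' ∈ T) :
    Metric.ball (midpoint ℝ p q) r ⊆ domain T₀ := by
  unfold domain
  rw [← hT.union_eq]
  refine interior_maximal (h.subset.trans (Set.union_subset ?_ ?_)) Metric.isOpen_ball
  · exact Set.subset_biUnion_of_mem (u := fun E : Tri => E.carrier) hE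
  · exact Set.subset_biUnion_of_mem (u := fun E : Tri => E.carrier) hE'

/-- Other elements do not enter the patch. -/
lemma EdgePatch.disjoint {p q n : Plane} {r : ℝ} (h : EdgePatch T E E' p q n r)
    (hT₀ : IsConforming T₀) (hT : IsTiling T₀ T) (hE : E ∈ T) (hE' : E' ∈ T) {K : Tri} (hK : K ∈ T)
    (h1 : K ≠ E) (h2 : K ≠ E') : Disjoint (interior K.carrier) (Metric.ball (midpoint ℝ p q) r) := by
  rw [Set.disjoint_left]
  intro y hy hyb
  rcases h.subset hyb with hy' | hy'
  · exact hT.notMem_interior hE hK h1 ((hT.inForest E hE).det_ne' hT₀) hy' hy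
  · exact hT.notMem_interior hE' hK h2 ((hT.inForest E' hE').det_ne' hT₀) hy' hy

open Classical in
/-- Exactly two elements share an interior edge. -/
lemma EdgePatch.filter_eq {p q n : Plane} {r : ℝ} (h : EdgePatch T E E' p q n r)
    (hT₀ : IsConforming T₀) (hT : IsTiling T₀ T) (hE : E ∈ T) (hE' : E' ∈ T)
    (he : s(p, q) ∈ edgesOf T E) (he' : s(p, q) ∈ edgesOf T E') :
    (T.filter fun K => s(p, q) ∈ edgesOf T K) = {E, E'} := by
  ext K
  simp only [Finset.mem_filter, Finset.mem_insert, Finset.mem_singleton]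
  constructor
  · rintro ⟨hK, hKe⟩
    by_contra! hcon
    have hdK := (hT.inForest K hK).det_ne' hT₀
    obtain ⟨-, -, -, hseg, -⟩ := mem_edgesOf.1 hKe
    -- A third element with this edge contains its midpoint, so its interior enters the disc that
    -- `E` and `E'` already fill.
    have hm := K.isClosed_carrier.frontier_subset (hseg (midpoint_mem_segment p q))
    rw [← closure_interior hdK] at hm
    obtain ⟨z, hz, hz'⟩ := mem_closure_iff.1 hm _ Metric.isOpen_ball (Metric.mem_ball_self h.pos)
    exact Set.disjoint_left.1 (h.disjoint hT₀ hT hE hE' hK hcon.1 hcon.2) hz' hz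
  · rintro (rfl | rfl)
    exacts [⟨hE, he⟩, ⟨hE', he'⟩]

end AVEM

namespace AVEM

open MeasureTheory Filter Topology
open scoped ContDiff ENNReal

/-! ### Weak gradients -/

lemma inner_gradient (φ : Plane → ℝ) (x a : Plane) :
    inner ℝ (gradient φ x) a = fderiv ℝ φ x a := inner_gradient_left

lemma norm_gradient (φ : Plane → ℝ) (x : Plane) : ‖gradient φ x‖ = ‖fderiv ℝ φ x‖ := by
  rw [gradient, LinearIsometryEquiv.norm_map]

lemma gradient_eq_zero_of_notMem_tsupport {φ : Plane → ℝ} {x : Plane} (hx : x ∉ tsupport φ) :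
    gradient φ x = 0 := by
  rw [← norm_eq_zero, norm_gradient, norm_eq_zero]
  by_contra h
  exact hx (support_fderiv_subset ℝ h)

lemma continuous_gradient {φ : Plane → ℝ} (h : ContDiff ℝ ∞ φ) : Continuous (gradient φ) := by
  unfold gradient
  exact (LinearIsometryEquiv.continuous _).comp (h.continuous_fderiv (by simp))

lemma IsTest.mono {U U' : Set Plane} {φ : Plane → ℝ} (h : IsTest U φ) (hU : U ⊆ U') :
    IsTest U' φ := ⟨h.1, h.2.1, h.2.2.trans hU⟩

lemma IsTest.eq_zero {U : Set Plane} {φ : Plane → ℝ} (h : IsTest U φ) {x : Plane} (hx : x ∉ U) :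
    φ x = 0 := image_eq_zero_of_notMem_tsupport fun hx' => hx (h.2.2 hx')

lemma IsTest.gradient_eq_zero {U : Set Plane} {φ : Plane → ℝ} (h : IsTest U φ) {x : Plane}
    (hx : x ∉ U) : gradient φ x = 0 :=
  gradient_eq_zero_of_notMem_tsupport fun hx' => hx (h.2.2 hx')

lemma memLp_of_continuous_of_isBounded {F : Type*} [NormedAddCommGroup F]
    {U : Set Plane} (hU : Bornology.IsBounded U) {f : Plane → F}
    (hf : Continuous f) (p : ℝ≥0∞) : MemLp f p (volume.restrict U) := by
  have hc : IsCompact (closure U) := Metric.isCompact_of_isClosed_isBounded isClosed_closure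
    hU.closure
  obtain ⟨C, hC⟩ := hc.exists_bound_of_continuousOn hf.continuousOn
  have : IsFiniteMeasure (volume.restrict (closure U)) := ⟨by
    rw [Measure.restrict_apply_univ]; exact hc.measure_lt_top⟩
  have h1 : MemLp f p (volume.restrict (closure U)) := by
    refine MemLp.of_bound (hf.continuousOn.aestronglyMeasurable_of_isCompact hc
      isClosed_closure.measurableSet) C ?_
    exact (ae_restrict_iff' isClosed_closure.measurableSet).2 (Eventually.of_forall hC)
  exact h1.mono_measure (Measure.restrict_mono subset_closure le_rfl)

lemma continuous_inner_gradient {φ : Plane → ℝ} (h : ContDiff ℝ ∞ φ) (a : Plane) :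
    Continuous fun x => fderiv ℝ φ x a :=
  (h.continuous_fderiv (by simp)).clm_apply continuous_const

/-- Integration by parts against a test function. -/
lemma integral_smul_gradient_eq {U : Set Plane} {v φ : Plane → ℝ} (hv : ContDiff ℝ ∞ v)
    (hφ : IsTest U φ) :
    ∫ x in U, v x • gradient φ x = -∫ x in U, φ x • gradient v x := by
  rw [setIntegral_eq_integral_of_forall_compl_eq_zero
      (fun x hx => by rw [hφ.gradient_eq_zero hx, smul_zero]),
    setIntegral_eq_integral_of_forall_compl_eq_zero
      (fun x hx => by rw [hφ.eq_zero hx, zero_smul])]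
  have hcg : HasCompactSupport (gradient φ) :=
    HasCompactSupport.intro hφ.2.1 fun x hx => gradient_eq_zero_of_notMem_tsupport hx
  have i1 : Integrable fun x => v x • gradient φ x :=
    (hv.continuous.smul (continuous_gradient hφ.1)).integrable_of_hasCompactSupport hcg.smul_left
  have i2 : Integrable fun x => φ x • gradient v x :=
    (hφ.1.continuous.smul (continuous_gradient hv)).integrable_of_hasCompactSupport
      hφ.2.1.smul_right
  refine ext_inner_left ℝ fun a => ?_
  rw [inner_neg_right, ← integral_inner i1, ← integral_inner i2]
  have h := integral_mul_fderiv_eq_neg_fderiv_mul_of_integrable (μ := (volume : Measure Plane))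
    (f := v) (g := φ) (v := a)
    (((continuous_inner_gradient hv a).mul hφ.1.continuous).integrable_of_hasCompactSupport
      hφ.2.1.mul_left)
    ((hv.continuous.mul (continuous_inner_gradient hφ.1 a)).integrable_of_hasCompactSupport
      (hφ.2.1.fderiv_apply (𝕜 := ℝ) a).mul_left)
    ((hv.continuous.mul hφ.1.continuous).integrable_of_hasCompactSupport hφ.2.1.mul_left)
    (fun x _ => (hv.differentiable (by simp)).differentiableAt)
    (fun x _ => (hφ.1.differentiable (by simp)).differentiableAt)
  have e1 : ∀ x, inner ℝ a (v x • gradient φ x) = v x * fderiv ℝ φ x a := fun x => by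
    rw [inner_smul_right, real_inner_comm, inner_gradient]
  have e2 : ∀ x, inner ℝ a (φ x • gradient v x) = fderiv ℝ v x a * φ x := fun x => by
    rw [inner_smul_right, real_inner_comm, inner_gradient, mul_comm]
  simp only [e1, e2]
  exact h

lemma hasWeakGrad_of_contDiff {U : Set Plane} (hU : Bornology.IsBounded U) {v : Plane → ℝ}
    (hv : ContDiff ℝ ∞ v) : HasWeakGrad U v (gradient v) :=
  ⟨memLp_of_continuous_of_isBounded hU hv.continuous 2,
    memLp_of_continuous_of_isBounded hU (continuous_gradient hv) 2,
    fun _ hφ => integral_smul_gradient_eq hv hφ⟩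

lemma P1.gradient_eval (p : P1) (x : Plane) : gradient p.eval x = p.grad := by
  refine ext_inner_right ℝ fun a => ?_
  rw [inner_gradient]
  have h : HasFDerivAt p.eval (innerSL ℝ p.grad) x :=
    ((innerSL ℝ p.grad).hasFDerivAt).add_const _
  rw [h.fderiv]; rfl

lemma P1.hasWeakGrad (p : P1) {U : Set Plane} (hU : Bornology.IsBounded U) :
    HasWeakGrad U p.eval fun _ => p.grad := by
  have := hasWeakGrad_of_contDiff hU p.contDiff_eval
  rwa [show gradient p.eval = fun _ => p.grad from funext p.gradient_eval] at this

variable {U U' : Set Plane} {v w : Plane → ℝ} {g h : Plane → Plane}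

lemma IsTest.memLp_smul {φ : Plane → ℝ} (hφ : IsTest U φ) (p : ℝ≥0∞) : MemLp φ p volume :=
  hφ.1.continuous.memLp_of_hasCompactSupport hφ.2.1

lemma IsTest.memLp_gradient {φ : Plane → ℝ} (hφ : IsTest U φ) (p : ℝ≥0∞) :
    MemLp (gradient φ) p volume :=
  (continuous_gradient hφ.1).memLp_of_hasCompactSupport
    (HasCompactSupport.intro hφ.2.1 fun _ hx => gradient_eq_zero_of_notMem_tsupport hx)

lemma IsTest.integrable_smul {F : Type*} [NormedAddCommGroup F] [NormedSpace ℝ F]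
    {φ : Plane → ℝ} (hφ : IsTest U φ) {f : Plane → F} {V : Set Plane}
    (hf : MemLp f 2 (volume.restrict V)) : Integrable (fun x => φ x • f x) (volume.restrict V) :=
  memLp_one_iff_integrable.1 (MemLp.smul hf ((hφ.memLp_smul 2).restrict V))

lemma IsTest.integrable_smul_gradient {φ : Plane → ℝ} (hφ : IsTest U φ) {f : Plane → ℝ}
    {V : Set Plane} (hf : MemLp f 2 (volume.restrict V)) :
    Integrable (fun x => f x • gradient φ x) (volume.restrict V) :=
  memLp_one_iff_integrable.1 (MemLp.smul ((hφ.memLp_gradient 2).restrict V) hf)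

/-- Weak gradients are unique. -/
lemma HasWeakGrad.ae_eq (hU : IsOpen U) (hg : HasWeakGrad U v g) (hh : HasWeakGrad U v h) :
    g =ᵐ[volume.restrict U] h := by
  have hm := hg.memLp_grad.sub hh.memLp_grad
  have := hU.ae_eq_zero_of_integral_contDiff_smul_eq_zero (μ := volume) (f := g - h)
    (locallyIntegrableOn_of_locallyIntegrable_restrict (hm.locallyIntegrable (by norm_num))) ?_
  · refine (ae_restrict_iff' hU.measurableSet).2 ?_
    filter_upwards [this] with x hx hxU
    exact sub_eq_zero.1 (hx hxU)
  · intro φ h1 h2 h3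
    have hφ : IsTest U φ := ⟨h1, h2, h3⟩
    rw [← setIntegral_eq_integral_of_forall_compl_eq_zero (s := U)
      (fun x hx => by rw [hφ.eq_zero hx, zero_smul])]
    simp only [Pi.sub_apply, smul_sub]
    rw [integral_sub (hφ.integrable_smul hg.memLp_grad) (hφ.integrable_smul hh.memLp_grad),
      sub_eq_zero]
    exact neg_injective ((hg.integral_eq φ hφ).symm.trans (hh.integral_eq φ hφ))

lemma HasWeakGrad.mono (hg : HasWeakGrad U v g) (hU : MeasurableSet U) (hsub : U' ⊆ U) :
    HasWeakGrad U' v g := by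
  refine ⟨hg.memLp.mono_measure (Measure.restrict_mono hsub le_rfl),
    hg.memLp_grad.mono_measure (Measure.restrict_mono hsub le_rfl), fun φ hφ => ?_⟩
  rw [← setIntegral_eq_of_subset_of_forall_sdiff_eq_zero hU hsub
      (fun x hx => by rw [hφ.gradient_eq_zero hx.2, smul_zero]),
    ← setIntegral_eq_of_subset_of_forall_sdiff_eq_zero hU hsub
      (fun x hx => by rw [hφ.eq_zero hx.2, zero_smul])]
  exact hg.integral_eq φ (hφ.mono hsub)

lemma HasWeakGrad.sub (hv : HasWeakGrad U v g) (hw : HasWeakGrad U w h) :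
    HasWeakGrad U (fun x => v x - w x) (fun x => g x - h x) := by
  refine ⟨hv.memLp.sub hw.memLp, hv.memLp_grad.sub hw.memLp_grad, fun φ hφ => ?_⟩
  simp only [sub_smul, smul_sub]
  rw [integral_sub (hφ.integrable_smul_gradient hv.memLp) (hφ.integrable_smul_gradient hw.memLp),
    integral_sub (hφ.integrable_smul hv.memLp_grad) (hφ.integrable_smul hw.memLp_grad),
    hv.integral_eq φ hφ, hw.integral_eq φ hφ]
  abel

lemma MemH1.hasWeakGrad (hv : MemH1 U v) : HasWeakGrad U v (weakGrad U v) := by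
  rw [weakGrad, dif_pos hv]; exact hv.choose_spec

lemma HasWeakGrad.weakGrad_ae_eq (hU : IsOpen U) (hg : HasWeakGrad U v g) :
    weakGrad U v =ᵐ[volume.restrict U] g :=
  (MemH1.hasWeakGrad ⟨g, hg⟩).ae_eq hU hg

lemma HasWeakGrad.semiH1sq_eq (hU : IsOpen U) (hg : HasWeakGrad U v g) :
    semiH1sq U v = ∫ x in U, ‖g x‖ ^ 2 := by
  refine integral_congr_ae ?_
  filter_upwards [hg.weakGrad_ae_eq hU] with x hx
  rw [hx]

lemma MemH10.memH1 (hv : MemH10 U v) : MemH1 U v := ⟨hv.choose, hv.choose_spec.1⟩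

lemma IsTest.memH10 (hU : Bornology.IsBounded U) {φ : Plane → ℝ} (hφ : IsTest U φ) :
    MemH10 U φ := by
  refine ⟨gradient φ, hasWeakGrad_of_contDiff hU hφ.1, fun _ => φ, fun _ => hφ, ?_, ?_⟩ <;>
  simp

lemma gradient_sub_of_contDiff {φ ψ : Plane → ℝ} (hφ : ContDiff ℝ ∞ φ) (hψ : ContDiff ℝ ∞ ψ) :
    gradient (φ - ψ) = gradient φ - gradient ψ := by
  ext1 x
  have h1 := (hφ.differentiable (by simp)).differentiableAt (x := x)
  have h2 := (hψ.differentiable (by simp)).differentiableAt (x := x)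
  simp only [gradient, Pi.sub_apply]
  rw [fderiv_sub h1 h2, map_sub]

lemma IsTest.sub {φ ψ : Plane → ℝ} (hφ : IsTest U φ) (hψ : IsTest U ψ) : IsTest U (φ - ψ) := by
  refine ⟨hφ.1.sub hψ.1, hφ.2.1.sub hψ.2.1, ?_⟩
  refine (tsupport_sub φ ψ).trans (Set.union_subset hφ.2.2 hψ.2.2)

lemma MemH10.sub (hv : MemH10 U v) (hw : MemH10 U w) : MemH10 U (fun x => v x - w x) := by
  obtain ⟨g, hg, φ, hφ, a1, a2⟩ := hv
  obtain ⟨h, hh, ψ, hψ, b1, b2⟩ := hw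
  refine ⟨_, hg.sub hh, fun n => φ n - ψ n, fun n => (hφ n).sub (hψ n), ?_, ?_⟩
  · refine tendsto_of_tendsto_of_tendsto_of_le_of_le tendsto_const_nhds
      (by simpa using a1.add b1) (fun _ => zero_le) fun n => ?_
    have e : (φ n - ψ n) - (fun x => v x - w x) = (φ n - v) - (ψ n - w) := by
      ext x; simp; ring
    rw [e]
    exact eLpNorm_sub_le ((hφ n).memLp_smul 2 |>.restrict U |>.sub hg.memLp).aestronglyMeasurable
      ((hψ n).memLp_smul 2 |>.restrict U |>.sub hh.memLp).aestronglyMeasurable (by norm_num)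
  · refine tendsto_of_tendsto_of_tendsto_of_le_of_le tendsto_const_nhds
      (by simpa using a2.add b2) (fun _ => zero_le) fun n => ?_
    have e : gradient (φ n - ψ n) - (fun x => g x - h x)
        = (gradient (φ n) - g) - (gradient (ψ n) - h) := by
      rw [gradient_sub_of_contDiff (hφ n).1 (hψ n).1]
      ext1 x; simp; abel
    rw [e]
    exact eLpNorm_sub_le
      ((hφ n).memLp_gradient 2 |>.restrict U |>.sub hg.memLp_grad).aestronglyMeasurable
      ((hψ n).memLp_gradient 2 |>.restrict U |>.sub hh.memLp_grad).aestronglyMeasurable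
      (by norm_num)

/-! ### The Poincaré inequality -/

lemma integral_norm_sq_eq {F : Type*} [NormedAddCommGroup F] {μ : Measure Plane}
    {f : Plane → F} (hf : MemLp f 2 μ) : ∫ x, ‖f x‖ ^ 2 ∂μ = (eLpNorm f 2 μ).toReal ^ 2 := by
  rw [hf.eLpNorm_eq_integral_rpow_norm (by norm_num) (by norm_num)]
  have h0 : 0 ≤ ∫ x, ‖f x‖ ^ 2 ∂μ := integral_nonneg fun x => by positivity
  simp only [ENNReal.toReal_ofNat, Real.rpow_two]
  rw [ENNReal.toReal_ofReal (by positivity), ← Real.rpow_natCast, ← Real.rpow_mul h0]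
  norm_num

/-- In the plane the Sobolev inequality bounds the L² norm by the L¹ norm of the gradient. Hölder's
inequality on the bounded set replaces the latter by the L² norm. -/
lemma exists_poincare_test (hU : Bornology.IsBounded U) :
    ∃ C : ℝ≥0∞, C ≠ ⊤ ∧ ∀ φ, IsTest U φ →
      eLpNorm φ 2 (volume.restrict U) ≤ C * eLpNorm (gradient φ) 2 (volume.restrict U) := by
  refine ⟨eLpNormLESNormFDerivOfLeConst ℝ (volume : Measure Plane) U 1 2 *
    (volume.restrict U) Set.univ ^ (1 / (1 : ℝ≥0∞).toReal - 1 / (2 : ℝ≥0∞).toReal), ?_, ?_⟩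
  · refine ENNReal.mul_ne_top ENNReal.coe_ne_top (ENNReal.rpow_ne_top_of_nonneg (by norm_num) ?_)
    rw [Measure.restrict_apply_univ]
    exact hU.measure_lt_top.ne
  · intro φ hφ
    have h1 := eLpNorm_le_eLpNorm_fderiv_of_le (μ := (volume : Measure Plane)) (F := ℝ)
      (u := φ) (s := U) (p := 1) (q := 2) (hφ.1.of_le (by simp))
      ((subset_tsupport φ).trans hφ.2.2) le_rfl (by simp) (by simp; norm_num) hU
    have h2 : eLpNorm (fderiv ℝ φ) 1 volume = eLpNorm (gradient φ) 1 (volume.restrict U) := by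
      rw [eLpNorm_restrict_eq_of_support_subset
        (Function.support_subset_iff'.2 fun x hx => hφ.gradient_eq_zero hx)]
      exact eLpNorm_congr_norm_ae (Eventually.of_forall fun x => (norm_gradient φ x).symm)
    have h3 := eLpNorm_le_eLpNorm_mul_rpow_measure_univ (p := 1) (q := 2)
      (μ := volume.restrict U) (f := gradient φ) (by norm_num)
      ((hφ.memLp_gradient 2).restrict U).aestronglyMeasurable
    calc eLpNorm φ 2 (volume.restrict U) ≤ eLpNorm φ 2 volume :=
          eLpNorm_mono_measure _ Measure.restrict_le_self
      _ ≤ _ := h1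
      _ ≤ _ := by
          rw [ENNReal.coe_one, h2, mul_assoc]
          gcongr
          rw [mul_comm]
          exact h3

/-- Poincaré's inequality on `H¹₀`. -/
lemma exists_poincare (hU : Bornology.IsBounded U) (hUo : IsOpen U) :
    ∃ C : ℝ, 0 < C ∧ ∀ v, MemH10 U v → ∫ x in U, v x ^ 2 ≤ C * semiH1sq U v := by
  obtain ⟨C, hC, h⟩ := exists_poincare_test hU
  refine ⟨C.toReal ^ 2 + 1, by positivity, fun v hv => ?_⟩
  obtain ⟨g, hg, φ, hφ, a1, a2⟩ := hv
  have key : eLpNorm v 2 (volume.restrict U) ≤ C * eLpNorm g 2 (volume.restrict U) := by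
    -- Use the inequality for the approximating test functions and pass to the limit in both norms.
    have hlim : Tendsto (fun n => eLpNorm (φ n - v) 2 (volume.restrict U)
        + C * (eLpNorm (gradient (φ n) - g) 2 (volume.restrict U)
          + eLpNorm g 2 (volume.restrict U))) atTop
        (𝓝 (0 + C * (0 + eLpNorm g 2 (volume.restrict U)))) :=
      a1.add (ENNReal.Tendsto.const_mul (a2.add tendsto_const_nhds) (Or.inr hC))
    rw [zero_add, zero_add] at hlim
    refine ge_of_tendsto' hlim fun n => ?_
    have m1 := ((hφ n).memLp_smul 2).restrict U
    have m2 := ((hφ n).memLp_gradient 2).restrict U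
    have e1 : eLpNorm v 2 (volume.restrict U) ≤ eLpNorm (φ n - v) 2 (volume.restrict U)
        + eLpNorm (φ n) 2 (volume.restrict U) := by
      rw [eLpNorm_sub_comm]
      have := eLpNorm_add_le (p := 2) (hg.memLp.sub m1).aestronglyMeasurable
        m1.aestronglyMeasurable (by norm_num)
      simpa using this
    have e2 : eLpNorm (gradient (φ n)) 2 (volume.restrict U)
        ≤ eLpNorm (gradient (φ n) - g) 2 (volume.restrict U)
          + eLpNorm g 2 (volume.restrict U) := by
      have := eLpNorm_add_le (p := 2) (m2.sub hg.memLp_grad).aestronglyMeasurable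
        hg.memLp_grad.aestronglyMeasurable (by norm_num)
      simpa using this
    exact e1.trans (by gcongr; exact (h _ (hφ n)).trans (by gcongr))
  rw [hg.semiH1sq_eq hUo, integral_norm_sq_eq hg.memLp_grad]
  have e : ∫ x in U, v x ^ 2 = ∫ x in U, ‖v x‖ ^ 2 := by simp
  rw [e, integral_norm_sq_eq hg.memLp]
  have h2 := ENNReal.toReal_mono (ENNReal.mul_ne_top hC hg.memLp_grad.eLpNorm_ne_top) key
  rw [ENNReal.toReal_mul] at h2
  have h3 : (eLpNorm v 2 (volume.restrict U)).toReal ^ 2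
      ≤ (C.toReal * (eLpNorm g 2 (volume.restrict U)).toReal) ^ 2 := by gcongr
  rw [mul_pow] at h3
  nlinarith [sq_nonneg (eLpNorm g 2 (volume.restrict U)).toReal]

end AVEM

namespace AVEM

open MeasureTheory Filter Topology
open scoped ContDiff ENNReal

open Tri

/-! ### The trace inequality -/

lemma exists_deriv_smoothTransition_le :
    ∃ K : ℝ, 0 < K ∧ ∀ t, |deriv Real.smoothTransition t| ≤ K := by
  have hz : ∀ t ∉ Set.Icc (0 : ℝ) 1, deriv Real.smoothTransition t = 0 := by
    intro t ht
    rw [Set.mem_Icc, not_and_or, not_le, not_le] at ht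
    rcases ht with ht | ht
    · have : Real.smoothTransition =ᶠ[𝓝 t] fun _ => 0 := by
        filter_upwards [eventually_lt_nhds ht] with s hs
        exact Real.smoothTransition.zero_of_nonpos hs.le
      rw [this.deriv_eq, deriv_const]
    · have : Real.smoothTransition =ᶠ[𝓝 t] fun _ => 1 := by
        filter_upwards [eventually_gt_nhds ht] with s hs
        exact Real.smoothTransition.one_of_one_le hs.le
      rw [this.deriv_eq, deriv_const]
  have hc : Continuous (deriv Real.smoothTransition) :=
    (Real.smoothTransition.contDiff (n := 1)).continuous_deriv le_rfl
  obtain ⟨K, hK⟩ := isCompact_Icc.exists_bound_of_continuousOn (s := Set.Icc (0 : ℝ) 1)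
    hc.continuousOn
  refine ⟨max K 1, by positivity, fun t => ?_⟩
  by_cases ht : t ∈ Set.Icc (0 : ℝ) 1
  · exact (hK t ht).trans (le_max_left _ _)
  · rw [hz t ht, abs_zero]; positivity

namespace Tri

variable {E : Tri} {ρ δ : ℝ}

/-- A smooth step in the direction of the barycentric coordinate `i`. -/
def step (E : Tri) (δ : ℝ) (i : Fin 3) (x : Plane) : ℝ :=
  Real.smoothTransition (E.bary i x / δ - 1)

/-- A cutoff function that vanishes near the boundary of `E`. -/
def cutoff (E : Tri) (δ : ℝ) (x : Plane) : ℝ := E.step δ 0 x * E.step δ 1 x * E.step δ 2 x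

lemma contDiff_bary (E : Tri) (i : Fin 3) : ContDiff ℝ ∞ (E.bary i) := P1.contDiff_eval _

lemma contDiff_step (E : Tri) (δ : ℝ) (i : Fin 3) : ContDiff ℝ ∞ (E.step δ i) :=
  Real.smoothTransition.contDiff.comp (((E.contDiff_bary i).div_const δ).sub contDiff_const)

lemma contDiff_cutoff (E : Tri) (δ : ℝ) : ContDiff ℝ ∞ (E.cutoff δ) :=
  ((E.contDiff_step δ 0).mul (E.contDiff_step δ 1)).mul (E.contDiff_step δ 2)

lemma abs_step_le (E : Tri) (δ : ℝ) (i : Fin 3) (x : Plane) : |E.step δ i x| ≤ 1 := by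
  rw [step, abs_of_nonneg (Real.smoothTransition.nonneg _)]
  exact Real.smoothTransition.le_one _

lemma step_eq_zero (hδ : 0 < δ) {i : Fin 3} {x : Plane} (h : E.bary i x ≤ δ) :
    E.step δ i x = 0 :=
  Real.smoothTransition.zero_of_nonpos (by rw [sub_nonpos, div_le_one hδ]; exact h)

lemma step_eq_one (hδ : 0 < δ) {i : Fin 3} {x : Plane} (h : 2 * δ ≤ E.bary i x) :
    E.step δ i x = 1 :=
  Real.smoothTransition.one_of_one_le (by rw [le_sub_iff_add_le, le_div_iff₀ hδ]; linarith)

lemma abs_cutoff_le (E : Tri) (δ : ℝ) (x : Plane) : |E.cutoff δ x| ≤ 1 := by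
  rw [cutoff, abs_mul, abs_mul]
  exact mul_le_one₀ (mul_le_one₀ (abs_step_le ..) (abs_nonneg _) (abs_step_le ..)) (abs_nonneg _)
    (abs_step_le ..)

lemma isTest_cutoff (hE : E.det ≠ 0) (hδ : 0 < δ) :
    IsTest (interior E.carrier) (E.cutoff δ) := by
  have hcl : IsClosed {x | ∀ i, δ ≤ E.bary i x} := by
    simp only [Set.ofPred_forall]
    exact isClosed_iInter fun i => isClosed_le continuous_const (E.continuous_bary i)
  have hsub : tsupport (E.cutoff δ) ⊆ {x | ∀ i, δ ≤ E.bary i x} := by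
    refine closure_minimal (fun x hx i => ?_) hcl
    by_contra! h
    apply hx
    have h0 := step_eq_zero hδ h.le
    rw [cutoff]
    fin_cases i <;> simp at h0 <;> rw [h0] <;> ring
  have hint : {x | ∀ i, δ ≤ E.bary i x} ⊆ interior E.carrier := by
    rw [interior_eq hE]; exact fun x hx i => hδ.trans_le (hx i)
  refine ⟨E.contDiff_cutoff δ, ?_, hsub.trans hint⟩
  exact E.isCompact_carrier.of_isClosed_subset (isClosed_tsupport _)
    (hsub.trans (hint.trans interior_subset))

lemma tendsto_cutoff (hE : E.det ≠ 0) {x : Plane} (hx : x ∈ interior E.carrier) :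
    Tendsto (fun δ => E.cutoff δ x) (𝓝[>] 0) (𝓝 1) := by
  rw [interior_eq hE] at hx
  have hi : ∀ i, ∀ᶠ δ in 𝓝[>] (0 : ℝ), 2 * δ ≤ E.bary i x := by
    intro i
    have : ∀ᶠ δ in 𝓝 (0 : ℝ), δ < E.bary i x / 2 := eventually_lt_nhds (half_pos (hx i))
    filter_upwards [this.filter_mono nhdsWithin_le_nhds] with δ h
    linarith
  refine tendsto_const_nhds.congr' ?_
  filter_upwards [hi 0, hi 1, hi 2, self_mem_nhdsWithin] with δ h0 h1 h2 hδ
  rw [cutoff, step_eq_one hδ h0, step_eq_one hδ h1, step_eq_one hδ h2]; norm_num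

lemma fderiv_step (E : Tri) (δ : ℝ) (i : Fin 3) (x a : Plane) :
    fderiv ℝ (E.step δ i) x a
      = deriv Real.smoothTransition (E.bary i x / δ - 1) * (inner ℝ (E.baryGrad i) a / δ) := by
  have h1 : HasFDerivAt (E.bary i) (innerSL ℝ (E.baryGrad i)) x :=
    ((innerSL ℝ (E.baryGrad i)).hasFDerivAt).add_const _
  have h2 : HasFDerivAt (fun x => E.bary i x / δ - 1) (δ⁻¹ • innerSL ℝ (E.baryGrad i)) x := by
    simp only [div_eq_inv_mul]
    exact (h1.const_mul δ⁻¹).sub_const 1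
  have h3 : HasDerivAt Real.smoothTransition (deriv Real.smoothTransition (E.bary i x / δ - 1))
      (E.bary i x / δ - 1) :=
    ((Real.smoothTransition.contDiff (n := 1)).differentiable one_ne_zero).differentiableAt.hasDerivAt
  have h4 := h3.comp_hasFDerivAt x h2
  change fderiv ℝ (Real.smoothTransition ∘ fun x => E.bary i x / δ - 1) x a = _
  rw [h4.fderiv]
  simp
  left; ring

/-- The set in which the step number `i` is not constant. -/
def strip (E : Tri) (δ : ℝ) (i : Fin 3) : Set Plane := {x | x ∈ E.carrier ∧ E.bary i x ≤ 2 * δ}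

lemma measurableSet_strip (E : Tri) (δ : ℝ) (i : Fin 3) : MeasurableSet (E.strip δ i) :=
  (E.isClosed_carrier.inter
    (isClosed_le (E.continuous_bary i) continuous_const)).measurableSet

/-- Shrink `E` towards vertex `i` by the factor 1 − 3δ. On the image coordinate `i` is at least 3δ,
so the strip avoids it and has at most the fraction 1 − (1 − 3δ)² ≤ 6δ of the area. -/
lemma volume_strip_le (hE : E.det ≠ 0) (hδ : 0 < δ) (hδ1 : δ < 1 / 3) (i : Fin 3) :
    volume.real (E.strip δ i) ≤ 6 * δ * volume.real E.carrier := by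
  set S := AffineMap.homothety (E.vtx i) (1 - 3 * δ) '' E.carrier with hS
  have hSE : S ⊆ E.carrier := by
    rintro _ ⟨x, hx, rfl⟩
    rw [AffineMap.homothety_eq_lineMap]
    exact E.convex_carrier.segment_subset (E.vtx_mem i) hx
      (by rw [segment_eq_image_lineMap]; exact ⟨_, ⟨by linarith, by linarith⟩, rfl⟩)
  have hSm : MeasurableSet S :=
    (E.isCompact_carrier.image (AffineMap.homothety_continuous _ _)).isClosed.measurableSet
  have hsub : E.strip δ i ⊆ E.carrier \ S := by
    rintro x ⟨hx, hxi⟩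
    refine ⟨hx, ?_⟩
    rintro ⟨y, hy, rfl⟩
    rw [AffineMap.homothety_eq_lineMap, bary_lineMap, bary_vtx_self hE] at hxi
    have := bary_nonneg hE hy i
    nlinarith
  have hvol : volume.real S = (1 - 3 * δ) ^ 2 * volume.real E.carrier := by
    rw [Measure.real, hS, Measure.addHaar_image_homothety]
    simp [Measure.real]
    exact Or.inl (sq_nonneg _)
  calc volume.real (E.strip δ i) ≤ volume.real (E.carrier \ S) :=
        measureReal_mono hsub (measure_ne_top_of_subset Set.sdiff_subset E.volume_carrier_lt_top.ne)
    _ = volume.real E.carrier - volume.real S :=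
        measureReal_sdiff hSE hSm (h₁ := E.volume_carrier_lt_top.ne)
    _ ≤ _ := by
        rw [hvol]
        have : 0 ≤ volume.real E.carrier := measureReal_nonneg
        nlinarith [mul_nonneg (sq_nonneg δ) this]

/-- The derivative is of order 1/δ but lives on a strip of area of order δ; the two cancel in
`exists_trace_bound`. -/
lemma abs_fderiv_step_le {K : ℝ} (hK : ∀ t, |deriv Real.smoothTransition t| ≤ K)
    (h : IsShape ρ E) (hδ : 0 < δ) (i : Fin 3) {x : Plane} (hx : x ∈ E.carrier) (a : Plane) :
    |fderiv ℝ (E.step δ i) x a|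
      ≤ (E.strip δ i).indicator (fun _ => K * (2 * ρ / E.size * ‖a‖ / δ)) x := by
  have hK0 : 0 ≤ K := (abs_nonneg _).trans (hK 0)
  rw [fderiv_step, abs_mul]
  by_cases hs : E.bary i x ≤ 2 * δ
  · rw [Set.indicator_of_mem (show x ∈ E.strip δ i from ⟨hx, hs⟩)]
    refine mul_le_mul (hK _) ?_ (abs_nonneg _) hK0
    rw [abs_div, abs_of_pos hδ]
    gcongr
    exact (abs_real_inner_le_norm _ _).trans
      (mul_le_mul_of_nonneg_right (h.norm_baryGrad_le i) (norm_nonneg _))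
  · rw [Set.indicator_of_notMem fun hx' => hs hx'.2]
    have : deriv Real.smoothTransition (E.bary i x / δ - 1) = 0 := by
      have hgt : 1 < E.bary i x / δ - 1 := by
        rw [lt_sub_iff_add_lt, lt_div_iff₀ hδ]; linarith
      have : Real.smoothTransition =ᶠ[𝓝 (E.bary i x / δ - 1)] fun _ => 1 := by
        filter_upwards [eventually_gt_nhds hgt] with s hs
        exact Real.smoothTransition.one_of_one_le hs.le
      rw [this.deriv_eq, deriv_const]
    rw [this, abs_zero, zero_mul]

lemma abs_fderiv_cutoff_le (E : Tri) (δ : ℝ) (x a : Plane) :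
    |fderiv ℝ (E.cutoff δ) x a| ≤ |fderiv ℝ (E.step δ 0) x a| + |fderiv ℝ (E.step δ 1) x a|
      + |fderiv ℝ (E.step δ 2) x a| := by
  have hd : ∀ i, HasFDerivAt (E.step δ i) (fderiv ℝ (E.step δ i) x) x := fun i =>
    (((E.contDiff_step δ i).differentiable (by simp)).differentiableAt).hasFDerivAt
  have h : fderiv ℝ (E.cutoff δ) x = _ := (((hd 0).mul (hd 1)).mul (hd 2)).fderiv
  rw [h]
  simp only [add_apply, smul_apply, smul_eq_mul,
    Pi.mul_apply]
  have b0 := E.abs_step_le δ 0 x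
  have b1 := E.abs_step_le δ 1 x
  have b2 := E.abs_step_le δ 2 x
  set s0 := E.step δ 0 x
  set s1 := E.step δ 1 x
  set s2 := E.step δ 2 x
  have t : ∀ s t u : ℝ, |s| ≤ 1 → |t| ≤ 1 → |s * (t * u)| ≤ |u| := by
    intro s t u hs ht
    rw [abs_mul, abs_mul]
    calc |s| * (|t| * |u|) ≤ 1 * (1 * |u|) := by gcongr
      _ = |u| := by ring
  refine (abs_add_le _ _).trans ?_
  rw [mul_add]
  have c2 : |s0 * s1 * fderiv ℝ (E.step δ 2) x a| ≤ |fderiv ℝ (E.step δ 2) x a| := by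
    rw [mul_assoc]; exact t _ _ _ b0 b1
  have := abs_add_le (s2 * (s0 * fderiv ℝ (E.step δ 1) x a))
    (s2 * (s1 * fderiv ℝ (E.step δ 0) x a))
  linarith [t s2 s0 (fderiv ℝ (E.step δ 1) x a) b2 b0,
    t s2 s1 (fderiv ℝ (E.step δ 0) x a) b2 b1]

/-- A continuous function is small near the boundary if it is small on the boundary. -/
lemma exists_strip_bound (hE : E.det ≠ 0) {w : Plane → ℝ} (hw : ContinuousOn w E.carrier) {m : ℝ}
    (hm : ∀ x ∈ frontier E.carrier, |w x| ≤ m) {ε : ℝ} (hε : 0 < ε) :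
    ∃ δ₀ > 0, ∀ δ, 0 < δ → δ < δ₀ → ∀ i, ∀ x ∈ E.strip δ i, |w x| ≤ m + ε := by
  have huc := E.isCompact_carrier.uniformContinuousOn_of_continuous hw
  rw [Metric.uniformContinuousOn_iff] at huc
  obtain ⟨η, hη, huc⟩ := huc ε hε
  have hs := size_pos hE
  refine ⟨η / (4 * E.size), by positivity, fun δ hδ hδ₀ i x ⟨hx, hxi⟩ => ?_⟩
  have hb := bary_nonneg hE hx i
  -- Moving the whole weight of vertex `i` to vertex `i + 1` lands on side `i`, at a distance of at
  -- most 2δ times twice the size.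
  set y := x + E.bary i x • (E.vtx (i + 1) - E.vtx i) with hy
  have hbary : ∀ j, E.bary j y = E.bary j x
      + E.bary i x * (E.bary j (E.vtx (i + 1)) - E.bary j (E.vtx i)) := by
    intro j
    have := E.bary_sub j y x
    rw [hy, add_sub_cancel_left, inner_smul_right, ← E.bary_sub, ← hy] at this
    linarith
  have y0 : E.bary i y = 0 := by
    rw [hbary, bary_vtx_self hE, bary_vtx_ne (fin_ne_add_one i).symm]; ring
  have hyE : y ∈ E.carrier := by
    rw [carrier_eq hE]
    intro j
    rcases fin_three_cases i j with rfl | rfl | rfl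
    · exact y0.ge
    · rw [hbary, bary_vtx_self hE, bary_vtx_ne (fin_ne_add_one i)]
      have := bary_nonneg hE hx (i + 1)
      linarith
    · rw [hbary, bary_vtx_ne (fin_add_one_ne_add_two i), bary_vtx_ne (fin_ne_add_two i)]
      have := bary_nonneg hE hx (i + 2)
      linarith
  have hyf : |w y| ≤ m := hm y ((mem_frontier_iff hE y).2 ⟨hyE, i, y0⟩)
  have hdist : dist x y < η := by
    rw [dist_comm, dist_eq_norm, hy, add_sub_cancel_left, norm_smul, Real.norm_eq_abs,
      abs_of_nonneg hb]
    have h1 : ‖E.vtx (i + 1) - E.vtx i‖ ≤ 2 * E.size := by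
      rw [← dist_eq_norm]; exact E.dist_le (E.vtx_mem _) (E.vtx_mem _)
    rw [lt_div_iff₀ (by positivity)] at hδ₀
    nlinarith [norm_nonneg (E.vtx (i + 1) - E.vtx i)]
  have := huc x hx y hyE hdist
  rw [Real.dist_eq] at this
  have h2 : |w x| ≤ |w x - w y| + |w y| := by
    have := abs_add_le (w x - w y) (w y); rwa [sub_add_cancel] at this
  linarith

end Tri

/-- Integration by parts in a triangle, the boundary term being estimated by the trace. -/
lemma exists_trace_bound : ∃ K : ℝ, 0 < K ∧ ∀ (ρ : ℝ) (E : Tri), E.IsShape ρ →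
    ∀ (w : Plane → ℝ) (g : Plane → Plane), ContinuousOn w E.carrier →
    HasWeakGrad (interior E.carrier) w g → ∀ m : ℝ, (∀ x ∈ frontier E.carrier, |w x| ≤ m) →
    ∀ (Φ : Plane → ℝ), ContDiff ℝ ∞ Φ → ∀ B : ℝ, (∀ x, |Φ x| ≤ B) → ∀ a : Plane,
    |∫ x in interior E.carrier, (w x * fderiv ℝ Φ x a + Φ x * inner ℝ (g x) a)|
      ≤ K * ρ * E.size * ‖a‖ * m * B := by
  obtain ⟨K, hK0, hK⟩ := exists_deriv_smoothTransition_le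
  refine ⟨36 * K * discArea, by have := discArea_pos; positivity, ?_⟩
  intro ρ E hsh w g hw hwg m hm Φ hΦ B hB a
  have hE := hsh.det_ne
  have hρ := hsh.two_le
  have hs := size_pos hE
  have hB0 : 0 ≤ B := (abs_nonneg _).trans (hB 0)
  have hbdd : Bornology.IsBounded (interior E.carrier) :=
    E.isCompact_carrier.isBounded.subset interior_subset
  have hm0 : 0 ≤ m := by
    refine (abs_nonneg _).trans (hm (E.vtx 0) ?_)
    exact (mem_frontier_iff hE _).2 ⟨E.vtx_mem 0, 1, bary_vtx_ne (by decide)⟩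
  set μ := (volume : Measure Plane).restrict (interior E.carrier) with hμ
  have hfin : IsFiniteMeasure μ := ⟨by
    rw [hμ, Measure.restrict_apply_univ]; exact hbdd.measure_lt_top⟩
  have i1 : Integrable (fun x => w x * fderiv ℝ Φ x a) μ :=
    memLp_one_iff_integrable.1 (MemLp.mul (p := 2) (q := 2)
      (memLp_of_continuous_of_isBounded hbdd (continuous_inner_gradient hΦ a) 2) hwg.memLp)
  have i2 : Integrable (fun x => Φ x * inner ℝ (g x) a) μ :=
    memLp_one_iff_integrable.1 (MemLp.mul (p := 2) (q := 2) (hwg.memLp_grad.inner_const a)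
      (memLp_of_continuous_of_isBounded hbdd hΦ.continuous 2))
  have hint : Integrable (fun x => w x * fderiv ℝ Φ x a + Φ x * inner ℝ (g x) a) μ := i1.add i2
  set F := fun x => w x * fderiv ℝ Φ x a + Φ x * inner ℝ (g x) a with hF
  -- the identity with a cutoff
  have hid : ∀ δ, 0 < δ → ∫ x, E.cutoff δ x * F x ∂μ
      = -∫ x, w x * Φ x * fderiv ℝ (E.cutoff δ) x a ∂μ := by
    intro δ hδ
    have htest : IsTest (interior E.carrier) (fun x => E.cutoff δ x * Φ x) := by
      have := isTest_cutoff hE hδ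
      exact ⟨this.1.mul hΦ, this.2.1.mul_right, (tsupport_mul_subset_left).trans this.2.2⟩
    have h := hwg.integral_eq _ htest
    have j1 := htest.integrable_smul_gradient hwg.memLp
    have j2 := htest.integrable_smul hwg.memLp_grad
    have h' := congrArg (fun z => inner ℝ a z) h
    simp only [inner_neg_right] at h'
    rw [← integral_inner j1, ← integral_inner j2] at h'
    have e1 : ∀ x, inner ℝ a (w x • gradient (fun x => E.cutoff δ x * Φ x) x)
        = E.cutoff δ x * (w x * fderiv ℝ Φ x a) + w x * Φ x * fderiv ℝ (E.cutoff δ) x a := by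
      intro x
      rw [inner_smul_right, real_inner_comm, inner_gradient]
      have d1 := ((E.contDiff_cutoff δ).differentiable (by simp)).differentiableAt (x := x)
      have d2 := (hΦ.differentiable (by simp)).differentiableAt (x := x)
      rw [fderiv_fun_mul d1 d2]
      simp
      ring
    have e2 : ∀ x, inner ℝ a ((E.cutoff δ x * Φ x) • g x)
        = E.cutoff δ x * (Φ x * inner ℝ (g x) a) := by
      intro x
      rw [inner_smul_right, real_inner_comm, mul_assoc]
    simp only [e1, e2] at h'
    have k1 : Integrable (fun x => E.cutoff δ x * (w x * fderiv ℝ Φ x a)) μ :=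
      i1.bdd_mul (E.contDiff_cutoff δ).continuous.aestronglyMeasurable
        (c := 1) (Eventually.of_forall fun x => E.abs_cutoff_le δ x)
    have k2 : Integrable (fun x => E.cutoff δ x * (Φ x * inner ℝ (g x) a)) μ :=
      i2.bdd_mul (E.contDiff_cutoff δ).continuous.aestronglyMeasurable
        (c := 1) (Eventually.of_forall fun x => E.abs_cutoff_le δ x)
    have k3 : Integrable (fun x => w x * Φ x * fderiv ℝ (E.cutoff δ) x a) μ := by
      simp only [mul_assoc]
      exact memLp_one_iff_integrable.1 (MemLp.mul (p := 2) (q := 2)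
        (memLp_of_continuous_of_isBounded hbdd
          (hΦ.continuous.mul (continuous_inner_gradient (E.contDiff_cutoff δ) a)) 2) hwg.memLp)
    rw [integral_add k1 k3] at h'
    simp only [hF, mul_add]
    rw [integral_add k1 k2]
    linarith
  -- the bound with a cutoff
  have hbound : ∀ ε > 0, ∀ᶠ δ in 𝓝[>] (0 : ℝ),
      |∫ x, E.cutoff δ x * F x ∂μ| ≤ 36 * K * discArea * ρ * E.size * ‖a‖ * (m + ε) * B := by
    intro ε hε
    obtain ⟨δ₀, hδ₀, hst⟩ := exists_strip_bound hE hw hm hε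
    have hmin : 0 < min δ₀ (1 / 3) := lt_min hδ₀ (by norm_num)
    filter_upwards [Ioo_mem_nhdsGT hmin] with δ ⟨hδ, hδ'⟩
    have hδ1 := hδ'.trans_le (min_le_left _ _)
    have hδ2 := hδ'.trans_le (min_le_right _ _)
    rw [hid δ hδ, abs_neg]
    set c := K * (2 * ρ / E.size * ‖a‖ / δ) with hc
    have hc0 : 0 ≤ c := by positivity
    set G := fun x => (m + ε) * B * ((E.strip δ 0).indicator (fun _ => c) x
      + (E.strip δ 1).indicator (fun _ => c) x + (E.strip δ 2).indicator (fun _ => c) x) with hG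
    have hGi : ∀ i, Integrable ((E.strip δ i).indicator fun _ => c) μ := fun i =>
      (integrable_const c).indicator (E.measurableSet_strip δ i)
    have hle : ∀ᵐ x ∂μ, ‖w x * Φ x * fderiv ℝ (E.cutoff δ) x a‖ ≤ G x := by
      refine (ae_restrict_iff' isOpen_interior.measurableSet).2 (Eventually.of_forall fun x hx => ?_)
      have hxE := interior_subset hx
      have hsum := E.abs_fderiv_cutoff_le δ x a
      have b0 := abs_fderiv_step_le hK hsh hδ 0 hxE a
      have b1 := abs_fderiv_step_le hK hsh hδ 1 hxE a
      have b2 := abs_fderiv_step_le hK hsh hδ 2 hxE a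
      rw [Real.norm_eq_abs, abs_mul, abs_mul]
      by_cases hxs : ∃ i, x ∈ E.strip δ i
      · obtain ⟨i, hi⟩ := hxs
        have hwx := hst δ hδ hδ1 i x hi
        rw [hG]
        exact mul_le_mul (mul_le_mul hwx (hB x) (abs_nonneg _) (by positivity)) (by linarith)
          (abs_nonneg _) (by positivity)
      · push Not at hxs
        rw [Set.indicator_of_notMem (hxs 0)] at b0
        rw [Set.indicator_of_notMem (hxs 1)] at b1
        rw [Set.indicator_of_notMem (hxs 2)] at b2
        have : |fderiv ℝ (E.cutoff δ) x a| = 0 :=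
          le_antisymm (by linarith) (abs_nonneg _)
        rw [this, mul_zero, hG]
        have hind : ∀ i, 0 ≤ (E.strip δ i).indicator (fun _ => c) x := fun i =>
          Set.indicator_nonneg (fun _ _ => hc0) x
        have := hind 0; have := hind 1; have := hind 2
        positivity
    have hGint : Integrable G μ := (((hGi 0).add (hGi 1)).add (hGi 2)).const_mul _
    refine (norm_integral_le_of_norm_le hGint hle).trans ?_
    have hI : ∀ i, ∫ x, (E.strip δ i).indicator (fun _ => c) x ∂μ
        ≤ 6 * δ * (E.size ^ 2 * discArea) * c := by
      intro i
      rw [integral_indicator_const c (E.measurableSet_strip δ i), smul_eq_mul]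
      refine mul_le_mul_of_nonneg_right ?_ hc0
      have h1 : μ.real (E.strip δ i) ≤ volume.real (E.strip δ i) := by
        refine ENNReal.toReal_mono ?_ (Measure.restrict_apply_le _ _)
        exact measure_ne_top_of_subset (fun x hx => hx.1) E.volume_carrier_lt_top.ne
      refine h1.trans ((volume_strip_le hE hδ hδ2 i).trans ?_)
      exact mul_le_mul_of_nonneg_left E.volume_carrier_le (by positivity)
    have h3 : ∫ x, G x ∂μ = (m + ε) * B * (∫ x, (E.strip δ 0).indicator (fun _ => c) x ∂μ
        + ∫ x, (E.strip δ 1).indicator (fun _ => c) x ∂μ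
        + ∫ x, (E.strip δ 2).indicator (fun _ => c) x ∂μ) := by
      have h := integral_add ((hGi 0).add (hGi 1)) (hGi 2)
      simp only [Pi.add_apply] at h
      rw [← integral_add (hGi 0) (hGi 1), ← h, ← integral_const_mul]
    rw [h3]
    have h4 : (m + ε) * B * (∫ x, (E.strip δ 0).indicator (fun _ => c) x ∂μ
        + ∫ x, (E.strip δ 1).indicator (fun _ => c) x ∂μ
        + ∫ x, (E.strip δ 2).indicator (fun _ => c) x ∂μ)
        ≤ (m + ε) * B * (3 * (6 * δ * (E.size ^ 2 * discArea) * c)) :=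
      mul_le_mul_of_nonneg_left (by linarith [hI 0, hI 1, hI 2]) (by positivity)
    -- The powers of δ cancel. The number 36 is composed of three strips, the area factor 6 and the
    -- gradient factor 2.
    refine h4.trans (le_of_eq ?_)
    rw [hc]
    field_simp
    ring
  -- First δ tends to 0 by dominated convergence, then ε does.
  have hlim : Tendsto (fun δ => ∫ x, E.cutoff δ x * F x ∂μ) (𝓝[>] 0) (𝓝 (∫ x, F x ∂μ)) := by
    refine tendsto_integral_filter_of_dominated_convergence (fun x => ‖F x‖)
      (Eventually.of_forall fun δ =>
        (E.contDiff_cutoff δ).continuous.aestronglyMeasurable.mul hint.aestronglyMeasurable)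
      (Eventually.of_forall fun δ => Eventually.of_forall fun x => ?_) hint.norm ?_
    · rw [norm_mul]
      exact mul_le_of_le_one_left (norm_nonneg _) (E.abs_cutoff_le δ x)
    · refine (ae_restrict_iff' isOpen_interior.measurableSet).2 (Eventually.of_forall fun x hx => ?_)
      simpa using (tendsto_cutoff hE hx).mul_const (F x)
  have hfinal : ∀ ε > 0, |∫ x, F x ∂μ| ≤ 36 * K * discArea * ρ * E.size * ‖a‖ * (m + ε) * B :=
    fun ε hε => le_of_tendsto hlim.abs (hbound ε hε)
  have hcont : Tendsto (fun ε => 36 * K * discArea * ρ * E.size * ‖a‖ * (m + ε) * B) (𝓝[>] 0)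
      (𝓝 (36 * K * discArea * ρ * E.size * ‖a‖ * (m + 0) * B)) :=
    Tendsto.mono_left (Continuous.tendsto (by fun_prop) 0) nhdsWithin_le_nhds
  rw [add_zero] at hcont
  exact ge_of_tendsto hcont (eventually_nhdsWithin_of_forall fun ε hε => hfinal ε hε)

end AVEM

namespace AVEM

open MeasureTheory Filter Topology
open scoped ContDiff ENNReal

/-! ### Primitives -/

/-- A smooth primitive in the direction `a` of a test function, up to a translate. -/
lemma exists_primitive {φ : Plane → ℝ} (hφ : ContDiff ℝ ∞ φ) (hc : HasCompactSupport φ) {B : ℝ}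
    (hB : ∀ x, |φ x| ≤ B) (a : Plane) {L : ℝ} (hL : 0 ≤ L) :
    ∃ Φ : Plane → ℝ, ContDiff ℝ ∞ Φ ∧ (∀ x, |Φ x| ≤ L * B) ∧
      ∀ x, fderiv ℝ Φ x a = φ x - φ (x - L • a) := by
  -- The integral of φ along a segment in direction −a is written as a convolution with the image of
  -- Lebesgue measure on an interval, so that it inherits smoothness from φ.
  set μ : Measure Plane := Measure.map (fun t : ℝ => t • a) (volume.restrict (Set.Ioc 0 L)) with hμ
  have hmeas : Measurable fun t : ℝ => t • a := by fun_prop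
  have hfin : IsFiniteMeasure μ := by rw [hμ]; infer_instance
  have hloc : LocallyIntegrable (fun _ : Plane => (1 : ℝ)) μ := locallyIntegrable_const 1
  set Φ := convolution (fun _ : Plane => (1 : ℝ)) φ (ContinuousLinearMap.mul ℝ ℝ) μ with hΦ
  have hΦx : ∀ x, Φ x = ∫ t in (0 : ℝ)..L, φ (x - t • a) := by
    intro x
    rw [hΦ, convolution_def, hμ, integral_map hmeas.aemeasurable, intervalIntegral.integral_of_le hL]
    · simp
    · exact Continuous.aestronglyMeasurable (by simp; exact hφ.continuous.comp (by fun_prop))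
  refine ⟨Φ, hc.contDiff_convolution_right _ hloc hφ, fun x => ?_, fun x => ?_⟩
  · rw [hΦx]
    have := intervalIntegral.norm_integral_le_of_norm_le_const (a := 0) (b := L) (C := B)
      (f := fun t => φ (x - t • a)) fun t _ => hB _
    rw [sub_zero, abs_of_nonneg hL] at this
    rw [mul_comm]; exact this
  · have hdiff := (hc.contDiff_convolution_right (ContinuousLinearMap.mul ℝ ℝ) hloc
      hφ).differentiable (by simp) x
    have h1 : HasDerivAt (fun s : ℝ => Φ (x + s • a)) (fderiv ℝ Φ x a) 0 := by
      have h2 : HasDerivAt (fun s : ℝ => x + s • a) a 0 := by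
        simpa using ((hasDerivAt_id (0 : ℝ)).smul_const a).const_add x
      have h3 : HasFDerivAt Φ (fderiv ℝ Φ x) (x + (0 : ℝ) • a) := by
        simpa using hdiff.hasFDerivAt
      exact h3.comp_hasDerivAt 0 h2
    have hcont : Continuous fun t : ℝ => φ (x + t • a) := hφ.continuous.comp (by fun_prop)
    -- Along the direction `a` the function is a difference of two values of one primitive, whose
    -- derivative is given by the fundamental theorem of calculus.
    have h4 : ∀ s : ℝ, Φ (x + s • a)
        = (∫ t in (0 : ℝ)..s, φ (x + t • a)) - ∫ t in (0 : ℝ)..(s - L), φ (x + t • a) := by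
      intro s
      rw [hΦx, intervalIntegral.integral_interval_sub_left (hcont.intervalIntegrable _ _)
        (hcont.intervalIntegrable _ _)]
      have := intervalIntegral.integral_comp_sub_left (fun t => φ (x + t • a)) s (a := 0) (b := L)
      rw [sub_zero] at this
      rw [← this]
      congr 1; ext t; congr 1; module
    have h5 : HasDerivAt (fun s : ℝ => Φ (x + s • a)) (φ x - φ (x - L • a)) 0 := by
      simp only [h4]
      refine HasDerivAt.sub ?_ ?_
      · simpa using (hcont.integral_hasStrictDerivAt 0 0).hasDerivAt
      · have h6 := (hcont.integral_hasStrictDerivAt 0 (0 - L)).hasDerivAt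
        have h7 : HasDerivAt (fun s : ℝ => s - L) 1 0 := (hasDerivAt_id 0).sub_const L
        have h8 := h6.comp (0 : ℝ) h7
        simp only [zero_sub, mul_one] at h8
        rw [show x + -L • a = x - L • a by module] at h8
        exact h8
    exact h1.unique h5

/-! ### The divergence theorem in a half plane -/

/-- The rotation by a right angle. -/
def perp (n : Plane) : Plane := !₂[-(n 1), n 0]

lemma norm_perp (n : Plane) : ‖perp n‖ = ‖n‖ := by
  rw [← sq_eq_sq₀ (norm_nonneg _) (norm_nonneg _), norm_sq_plane, norm_sq_plane]
  simp [perp]; ring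

lemma inner_perp (n : Plane) : inner ℝ n (perp n) = 0 := by
  rw [inner_plane]; simp [perp]; ring

/-- Orthonormal coordinates with origin `m` whose first axis is spanned by `n`. -/
lemma measurePreserving_frame {n : Plane} (hn : ‖n‖ = 1) (m : Plane) :
    MeasurePreserving (fun z : ℝ × ℝ => m + (z.1 • n + z.2 • perp n)) ∧
      MeasurableEmbedding (fun z : ℝ × ℝ => m + (z.1 • n + z.2 • perp n)) := by
  have hon : Orthonormal ℝ ![n, perp n] := by
    rw [orthonormal_iff_ite]
    intro i j
    fin_cases i <;> fin_cases j <;> simp [hn, norm_perp, inner_perp, real_inner_comm]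
  have hcard : Fintype.card (Fin 2) = Module.finrank ℝ Plane := by simp
  set b : OrthonormalBasis (Fin 2) ℝ Plane :=
    (basisOfOrthonormalOfCardEqFinrank hon hcard).toOrthonormalBasis
      (by rw [coe_basisOfOrthonormalOfCardEqFinrank]; exact hon) with hb
  have hb0 : ∀ i, b i = ![n, perp n] i := by
    intro i
    rw [hb, Module.Basis.coe_toOrthonormalBasis, coe_basisOfOrthonormalOfCardEqFinrank]
  have e1 : MeasurePreserving (fun z : ℝ × ℝ =>
      b.repr.symm (WithLp.toLp 2 (MeasurableEquiv.finTwoArrow.symm z))) :=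
    b.measurePreserving_repr_symm.comp
      ((PiLp.volume_preserving_toLp (Fin 2)).comp
        ((volume_preserving_finTwoArrow ℝ).symm MeasurableEquiv.finTwoArrow))
  have hfun : (fun z : ℝ × ℝ => m + (z.1 • n + z.2 • perp n)) = fun z : ℝ × ℝ => m +
      b.repr.symm (WithLp.toLp 2 (MeasurableEquiv.finTwoArrow.symm z)) := by
    ext1 z
    congr 1
    rw [← b.sum_repr_symm, Fin.sum_univ_two, hb0, hb0]
    rfl
  have e2 : MeasurableEmbedding (fun z : ℝ × ℝ =>
      b.repr.symm (WithLp.toLp 2 (MeasurableEquiv.finTwoArrow.symm z))) :=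
    b.repr.symm.toHomeomorph.measurableEmbedding.comp
      ((MeasurableEquiv.toLp 2 (Fin 2 → ℝ)).measurableEmbedding.comp
        (MeasurableEquiv.finTwoArrow (α := ℝ)).symm.measurableEmbedding)
  rw [hfun]
  exact ⟨(measurePreserving_add_left volume m).comp e1, (measurableEmbedding_addLeft m).comp e2⟩

/-- The integral of a derivative over a half plane. -/
lemma integral_halfPlane {φ : Plane → ℝ} (hφ : ContDiff ℝ ∞ φ) (hc : HasCompactSupport φ)
    {n : Plane} (hn : ‖n‖ = 1) (m a : Plane) :
    ∫ x in {x | inner ℝ n (x - m) < 0}, fderiv ℝ φ x a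
      = inner ℝ n a * ∫ t : ℝ, φ (m + t • perp n) := by
  obtain ⟨hmp, hme⟩ := measurePreserving_frame hn m
  set f := fun z : ℝ × ℝ => m + (z.1 • n + z.2 • perp n) with hf
  have hpre : f ⁻¹' {x | inner ℝ n (x - m) < 0} = Set.Iio 0 ×ˢ Set.univ := by
    ext z
    simp [hf, inner_add_right, inner_smul_right, inner_perp, hn]
  -- Split `a` into a normal and a tangential part. The tangential derivative integrates to zero
  -- along every line parallel to the boundary; the normal one integrates to the boundary values.
  have hdec : a = inner ℝ n a • n + inner ℝ (perp n) a • perp n := by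
    have h1 : n 0 ^ 2 + n 1 ^ 2 = 1 := by rw [← norm_sq_plane, hn]; norm_num
    rw [inner_plane, inner_plane]
    ext k
    fin_cases k <;> simp [perp]
    · linear_combination -(a 0) * h1
    · linear_combination -(a 1) * h1
  have hint : ∀ b : Plane, Integrable (fun z : ℝ × ℝ => fderiv ℝ φ (f z) b)
      ((volume.restrict (Set.Iio 0)).prod volume) := by
    intro b
    have h1 : Integrable (fun x => fderiv ℝ φ x b) :=
      (continuous_inner_gradient hφ b).integrable_of_hasCompactSupport
        (hc.fderiv_apply (𝕜 := ℝ) b)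
    have h2 := (hmp.integrable_comp_emb hme).2 h1
    have h3 := h2.integrableOn (s := Set.Iio 0 ×ˢ Set.univ)
    rwa [IntegrableOn, Measure.volume_eq_prod, ← Measure.prod_restrict, Measure.restrict_univ] at h3
  have hfd : ∀ z, HasFDerivAt φ (fderiv ℝ φ (f z)) (f z) := fun z =>
    ((hφ.differentiable (by simp)).differentiableAt).hasFDerivAt
  have hiso : ∀ (y d : Plane), ‖d‖ = 1 → HasCompactSupport fun s : ℝ => φ (y + s • d) := by
    intro y d hd
    have h1 : Isometry fun s : ℝ => y + s • d := by
      refine Isometry.of_dist_eq fun s t => ?_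
      rw [dist_add_left, dist_eq_norm, ← sub_smul, norm_smul, hd, mul_one, ← dist_eq_norm]
    exact hc.comp_isClosedEmbedding h1.isClosedEmbedding
  have hline : ∀ (y d : Plane), ContDiff ℝ 1 fun s : ℝ => φ (y + s • d) := fun y d =>
    (hφ.of_le (by simp)).comp (contDiff_const.add (contDiff_id.smul contDiff_const))
  have hderiv : ∀ (y d : Plane) (s : ℝ),
      deriv (fun s : ℝ => φ (y + s • d)) s = fderiv ℝ φ (y + s • d) d := by
    intro y d s
    have h2 : HasDerivAt (fun s : ℝ => y + s • d) d s := by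
      simpa using ((hasDerivAt_id s).smul_const d).const_add y
    exact ((((hφ.differentiable (by simp)).differentiableAt).hasFDerivAt).comp_hasDerivAt s
      h2).deriv
  have hn1 : ∀ t : ℝ, ∫ s in Set.Iio (0 : ℝ), fderiv ℝ φ (f (s, t)) n = φ (m + t • perp n) := by
    intro t
    have h := (hiso (m + t • perp n) n hn).integral_Iic_deriv_eq (hline _ _) 0
    rw [integral_Iic_eq_integral_Iio] at h
    simp only [hderiv, zero_smul, add_zero] at h
    rw [← h]
    refine integral_congr_ae (Eventually.of_forall fun s => ?_)
    simp only [hf]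
    rw [show m + (s • n + t • perp n) = m + t • perp n + s • n by abel]
  have hn2 : ∀ s : ℝ, ∫ t : ℝ, fderiv ℝ φ (f (s, t)) (perp n) = 0 := by
    intro s
    have hcs := hiso (m + s • n) (perp n) (by rw [norm_perp, hn])
    have h : ∫ t : ℝ, deriv (fun t : ℝ => φ (m + s • n + t • perp n)) t = 0 := by
      refine integral_eq_zero_of_hasDerivAt_of_integrable
        (fun t => ((hline _ _).differentiable one_ne_zero t).hasDerivAt) ?_ ?_
      · exact ((hline _ _).continuous_deriv le_rfl).integrable_of_hasCompactSupport hcs.deriv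
      · exact (hline _ _).continuous.integrable_of_hasCompactSupport hcs
    simp only [hderiv] at h
    rw [← h]
    refine integral_congr_ae (Eventually.of_forall fun t => ?_)
    simp only [hf]
    rw [add_assoc]
  rw [← hmp.setIntegral_preimage_emb hme, hpre, Measure.volume_eq_prod, ← Measure.prod_restrict,
    Measure.restrict_univ]
  have e : ∀ z : ℝ × ℝ, fderiv ℝ φ (f z) a = inner ℝ n a * fderiv ℝ φ (f z) n
      + inner ℝ (perp n) a * fderiv ℝ φ (f z) (perp n) := by
    intro z
    conv_lhs => rw [hdec]
    simp
  simp only [e]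
  rw [integral_add ((hint n).const_mul _) ((hint (perp n)).const_mul _), integral_const_mul,
    integral_const_mul, integral_prod_symm _ (hint n), integral_prod _ (hint (perp n))]
  simp only [hn1, hn2, integral_zero, mul_zero, add_zero]

/-! ### Bump functions -/

/-- A fixed bump function. -/
def refBump : ContDiffBump (0 : Plane) := ⟨1, 2, one_pos, one_lt_two⟩

/-- The bump function with centre `m` and radius `r`. -/
def bump (m : Plane) (r : ℝ) (x : Plane) : ℝ := refBump (r⁻¹ • (x - m))

variable {m : Plane} {r : ℝ}

lemma contDiff_bump (m : Plane) (r : ℝ) : ContDiff ℝ ∞ (bump m r) :=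
  refBump.contDiff.comp (by fun_prop : ContDiff ℝ ∞ fun x : Plane => r⁻¹ • (x - m))

lemma bump_nonneg (x : Plane) : 0 ≤ bump m r x := refBump.nonneg

lemma bump_le_one (x : Plane) : bump m r x ≤ 1 := refBump.le_one

lemma bump_eq_one (hr : 0 < r) {x : Plane} (hx : dist x m ≤ r) : bump m r x = 1 := by
  apply refBump.one_of_mem_closedBall
  rw [mem_closedBall_zero_iff, norm_smul, norm_inv, Real.norm_eq_abs, abs_of_pos hr,
    ← dist_eq_norm, inv_mul_le_iff₀ hr]
  simpa [refBump] using hx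

lemma bump_eq_zero (hr : 0 < r) {x : Plane} (hx : 2 * r ≤ dist x m) : bump m r x = 0 := by
  apply refBump.zero_of_le_dist
  rw [dist_zero_right, norm_smul, norm_inv, Real.norm_eq_abs, abs_of_pos hr, ← dist_eq_norm,
    le_inv_mul_iff₀ hr]
  simpa [refBump, mul_comm] using hx

lemma tsupport_bump_subset (hr : 0 < r) : tsupport (bump m r) ⊆ Metric.closedBall m (2 * r) := by
  refine closure_minimal (fun x hx => ?_) Metric.isClosed_closedBall
  rw [Metric.mem_closedBall]
  by_contra! h
  exact hx (bump_eq_zero hr h.le)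

lemma hasCompactSupport_bump (hr : 0 < r) : HasCompactSupport (bump m r) :=
  (isCompact_closedBall m (2 * r)).of_isClosed_subset (isClosed_tsupport _)
    (tsupport_bump_subset hr)

lemma exists_gradient_bump_le :
    ∃ C : ℝ, 0 < C ∧ ∀ (m : Plane) (r : ℝ), 0 < r → ∀ x, ‖fderiv ℝ (bump m r) x‖ ≤ C / r := by
  have hcont : Continuous (fderiv ℝ (refBump : Plane → ℝ)) :=
    (refBump.contDiff (n := 1)).continuous_fderiv one_ne_zero
  obtain ⟨C, hC⟩ := hcont.bounded_above_of_compact_support (refBump.hasCompactSupport.fderiv (𝕜 := ℝ))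
  refine ⟨max C 1, by positivity, fun m r hr x => ?_⟩
  have h1 : HasFDerivAt (fun x : Plane => r⁻¹ • (x - m)) (r⁻¹ • ContinuousLinearMap.id ℝ Plane) x :=
    ((hasFDerivAt_id x).sub_const m).const_smul r⁻¹
  have h2 : HasFDerivAt (refBump : Plane → ℝ) (fderiv ℝ refBump (r⁻¹ • (x - m))) (r⁻¹ • (x - m)) :=
    ((refBump.contDiff (n := 1)).differentiable one_ne_zero).differentiableAt.hasFDerivAt
  have h3 := (h2.comp x h1).fderiv
  change fderiv ℝ (bump m r) x = _ at h3
  rw [h3, ContinuousLinearMap.comp_smul, ContinuousLinearMap.comp_id, norm_smul, norm_inv,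
    Real.norm_eq_abs, abs_of_pos hr, div_eq_inv_mul]
  gcongr
  exact (hC _).trans (le_max_left _ _)

/-- The weighted `L²` norm of an affine function controls its coefficients. -/
lemma le_integral_bump_mul_sq (hr : 0 < r) (p : P1) :
    Tri.discArea / 256 * r ^ 2 * (p.eval m ^ 2 + r ^ 2 * ‖p.grad‖ ^ 2)
      ≤ ∫ x, bump m r x * p.eval x ^ 2 := by
  have hint : Integrable fun x => bump m r x * p.eval x ^ 2 :=
    ((contDiff_bump m r).continuous.mul (p.continuous_eval.pow 2)).integrable_of_hasCompactSupport
      (hasCompactSupport_bump hr).mul_right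
  -- Go from `m` the distance r/2 along the gradient, in the sense that increases the modulus. On
  -- the disc of radius r/4 there the bump is 1 and the modulus is at least |p(m)| + r‖∇p‖/4. The
  -- area of the disc and this quarter contribute 1/16 each to 1/256.
  obtain ⟨σ, hσ, hσp⟩ : ∃ σ : ℝ, |σ| = 1 ∧ σ * p.eval m = |p.eval m| := by
    rcases abs_cases (p.eval m) with ⟨h, _⟩ | ⟨h, _⟩
    · exact ⟨1, by simp, by rw [h]; ring⟩
    · exact ⟨-1, by simp, by rw [h]; ring⟩
  have hσ2 : σ ^ 2 = 1 := by rw [← sq_abs, hσ]; norm_num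
  set e := ‖p.grad‖⁻¹ • p.grad with he
  have he1 : ‖e‖ ≤ 1 := by
    rw [he, norm_smul, norm_inv, norm_norm]; exact inv_mul_le_one
  have he2 : inner ℝ p.grad e = ‖p.grad‖ := by
    rw [he, inner_smul_right, real_inner_self_eq_norm_sq]
    by_cases h0 : ‖p.grad‖ = 0
    · rw [h0]; simp
    · field_simp
  set c := m + (σ * (r / 2)) • e with hc
  have hball : ∀ x ∈ Metric.ball c (r / 4),
      p.eval m ^ 2 + r ^ 2 * ‖p.grad‖ ^ 2 / 16 ≤ bump m r x * p.eval x ^ 2 := by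
    intro x hx
    rw [Metric.mem_ball] at hx
    have hxm : dist x m ≤ r := by
      have : dist c m ≤ r / 2 := by
        rw [hc, dist_eq_norm, add_sub_cancel_left, norm_smul, norm_mul, Real.norm_eq_abs,
          Real.norm_eq_abs, hσ, abs_of_pos (by positivity)]
        nlinarith [norm_nonneg e]
      linarith [dist_triangle x c m]
    rw [bump_eq_one hr hxm, one_mul]
    have h1 : p.eval x = p.eval m + σ * (r / 2) * ‖p.grad‖ + inner ℝ p.grad (x - c) := by
      have a1 := p.eval_sub x c
      have a2 := p.eval_sub c m
      rw [hc, add_sub_cancel_left, inner_smul_right, he2, ← hc] at a2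
      linarith
    have h2 : |inner ℝ p.grad (x - c)| ≤ ‖p.grad‖ * (r / 4) :=
      (abs_real_inner_le_norm _ _).trans
        (mul_le_mul_of_nonneg_left (by rw [← dist_eq_norm]; exact hx.le) (norm_nonneg _))
    have h3 : |p.eval m| + r * ‖p.grad‖ / 4 ≤ σ * p.eval x := by
      have : -(‖p.grad‖ * (r / 4)) ≤ σ * inner ℝ p.grad (x - c) := by
        have h4 : |σ * inner ℝ p.grad (x - c)| ≤ ‖p.grad‖ * (r / 4) := by
          rw [abs_mul, hσ, one_mul]; exact h2
        exact (abs_le.1 h4).1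
      rw [h1, mul_add, mul_add, hσp]
      have : σ * (σ * (r / 2) * ‖p.grad‖) = r / 2 * ‖p.grad‖ := by
        calc _ = σ ^ 2 * (r / 2 * ‖p.grad‖) := by ring
          _ = _ := by rw [hσ2, one_mul]
      linarith
    have h5 : p.eval x ^ 2 = (σ * p.eval x) ^ 2 := by rw [mul_pow, hσ2, one_mul]
    have h6 : (|p.eval m| + r * ‖p.grad‖ / 4) ^ 2 ≤ (σ * p.eval x) ^ 2 := by gcongr
    rw [h5]
    refine le_trans ?_ h6
    have : 0 ≤ |p.eval m| * (r * ‖p.grad‖) := by positivity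
    nlinarith [sq_abs (p.eval m)]
  calc Tri.discArea / 256 * r ^ 2 * (p.eval m ^ 2 + r ^ 2 * ‖p.grad‖ ^ 2)
      ≤ (p.eval m ^ 2 + r ^ 2 * ‖p.grad‖ ^ 2 / 16) * volume.real (Metric.ball c (r / 4)) := by
        rw [Tri.volume_real_ball c (by positivity)]
        have := Tri.discArea_pos
        have h : 0 ≤ Tri.discArea * r ^ 2 * p.eval m ^ 2 := by positivity
        nlinarith
    _ = ∫ x in Metric.ball c (r / 4), (p.eval m ^ 2 + r ^ 2 * ‖p.grad‖ ^ 2 / 16) := by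
        rw [setIntegral_const, smul_eq_mul, mul_comm]
    _ ≤ ∫ x in Metric.ball c (r / 4), bump m r x * p.eval x ^ 2 :=
        setIntegral_mono_on (integrableOn_const measure_ball_lt_top.ne) hint.integrableOn
          Metric.isOpen_ball.measurableSet hball
    _ ≤ _ := setIntegral_le_integral hint
        (Eventually.of_forall fun x => mul_nonneg (bump_nonneg x) (sq_nonneg _))

/-- The integral of the bump function along a line through its centre. -/
lemma le_integral_bump_line (hr : 0 < r) {d : Plane} (hd : ‖d‖ = 1) :
    r ≤ ∫ t : ℝ, bump m r (m + t • d) := by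
  have hcs : HasCompactSupport fun t : ℝ => bump m r (m + t • d) := by
    have h1 : Isometry fun s : ℝ => m + s • d := by
      refine Isometry.of_dist_eq fun s t => ?_
      rw [dist_add_left, dist_eq_norm, ← sub_smul, norm_smul, hd, mul_one, ← dist_eq_norm]
    exact (hasCompactSupport_bump hr).comp_isClosedEmbedding h1.isClosedEmbedding
  have hint : Integrable fun t : ℝ => bump m r (m + t • d) :=
    ((contDiff_bump m r).continuous.comp (by fun_prop)).integrable_of_hasCompactSupport hcs
  calc r = ∫ t in Set.Ioc (0 : ℝ) r, (1 : ℝ) := by simp [hr.le]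
    _ = ∫ t in Set.Ioc (0 : ℝ) r, bump m r (m + t • d) := by
        refine setIntegral_congr_fun measurableSet_Ioc fun t ht => ?_
        rw [bump_eq_one hr]
        rw [dist_eq_norm, add_sub_cancel_left, norm_smul, hd, mul_one, Real.norm_eq_abs,
          abs_of_pos ht.1]
        exact ht.2
    _ ≤ _ := setIntegral_le_integral hint (Eventually.of_forall fun t => bump_nonneg _)

end AVEM

namespace AVEM

open MeasureTheory Filter Topology
open scoped ContDiff ENNReal

open Tri

/-! ### Local projections -/

/-- Cauchy–Schwarz against the constant 1: the integral of (‖f‖ − t)² is a nonnegative quadratic in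
t, so its discriminant is not positive. -/
lemma sq_integral_norm_le {F : Type*} [NormedAddCommGroup F] {μ : Measure Plane}
    [IsFiniteMeasure μ] {f : Plane → F} (hf : MemLp f 2 μ) :
    (∫ x, ‖f x‖ ∂μ) ^ 2 ≤ μ.real Set.univ * ∫ x, ‖f x‖ ^ 2 ∂μ := by
  have h1 : Integrable (fun x => ‖f x‖) μ := (hf.integrable one_le_two).norm
  have h2 : Integrable (fun x => ‖f x‖ ^ 2) μ := hf.integrable_norm_pow two_ne_zero
  have key : ∀ t : ℝ, 0 ≤ μ.real Set.univ * (t * t) + (-2 * ∫ x, ‖f x‖ ∂μ) * t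
      + ∫ x, ‖f x‖ ^ 2 ∂μ := by
    intro t
    have h3 : 0 ≤ ∫ x, (‖f x‖ - t) ^ 2 ∂μ := integral_nonneg fun x => sq_nonneg _
    have h4 : ∫ x, (‖f x‖ - t) ^ 2 ∂μ = (∫ x, ‖f x‖ ^ 2 ∂μ) - (∫ x, 2 * t * ‖f x‖ ∂μ)
        + ∫ _x, t ^ 2 ∂μ := by
      have h5 : Integrable (fun x => ‖f x‖ ^ 2 - 2 * t * ‖f x‖) μ := h2.sub (h1.const_mul _)
      rw [← integral_sub h2 (h1.const_mul _), ← integral_add h5 (integrable_const _)]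
      exact integral_congr_ae (.of_forall fun x => by ring)
    rw [h4, integral_const_mul, integral_const, smul_eq_mul] at h3
    linarith
  have := discrim_le_zero key
  rw [discrim] at this
  linarith

lemma abs_integral_le_of_memLp {F : Type*} [NormedAddCommGroup F] {μ : Measure Plane}
    [IsFiniteMeasure μ] {f : Plane → F} (hf : MemLp f 2 μ) {h : Plane → ℝ} {B : ℝ} (hB : 0 ≤ B)
    (hb : ∀ x, |h x| ≤ B * ‖f x‖) :
    |∫ x, h x ∂μ| ≤ B * (√(μ.real Set.univ) * √(∫ x, ‖f x‖ ^ 2 ∂μ)) := by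
  have h1 : Integrable (fun x => ‖f x‖) μ := (hf.integrable one_le_two).norm
  calc |∫ x, h x ∂μ| ≤ ∫ x, B * ‖f x‖ ∂μ :=
        norm_integral_le_of_norm_le (f := h) (h1.const_mul B) (.of_forall hb)
    _ = B * ∫ x, ‖f x‖ ∂μ := integral_const_mul _ _
    _ ≤ _ := by
        rw [← Real.sqrt_mul measureReal_nonneg]
        exact mul_le_mul_of_nonneg_left (Real.le_sqrt_of_sq_le (sq_integral_norm_le hf)) hB

namespace Tri

variable {E : Tri} {ρ : ℝ}

instance isFiniteMeasure_restrict_interior (E : Tri) :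
    IsFiniteMeasure (volume.restrict (interior E.carrier)) := by
  rw [restrict_interior]
  exact ⟨by simpa using E.volume_carrier_lt_top⟩

lemma measureReal_restrict_interior (E : Tri) :
    (volume.restrict (interior E.carrier)).real Set.univ = volume.real E.carrier := by
  rw [restrict_interior, measureReal_restrict_apply_univ]

lemma sqrt_volume_le (E : Tri) : √(volume.real E.carrier) ≤ E.size * √discArea := by
  rw [Real.sqrt_le_left (by have := E.size_nonneg; positivity), mul_pow,
    Real.sq_sqrt discArea_pos.le]
  exact E.volume_carrier_le

lemma lineMap_mem_frontier (hE : E.det ≠ 0) (i : Fin 3) {t : ℝ} (ht : t ∈ Set.Icc (0 : ℝ) 1) :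
    AffineMap.lineMap (E.vtx i) (E.vtx (i + 1)) t ∈ frontier E.carrier := by
  rw [mem_frontier_iff hE]
  refine ⟨E.convex_carrier.segment_subset (E.vtx_mem i) (E.vtx_mem (i + 1)) ?_, i + 2, ?_⟩
  · rw [segment_eq_image_lineMap]
    exact ⟨t, ht, rfl⟩
  · rw [bary_lineMap, bary_vtx_ne, bary_vtx_ne]
    · simp
    · fin_cases i <;> decide
    · fin_cases i <;> decide

/-- The perimeter. -/
def perimeter (E : Tri) : ℝ := ∑ i : Fin 3, dist (E.vtx i) (E.vtx (i + 1))

lemma perimeter_pos (hE : E.det ≠ 0) : 0 < E.perimeter := by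
  have hne : E.vtx 0 ≠ E.vtx (0 + 1) := by
    intro h
    have h1 := bary_vtx_self hE 0
    rw [h, bary_vtx_ne (by decide)] at h1
    exact zero_ne_one h1
  have := dist_pos.2 hne
  unfold perimeter
  exact Finset.sum_pos' (fun _ _ => dist_nonneg) ⟨0, Finset.mem_univ _, this⟩

lemma continuousOn_lineMap {f : Plane → ℝ} (hf : ContinuousOn f E.carrier) (i : Fin 3) :
    ContinuousOn (fun t : ℝ => f (AffineMap.lineMap (E.vtx i) (E.vtx (i + 1)) t))
      (Set.uIcc 0 1) := by
  rw [Set.uIcc_of_le zero_le_one]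
  refine hf.comp (AffineMap.lineMap_continuous (R := ℝ)).continuousOn fun t ht => ?_
  refine E.convex_carrier.segment_subset (E.vtx_mem i) (E.vtx_mem (i + 1)) ?_
  rw [segment_eq_image_lineMap]
  exact ⟨t, ht, rfl⟩

lemma boundaryIntegral_sub_const {f : Plane → ℝ} (hf : ContinuousOn f E.carrier) (c : ℝ) :
    E.boundaryIntegral (fun x => f x - c) = E.boundaryIntegral f - E.perimeter * c := by
  unfold boundaryIntegral perimeter
  rw [Finset.sum_mul, ← Finset.sum_sub_distrib]
  refine Finset.sum_congr rfl fun i _ => ?_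
  rw [intervalIntegral.integral_sub (continuousOn_lineMap hf i).intervalIntegrable
    intervalIntegrable_const, intervalIntegral.integral_const]
  simp
  ring

lemma abs_boundaryIntegral_le (hE : E.det ≠ 0) {f : Plane → ℝ} {B : ℝ}
    (hB : ∀ x ∈ frontier E.carrier, |f x| ≤ B) : |E.boundaryIntegral f| ≤ E.perimeter * B := by
  unfold boundaryIntegral perimeter
  rw [Finset.sum_mul]
  refine (Finset.abs_sum_le_sum_abs _ _).trans (Finset.sum_le_sum fun i _ => ?_)
  rw [abs_mul, abs_of_nonneg dist_nonneg]
  refine mul_le_mul_of_nonneg_left ?_ dist_nonneg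
  have := intervalIntegral.norm_integral_le_of_norm_le_const (a := (0 : ℝ)) (b := 1) (C := B)
    (f := fun t : ℝ => f (AffineMap.lineMap (E.vtx i) (E.vtx (i + 1)) t)) fun t ht => by
      rw [Set.uIoc_of_le zero_le_one] at ht
      exact hB _ (lineMap_mem_frontier hE i ⟨ht.1.le, ht.2⟩)
  simpa using this

/-- The boundary mean of f − c is −c. -/
lemma abs_le_of_boundaryIntegral_eq_zero (hE : E.det ≠ 0) {f : Plane → ℝ}
    (hf : ContinuousOn f E.carrier) (h0 : E.boundaryIntegral f = 0) {B c : ℝ}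
    (hB : ∀ x ∈ frontier E.carrier, |f x - c| ≤ B) : |c| ≤ B := by
  have h1 := abs_boundaryIntegral_le hE hB
  rw [boundaryIntegral_sub_const hf, h0, zero_sub, abs_neg, abs_mul,
    abs_of_pos (perimeter_pos hE)] at h1
  exact le_of_mul_le_mul_left h1 (perimeter_pos hE)

end Tri

/-! ### The projection onto affine functions -/

section Projections

variable {E : Tri} {v : Plane → ℝ}

lemma integral_inner_sub {μ : Measure Plane} [IsFiniteMeasure μ] {g : Plane → Plane}
    (hg : MemLp g 2 μ) (ξ a : Plane) :
    ∫ x, inner ℝ (g x - ξ) a ∂μ = inner ℝ ((∫ x, g x ∂μ) - μ.real Set.univ • ξ) a := by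
  have hi := hg.integrable one_le_two
  have h1 := integral_inner (𝕜 := ℝ) (hi.sub (integrable_const ξ)) a
  simp only [Pi.sub_apply] at h1
  rw [integral_sub hi (integrable_const ξ), integral_const] at h1
  simp_rw [real_inner_comm a]
  exact h1

/-- The gradient is the mean of the weak gradient over the element, and the constant is fixed by the
boundary mean. -/
lemma exists_isPiNabla (hE : E.det ≠ 0) (hv : MemH1 (interior E.carrier) v)
    (hc : ContinuousOn v E.carrier) : ∃ p, IsPiNabla E v p := by
  set ξ : Plane := (volume.real E.carrier)⁻¹ • ∫ x in interior E.carrier,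
    weakGrad (interior E.carrier) v x with hξ
  have hvol : volume.real E.carrier ≠ 0 := by
    rw [measureReal_def, ENNReal.toReal_ne_zero]
    refine ⟨fun h => ?_, E.volume_carrier_lt_top.ne⟩
    have h1 : volume (interior E.carrier) = 0 := measure_mono_null interior_subset h
    rw [isOpen_interior.measure_eq_zero_iff volume] at h1
    exact (interior_nonempty hE).ne_empty h1
  have hc' : ContinuousOn (fun x => v x - inner ℝ ξ x) E.carrier := hc.sub (by fun_prop)
  refine ⟨⟨ξ, E.boundaryIntegral (fun x => v x - inner ℝ ξ x) / E.perimeter⟩, fun w => ?_, ?_⟩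
  · rw [integral_inner_sub hv.hasWeakGrad.memLp_grad, measureReal_restrict_interior, hξ,
      smul_smul, mul_inv_cancel₀ hvol, one_smul, sub_self, inner_zero_left]
  · have := boundaryIntegral_sub_const hc'
      (E.boundaryIntegral (fun x => v x - inner ℝ ξ x) / E.perimeter)
    rw [mul_div_cancel₀ _ (perimeter_pos hE).ne', sub_self] at this
    rw [← this]
    congr 1
    ext x
    simp only [P1.eval]
    ring

lemma isPiNabla_piNabla (hE : E.det ≠ 0) (hv : MemH1 (interior E.carrier) v)
    (hc : ContinuousOn v E.carrier) : IsPiNabla E v (piNabla E v) := by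
  have h := exists_isPiNabla hE hv hc
  rw [piNabla, dif_pos h]
  exact h.choose_spec

/-- Pythagoras: the gradient of the projection is the L² projection of g onto constant fields. -/
lemma IsPiNabla.integral_norm_sq_sub {p : P1} (hp : IsPiNabla E v p) {g : Plane → Plane}
    (hg : HasWeakGrad (interior E.carrier) v g) (ξ : Plane) :
    (∫ x in interior E.carrier, ‖g x - p.grad‖ ^ 2) + volume.real E.carrier * ‖p.grad - ξ‖ ^ 2
      = ∫ x in interior E.carrier, ‖g x - ξ‖ ^ 2 := by
  have hgl := hg.memLp_grad
  have hm : MemLp (fun x => g x - p.grad) 2 (volume.restrict (interior E.carrier)) :=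
    hgl.sub (memLp_const _)
  have h0 : ∫ x in interior E.carrier, inner ℝ (g x - p.grad) (p.grad - ξ) = 0 := by
    rw [← hp.1 ⟨p.grad - ξ, 0⟩]
    refine integral_congr_ae ?_
    filter_upwards [hg.weakGrad_ae_eq isOpen_interior] with x hx
    rw [hx]
  have hi1 : Integrable (fun x => ‖g x - p.grad‖ ^ 2) (volume.restrict (interior E.carrier)) :=
    hm.integrable_norm_pow two_ne_zero
  have hi2 : Integrable (fun x => inner ℝ (g x - p.grad) (p.grad - ξ))
      (volume.restrict (interior E.carrier)) :=
    (hm.integrable one_le_two).inner_const _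
  have : ∀ x, ‖g x - ξ‖ ^ 2 = ‖g x - p.grad‖ ^ 2 + 2 * inner ℝ (g x - p.grad) (p.grad - ξ)
      + ‖p.grad - ξ‖ ^ 2 := fun x => by
    rw [← norm_add_sq_real, sub_add_sub_cancel]
  simp_rw [this]
  have hi3 : Integrable (fun x => ‖g x - p.grad‖ ^ 2 + 2 * inner ℝ (g x - p.grad) (p.grad - ξ))
      (volume.restrict (interior E.carrier)) := hi1.add (hi2.const_mul 2)
  rw [integral_add hi3 (integrable_const _),
    integral_add hi1 (hi2.const_mul 2), integral_const_mul, h0, integral_const,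
    measureReal_restrict_interior, smul_eq_mul]
  ring

end Projections

end AVEM

namespace AVEM

open MeasureTheory Filter Topology
open scoped ContDiff ENNReal

open Tri

/-! ### Local bounds for the virtual functions -/

/-- This takes the place of a local Poincaré inequality with trace. On `E` the test function is the
derivative of a bounded primitive in a fixed direction; integrating by parts leaves the trace of w
and its gradient. -/
lemma exists_pairing_bound : ∃ K : ℝ, 0 < K ∧ ∀ (ρ : ℝ) (E : Tri), E.IsShape ρ →
    ∀ (w : Plane → ℝ) (g : Plane → Plane), ContinuousOn w E.carrier →
    HasWeakGrad (interior E.carrier) w g →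
    ∀ m : ℝ, (∀ x ∈ frontier E.carrier, |w x| ≤ m) →
    ∀ φ : Plane → ℝ, ContDiff ℝ ∞ φ → HasCompactSupport φ → ∀ B : ℝ, (∀ x, |φ x| ≤ B) →
    ∀ c ∈ E.carrier, (∀ y, E.size ≤ dist y c → φ y = 0) →
    |∫ x in interior E.carrier, w x * φ x|
      ≤ K * B * E.size ^ 2 * (ρ * m + √(∫ x in interior E.carrier, ‖g x‖ ^ 2)) := by
  obtain ⟨K, hK, hbd⟩ := exists_trace_bound
  refine ⟨3 * (K + √discArea), by positivity, ?_⟩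
  intro ρ E hE w g hw hg m hm φ hφ hφc B hB c hc hsupp
  set a : Plane := EuclideanSpace.single 0 1 with ha
  have hna : ‖a‖ = 1 := by simp [ha]
  have hs := E.size_nonneg
  have hB0 : 0 ≤ B := (abs_nonneg _).trans (hB 0)
  -- Points of `E` are within 2·size of c, so a shift by 3·size brings them to distance at least
  -- size, where φ vanishes. The shifted term in the derivative thus disappears on `E`.
  obtain ⟨Φ, hΦ, hΦb, hΦd⟩ := exists_primitive hφ hφc hB a (L := 3 * E.size) (by positivity)
  have h1 := hbd ρ E hE w g hw hg m hm Φ hΦ _ hΦb a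
  have hder : ∀ x ∈ E.carrier, fderiv ℝ Φ x a = φ x := by
    intro x hx
    rw [hΦd, hsupp (x - _), sub_zero]
    have h2 := E.dist_le hx hc
    have h3 : dist x (x - (3 * E.size) • a) = 3 * E.size := by
      rw [dist_eq_norm, sub_sub_cancel, norm_smul, hna, mul_one, Real.norm_of_nonneg (by positivity)]
    have h4 := dist_triangle x c (x - (3 * E.size) • a)
    rw [dist_comm c] at h4
    linarith
  have hae : ∀ᵐ x ∂volume.restrict (interior E.carrier), x ∈ E.carrier :=
    (ae_restrict_mem isOpen_interior.measurableSet).mono fun x hx => _root_.interior_subset hx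
  have hi1 : Integrable (fun x => w x * φ x) (volume.restrict (interior E.carrier)) := by
    refine (hg.memLp.integrable one_le_two).mul_bdd (c := B) hφ.continuous.aestronglyMeasurable
      (.of_forall hB)
  have hi2 : Integrable (fun x => Φ x * inner ℝ (g x) a)
      (volume.restrict (interior E.carrier)) := by
    refine ((hg.memLp_grad.integrable one_le_two).inner_const a).bdd_mul (c := 3 * E.size * B)
      hΦ.continuous.aestronglyMeasurable (.of_forall hΦb)
  have h2 : ∫ x in interior E.carrier, (w x * fderiv ℝ Φ x a + Φ x * inner ℝ (g x) a)
      = (∫ x in interior E.carrier, w x * φ x)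
        + ∫ x in interior E.carrier, Φ x * inner ℝ (g x) a := by
    rw [← integral_add hi1 hi2]
    refine integral_congr_ae (hae.mono fun x hx => ?_)
    simp only [hder x hx]
  have h3 : |∫ x in interior E.carrier, Φ x * inner ℝ (g x) a|
      ≤ 3 * E.size * B * (E.size * √discArea * √(∫ x in interior E.carrier, ‖g x‖ ^ 2)) := by
    refine (abs_integral_le_of_memLp hg.memLp_grad (B := 3 * E.size * B) (by positivity)
      fun x => ?_).trans ?_
    · rw [abs_mul]
      refine mul_le_mul (hΦb x) ?_ (abs_nonneg _) (by positivity)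
      simpa [hna] using abs_real_inner_le_norm (g x) a
    · rw [measureReal_restrict_interior]
      exact mul_le_mul_of_nonneg_left
        (mul_le_mul_of_nonneg_right E.sqrt_volume_le (Real.sqrt_nonneg _)) (by positivity)
  rw [h2] at h1
  have h4 := abs_sub_abs_le_abs_add (∫ x in interior E.carrier, w x * φ x)
    (∫ x in interior E.carrier, Φ x * inner ℝ (g x) a)
  rw [hna, mul_one] at h1
  set S := √(∫ x in interior E.carrier, ‖g x‖ ^ 2) with hS
  have hS0 : 0 ≤ S := Real.sqrt_nonneg _
  have hm0 : 0 ≤ m := by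
    have := hm _ (lineMap_mem_frontier hE.det_ne 0 ⟨le_rfl, zero_le_one⟩)
    exact (abs_nonneg _).trans this
  have hρ : 0 ≤ ρ := by linarith [hE.two_le]
  clear_value S
  clear hbd hsupp hΦd hder hi1 hi2 h2
  have h5 : 0 ≤ 3 * B * E.size ^ 2 * (K * S + √discArea * (ρ * m)) :=
    mul_nonneg (by positivity) (add_nonneg (by positivity)
      (mul_nonneg (Real.sqrt_nonneg _) (mul_nonneg hρ hm0)))
  calc _ ≤ K * ρ * E.size * m * (3 * E.size * B)
        + 3 * E.size * B * (E.size * √discArea * S) := by linarith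
    _ ≤ _ := by linarith

/-- On each element the gradient of `v - Π v`, and `v - Π v` tested with smooth functions, are
controlled by the stabilization term. -/
theorem exists_local_bound {ρ cs : ℝ} (hcs : 0 < cs) : ∃ C : ℝ, 0 < C ∧
    ∀ (T : Finset Tri) (E : Tri), E ∈ T → E.IsShape ρ →
    ∀ (V : Submodule ℝ (E.carrier → ℝ)) (Cs : ℝ), IsLocalSpace T E V → IsStable T E V cs Cs →
    ∀ v : Plane → ℝ, E.carrier.domRestrict v ∈ V →
    ∀ g : Plane → Plane, HasWeakGrad (interior E.carrier) v g →
    ∀ N : ℝ, N = stab T E (fun x => v x - (interp E v).eval x)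
      (fun x => v x - (interp E v).eval x) →
    (∫ x in interior E.carrier, ‖g x - (piNabla E v).grad‖ ^ 2 ≤ C * N) ∧
    ∀ φ : Plane → ℝ, ContDiff ℝ ∞ φ → HasCompactSupport φ → ∀ B : ℝ, (∀ x, |φ x| ≤ B) →
    ∀ c ∈ E.carrier, (∀ y, E.size ≤ dist y c → φ y = 0) →
    |∫ x in interior E.carrier, (v x - (piNabla E v).eval x) * φ x|
      ≤ C * B * E.size ^ 2 * √N := by
  obtain ⟨K, hK, hbd⟩ := exists_pairing_bound
  set c1 := √cs⁻¹ with hc1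
  -- The first summand belongs to v − I v, the second to the affine difference Πv − I v.
  set C2 := K * (ρ + c1) + (1 + 12 * ρ * c1 / √discArea) * discArea with hC2
  refine ⟨max cs⁻¹ C2, lt_max_of_lt_left (by positivity), ?_⟩
  intro T E hET hE V Cs hV hst v hv g hg N hN
  have hρ : 0 < ρ := by linarith [hE.two_le]
  have hsz := size_pos hE.det_ne
  set I := interp E v with hI
  set p := piNabla E v with hp
  have hcont : ContinuousOn v E.carrier := by
    have := hV.continuous _ hv
    rwa [← continuousOn_iff_continuous_domRestrict] at this
  have hpi : IsPiNabla E v p := isPiNabla_piNabla hE.det_ne ⟨g, hg⟩ hcont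
  have hwV : E.carrier.domRestrict (fun x => v x - I.eval x) ∈ V :=
    V.sub_mem hv (hV.affine_mem I)
  have hbdd : Bornology.IsBounded (interior E.carrier) :=
    E.isCompact_carrier.isBounded.subset _root_.interior_subset
  have hwg : HasWeakGrad (interior E.carrier) (fun x => v x - I.eval x) fun x => g x - I.grad :=
    hg.sub (I.hasWeakGrad hbdd)
  have hwc : ContinuousOn (fun x => v x - I.eval x) E.carrier :=
    hcont.sub I.continuous_eval.continuousOn
  have hN' : N = ∑ x ∈ nodesOf T E, (v x - I.eval x) ^ 2 := by
    rw [hN, stab]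
    exact Finset.sum_congr rfl fun x _ => (sq _).symm
  have hN0 : 0 ≤ N := by rw [hN']; exact Finset.sum_nonneg fun _ _ => sq_nonneg _
  have hbnd : ∀ x ∈ frontier E.carrier, |v x - I.eval x| ≤ √N := by
    intro x hx
    refine Real.abs_le_sqrt ?_
    rw [hN']
    exact (hV.trace_mem _ hwV).sq_le hET hE.det_ne hx
  -- The lower stability bound holds for every subtracted constant; for the interpolation error the
  -- constant 0 gives precisely the stabilization term.
  have hgN : ∫ x in interior E.carrier, ‖g x - I.grad‖ ^ 2 ≤ cs⁻¹ * N := by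
    have h1 := (hst _ hwV).1 0
    simp only [sub_zero] at h1
    rw [← hN, hwg.semiH1sq_eq isOpen_interior] at h1
    rw [inv_mul_eq_div, le_div_iff₀ hcs]
    linarith
  -- A single identity controls both the gradient of v − Πv and the gradient of Πv − I v.
  have hpyth := hpi.integral_norm_sq_sub hg I.grad
  have hvol0 : 0 ≤ volume.real E.carrier := measureReal_nonneg
  have hX0 : 0 ≤ ∫ x in interior E.carrier, ‖g x - p.grad‖ ^ 2 :=
    integral_nonneg fun x => sq_nonneg _
  have hq0 : 0 ≤ volume.real E.carrier * ‖p.grad - I.grad‖ ^ 2 := by positivity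
  refine ⟨?_, ?_⟩
  · calc _ ≤ cs⁻¹ * N := by linarith
      _ ≤ _ := mul_le_mul_of_nonneg_right (le_max_left _ _) hN0
  intro φ hφ hφc B hB c hc hsupp
  have hB0 : 0 ≤ B := (abs_nonneg _).trans (hB 0)
  have hd := discArea_pos
  have hgS : √(∫ x in interior E.carrier, ‖g x - I.grad‖ ^ 2) ≤ c1 * √N := by
    rw [hc1, ← Real.sqrt_mul (by positivity)]
    exact Real.sqrt_le_sqrt hgN
  have hqn : E.size * ‖p.grad - I.grad‖ ≤ 6 * ρ * c1 / √discArea * √N := by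
    have h1 : (E.size / (6 * ρ)) ^ 2 * discArea * ‖p.grad - I.grad‖ ^ 2 ≤ cs⁻¹ * N := by
      have := mul_le_mul_of_nonneg_right hE.le_volume_carrier (sq_nonneg ‖p.grad - I.grad‖)
      linarith
    have h2 : E.size / (6 * ρ) * √discArea * ‖p.grad - I.grad‖ ≤ c1 * √N := by
      rw [hc1, ← Real.sqrt_mul (by positivity)]
      refine Real.le_sqrt_of_sq_le ?_
      rw [mul_pow, mul_pow, Real.sq_sqrt hd.le]
      exact h1
    have h3 : E.size * ‖p.grad - I.grad‖
        = 6 * ρ / √discArea * (E.size / (6 * ρ) * √discArea * ‖p.grad - I.grad‖) := by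
      field_simp
    rw [h3]
    refine (mul_le_mul_of_nonneg_left h2 (by positivity)).trans (le_of_eq ?_)
    ring
  have hqb : ∀ x ∈ E.carrier, |p.eval x - I.eval x| ≤ (1 + 12 * ρ * c1 / √discArea) * √N := by
    intro x hx
    have h1 : |p.eval x - I.eval x| ≤ √N + 2 * E.size * ‖p.grad - I.grad‖ := by
      rw [← abs_neg]
      -- Since v − Πv has zero boundary mean, the value of Πv − I v at `x` is bounded by the largest
      -- deviation of v − Πv from its negative. That deviation is v − I v plus the variation of an
      -- affine function.
      refine abs_le_of_boundaryIntegral_eq_zero hE.det_ne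
        (f := fun x => v x - p.eval x) (hcont.sub p.continuous_eval.continuousOn) hpi.2
        fun y hy => ?_
      have hy' : y ∈ E.carrier := ((mem_frontier_iff hE.det_ne y).1 hy).1
      have h2 : v y - p.eval y - -(p.eval x - I.eval x)
          = (v y - I.eval y) + inner ℝ (p.grad - I.grad) (x - y) := by
        rw [inner_sub_left, ← P1.eval_sub, ← P1.eval_sub]
        ring
      rw [h2]
      refine (abs_add_le _ _).trans (add_le_add (hbnd y hy) ?_)
      refine (abs_real_inner_le_norm _ _).trans ?_
      rw [mul_comm, ← dist_eq_norm x y]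
      exact mul_le_mul_of_nonneg_right (E.dist_le hx hy') (norm_nonneg _)
    have h3 : 12 * ρ * c1 / √discArea * √N = 2 * (6 * ρ * c1 / √discArea * √N) := by ring
    rw [add_mul, h3]
    linarith
  have hi1 : Integrable (fun x => (v x - I.eval x) * φ x)
      (volume.restrict (interior E.carrier)) :=
    (hwg.memLp.integrable one_le_two).mul_bdd (c := B) hφ.continuous.aestronglyMeasurable
      (.of_forall hB)
  have hi2 : Integrable (fun x => (p.eval x - I.eval x) * φ x)
      (volume.restrict (interior E.carrier)) :=
    (((p.hasWeakGrad hbdd).sub (I.hasWeakGrad hbdd)).memLp.integrable one_le_two).mul_bdd (c := B)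
      hφ.continuous.aestronglyMeasurable (.of_forall hB)
  have hsplit : ∫ x in interior E.carrier, (v x - p.eval x) * φ x
      = (∫ x in interior E.carrier, (v x - I.eval x) * φ x)
        - ∫ x in interior E.carrier, (p.eval x - I.eval x) * φ x := by
    rw [← integral_sub hi1 hi2]
    exact integral_congr_ae (.of_forall fun x => by ring)
  have hb1 := hbd ρ E hE _ _ hwc hwg _ hbnd φ hφ hφc B hB c hc hsupp
  have hb2 : |∫ x in interior E.carrier, (p.eval x - I.eval x) * φ x|
      ≤ (1 + 12 * ρ * c1 / √discArea) * √N * B * (E.size ^ 2 * discArea) := by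
    have := norm_setIntegral_le_of_norm_le_const (μ := volume) (s := interior E.carrier)
      (f := fun x => (p.eval x - I.eval x) * φ x)
      (C := (1 + 12 * ρ * c1 / √discArea) * √N * B)
      ((measure_mono _root_.interior_subset).trans_lt E.volume_carrier_lt_top) fun x hx => by
        rw [norm_mul]
        exact mul_le_mul (hqb x (_root_.interior_subset hx)) (hB x) (norm_nonneg _) (by positivity)
    refine this.trans ?_
    rw [measureReal_congr E.interior_ae_eq]
    exact mul_le_mul_of_nonneg_left E.volume_carrier_le (by positivity)
  rw [hsplit]
  refine (abs_sub _ _).trans ((add_le_add hb1 hb2).trans ?_)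
  have h6 : K * B * E.size ^ 2 * (ρ * √N + √(∫ x in interior E.carrier, ‖g x - I.grad‖ ^ 2))
      ≤ K * B * E.size ^ 2 * (ρ * √N + c1 * √N) :=
    mul_le_mul_of_nonneg_left (add_le_add_right hgS _) (by positivity)
  calc _ ≤ C2 * B * E.size ^ 2 * √N := by rw [hC2]; linarith
    _ ≤ _ := by gcongr; exact le_max_right _ _

end AVEM

namespace AVEM

open MeasureTheory Filter Topology
open scoped ContDiff ENNReal

open Tri

/-! ### The residual as a functional of the error -/

lemma mulV_sub (B : Matrix (Fin 2) (Fin 2) ℝ) (ξ η : Plane) :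
    mulV B (ξ - η) = mulV B ξ - mulV B η := map_sub _ _ _

lemma norm_mulV_le {B : Matrix (Fin 2) (Fin 2) ℝ} {M : ℝ} (hB : ∀ i j, |B i j| ≤ M) (ξ : Plane) :
    ‖mulV B ξ‖ ≤ 2 * M * ‖ξ‖ := by
  have hM : 0 ≤ M := (abs_nonneg _).trans (hB 0 0)
  refine abs_le_of_sq_le_sq' ?_ (by positivity) |>.2
  have hrow : ∀ i, mulV B ξ i = B i 0 * ξ 0 + B i 1 * ξ 1 := by
    intro i
    fin_cases i <;> simp [mulV, Matrix.toLpLin_apply]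
  have hbd : ∀ i, mulV B ξ i ^ 2 ≤ M ^ 2 * (2 * ‖ξ‖ ^ 2) := by
    intro i
    have h1 : |mulV B ξ i| ≤ M * (|ξ 0| + |ξ 1|) := by
      rw [hrow, mul_add]
      refine (abs_add_le _ _).trans ?_
      rw [abs_mul, abs_mul]
      gcongr <;> exact hB _ _
    rw [← sq_abs]
    refine (pow_le_pow_left₀ (abs_nonneg _) h1 2).trans ?_
    rw [mul_pow, norm_sq_plane, ← sq_abs (ξ 0), ← sq_abs (ξ 1)]
    gcongr
    exact add_sq_le
  rw [norm_sq_plane]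
  linarith [hbd 0, hbd 1]

/-- Elementwise bounds that relate the error between `u` and `v`, with weak gradients `gu` and
`gv`, to the piecewise affine projection `p` of `v`. -/
structure ErrorBounds (Ω : Set Plane) (T : Finset Tri) (d : ElemCoeffs) (ρ L M C : ℝ)
    (u v : Plane → ℝ) (gu gv : Plane → Plane) (p : Tri → P1) (N : Tri → ℝ) : Prop where
  shape : ∀ E ∈ T, E.IsShape ρ
  size_le : ∀ E ∈ T, E.size ≤ L
  abs_A : ∀ E ∈ T, ∀ i j, |d.A E i j| ≤ M
  abs_c : ∀ E ∈ T, |d.c E| ≤ M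
  memLp_u : ∀ E ∈ T, MemLp u 2 (volume.restrict (interior E.carrier))
  memLp_v : ∀ E ∈ T, MemLp v 2 (volume.restrict (interior E.carrier))
  memLp_gu : ∀ E ∈ T, MemLp gu 2 (volume.restrict (interior E.carrier))
  memLp_gv : ∀ E ∈ T, MemLp gv 2 (volume.restrict (interior E.carrier))
  nonneg : ∀ E ∈ T, 0 ≤ N E
  weak : ∀ φ, IsTest Ω φ → ∑ E ∈ T,
    ((∫ x in interior E.carrier, inner ℝ (mulV (d.A E) (gu x)) (gradient φ x))
      + d.c E * (∫ x in interior E.carrier, u x * φ x)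
      - d.f E * ∫ x in interior E.carrier, φ x) = 0
  grad_le : ∀ E ∈ T, ∫ x in interior E.carrier, ‖gv x - (p E).grad‖ ^ 2 ≤ C * N E
  pairing : ∀ E ∈ T, ∀ φ : Plane → ℝ, ContDiff ℝ ∞ φ → HasCompactSupport φ →
    ∀ B : ℝ, (∀ x, |φ x| ≤ B) → ∀ c ∈ E.carrier, (∀ y, E.size ≤ dist y c → φ y = 0) →
    |∫ x in interior E.carrier, (v x - (p E).eval x) * φ x| ≤ C * B * E.size ^ 2 * √(N E)

/-- The local error on `E`. -/
def localError (u v : Plane → ℝ) (gu gv : Plane → Plane) (N : Tri → ℝ) (E : Tri) : ℝ :=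
  (∫ x in interior E.carrier, ‖gu x - gv x‖ ^ 2) + (∫ x in interior E.carrier, (u x - v x) ^ 2)
    + N E

/-- The action of the elementwise error on a test function. -/
def errorAction (d : ElemCoeffs) (u : Plane → ℝ) (gu : Plane → Plane) (p : Tri → P1) (E : Tri)
    (φ : Plane → ℝ) : ℝ :=
  (∫ x in interior E.carrier, inner ℝ (mulV (d.A E) (gu x - (p E).grad)) (gradient φ x))
    + d.c E * ∫ x in interior E.carrier, (u x - (p E).eval x) * φ x

/-- The element residual. -/
def elemResidual (d : ElemCoeffs) (p : Tri → P1) (E : Tri) : P1 :=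
  ⟨-d.c E • (p E).grad, d.f E - d.c E * (p E).const⟩

lemma elemResidual_eval (d : ElemCoeffs) (p : Tri → P1) (E : Tri) (x : Plane) :
    (elemResidual d p E).eval x = d.f E - d.c E * (p E).eval x := by
  simp only [elemResidual, P1.eval, inner_smul_left]
  simp
  ring

namespace ErrorBounds

variable {Ω : Set Plane} {T : Finset Tri} {d : ElemCoeffs} {ρ L M C : ℝ}
  {u v : Plane → ℝ} {gu gv : Plane → Plane} {p : Tri → P1} {N : Tri → ℝ}

lemma localError_nonneg (h : ErrorBounds Ω T d ρ L M C u v gu gv p N) {E : Tri} (hE : E ∈ T) :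
    0 ≤ localError u v gu gv N E := by
  have h1 : 0 ≤ ∫ x in interior E.carrier, ‖gu x - gv x‖ ^ 2 :=
    integral_nonneg fun x => sq_nonneg _
  have h2 : 0 ≤ ∫ x in interior E.carrier, (u x - v x) ^ 2 := integral_nonneg fun x => sq_nonneg _
  have := h.nonneg E hE
  unfold localError
  positivity

/-- Insert v between u and its affine replacement. The part u − v is estimated by Cauchy–Schwarz,
the part v − p through the gradient and pairing bounds. As G bounds the scaled gradient size·‖∇φ‖,
the factor size from the root of the area cancels, and K serves all meshes. -/
lemma abs_errorAction_le (hL : 0 < L) (hM : 0 ≤ M) (hC : 0 < C) : ∃ K : ℝ, 0 < K ∧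
    ∀ {Ω : Set Plane} {T : Finset Tri} {d : ElemCoeffs} {u v : Plane → ℝ} {gu gv : Plane → Plane}
      {p : Tri → P1} {N : Tri → ℝ}, ErrorBounds Ω T d ρ L M C u v gu gv p N →
    ∀ E ∈ T, ∀ φ : Plane → ℝ, ContDiff ℝ ∞ φ → HasCompactSupport φ →
    ∀ B : ℝ, (∀ x, |φ x| ≤ B) → ∀ G : ℝ, (∀ x, E.size * ‖gradient φ x‖ ≤ G) →
    ∀ c ∈ E.carrier, (∀ y, E.size ≤ dist y c → φ y = 0) →
    |errorAction d u gu p E φ| ≤ K * (G + B) * √(localError u v gu gv N E) := by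
  set K1 := 2 * M * √discArea * √(2 * (1 + C)) with hK1
  set K2 := M * (L * √discArea + C * L ^ 2) with hK2
  refine ⟨K1 + K2 + 1, by positivity, ?_⟩
  intro Ω T d u v gu gv p N h E hE φ hφ hφc B hB G hG c hc hsupp
  set X := localError u v gu gv N E with hX
  have hX1 : 0 ≤ ∫ x in interior E.carrier, ‖gu x - gv x‖ ^ 2 :=
    integral_nonneg fun x => sq_nonneg _
  have hX2 : 0 ≤ ∫ x in interior E.carrier, (u x - v x) ^ 2 := integral_nonneg fun x => sq_nonneg _
  have hX3 := h.nonneg E hE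
  have hX0 : X = (∫ x in interior E.carrier, ‖gu x - gv x‖ ^ 2)
    + (∫ x in interior E.carrier, (u x - v x) ^ 2) + N E := rfl
  have hXn := h.localError_nonneg hE
  have hB0 : 0 ≤ B := (abs_nonneg _).trans (hB 0)
  have hs := size_pos (h.shape E hE).det_ne
  have hG0 : 0 ≤ G := le_trans (by positivity) (hG 0)
  have hsL := h.size_le E hE
  have hgup : MemLp (fun x => gu x - (p E).grad) 2 (volume.restrict (interior E.carrier)) :=
    (h.memLp_gu E hE).sub (memLp_const _)
  have hgvp : MemLp (fun x => gv x - (p E).grad) 2 (volume.restrict (interior E.carrier)) :=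
    (h.memLp_gv E hE).sub (memLp_const _)
  have hguv : MemLp (fun x => gu x - gv x) 2 (volume.restrict (interior E.carrier)) :=
    (h.memLp_gu E hE).sub (h.memLp_gv E hE)
  have huv : MemLp (fun x => u x - v x) 2 (volume.restrict (interior E.carrier)) :=
    (h.memLp_u E hE).sub (h.memLp_v E hE)
  have hgrad : ∫ x in interior E.carrier, ‖gu x - (p E).grad‖ ^ 2 ≤ 2 * (1 + C) * X := by
    have h1 : ∫ x in interior E.carrier, ‖gu x - (p E).grad‖ ^ 2
        ≤ ∫ x in interior E.carrier, (2 * ‖gu x - gv x‖ ^ 2 + 2 * ‖gv x - (p E).grad‖ ^ 2) := by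
      refine integral_mono (hgup.integrable_norm_pow two_ne_zero)
        (((hguv.integrable_norm_pow two_ne_zero).const_mul 2).add
          ((hgvp.integrable_norm_pow two_ne_zero).const_mul 2)) fun x => ?_
      have h2 := norm_add_le (gu x - gv x) (gv x - (p E).grad)
      rw [sub_add_sub_cancel] at h2
      have h3 := pow_le_pow_left₀ (norm_nonneg _) h2 2
      have h4 := add_sq_le (a := ‖gu x - gv x‖) (b := ‖gv x - (p E).grad‖)
      simp only
      linarith
    rw [integral_add ((hguv.integrable_norm_pow two_ne_zero).const_mul 2)
      ((hgvp.integrable_norm_pow two_ne_zero).const_mul 2), integral_const_mul,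
      integral_const_mul] at h1
    have h2 := h.grad_le E hE
    have h3 : C * N E ≤ C * X := mul_le_mul_of_nonneg_left (by linarith) hC.le
    linarith
  have hA : |∫ x in interior E.carrier, inner ℝ (mulV (d.A E) (gu x - (p E).grad)) (gradient φ x)|
      ≤ K1 * G * √X := by
    have h1 := abs_integral_le_of_memLp hgup (B := 2 * M * (G / E.size)) (by positivity)
      (h := fun x => inner ℝ (mulV (d.A E) (gu x - (p E).grad)) (gradient φ x)) fun x => by
        refine (abs_real_inner_le_norm _ _).trans ?_
        have h2 := norm_mulV_le (h.abs_A E hE) (gu x - (p E).grad)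
        have h3 : ‖gradient φ x‖ ≤ G / E.size := by
          rw [le_div_iff₀ hs, mul_comm]
          exact hG x
        calc _ ≤ (2 * M * ‖gu x - (p E).grad‖) * (G / E.size) := by gcongr
          _ = _ := by ring
    refine h1.trans ?_
    rw [measureReal_restrict_interior]
    have h4 := Real.sqrt_le_sqrt hgrad
    rw [Real.sqrt_mul (by positivity)] at h4
    calc _ ≤ 2 * M * (G / E.size) * (E.size * √discArea * (√(2 * (1 + C)) * √X)) :=
          mul_le_mul_of_nonneg_left (mul_le_mul E.sqrt_volume_le h4 (Real.sqrt_nonneg _)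
            (by positivity)) (by positivity)
      _ = _ := by rw [hK1]; field_simp
  have hc1 : |∫ x in interior E.carrier, (u x - v x) * φ x| ≤ B * (L * √discArea) * √X := by
    refine (abs_integral_le_of_memLp huv hB0 fun x => ?_).trans ?_
    · rw [abs_mul, mul_comm, Real.norm_eq_abs]
      exact mul_le_mul_of_nonneg_right (hB x) (abs_nonneg _)
    · rw [measureReal_restrict_interior, mul_assoc B]
      refine mul_le_mul_of_nonneg_left (mul_le_mul (E.sqrt_volume_le.trans ?_)
        (Real.sqrt_le_sqrt ?_) (Real.sqrt_nonneg _) (by positivity)) hB0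
      · gcongr
      · simp only [Real.norm_eq_abs, sq_abs]
        linarith
  have hc2 : |∫ x in interior E.carrier, (v x - (p E).eval x) * φ x|
      ≤ B * (C * L ^ 2) * √X := by
    refine (h.pairing E hE φ hφ hφc B hB c hc hsupp).trans ?_
    have h5 : √(N E) ≤ √X := Real.sqrt_le_sqrt (by linarith)
    calc _ ≤ C * B * L ^ 2 * √X := by gcongr
      _ = _ := by ring
  have hpl : MemLp (p E).eval 2 (volume.restrict (interior E.carrier)) :=
    memLp_of_continuous_of_isBounded
      (E.isCompact_carrier.isBounded.subset _root_.interior_subset) (p E).continuous_eval 2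
  have hi1 : Integrable (fun x => (u x - v x) * φ x) (volume.restrict (interior E.carrier)) :=
    (huv.integrable one_le_two).mul_bdd (c := B) hφ.continuous.aestronglyMeasurable (.of_forall hB)
  have hi2 : Integrable (fun x => (v x - (p E).eval x) * φ x)
      (volume.restrict (interior E.carrier)) :=
    (((h.memLp_v E hE).sub hpl).integrable one_le_two).mul_bdd (c := B)
      hφ.continuous.aestronglyMeasurable (.of_forall hB)
  have hsplit : ∫ x in interior E.carrier, (u x - (p E).eval x) * φ x
      = (∫ x in interior E.carrier, (u x - v x) * φ x)
        + ∫ x in interior E.carrier, (v x - (p E).eval x) * φ x := by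
    rw [← integral_add hi1 hi2]
    exact integral_congr_ae (.of_forall fun x => by ring)
  have hcc : |d.c E * ∫ x in interior E.carrier, (u x - (p E).eval x) * φ x| ≤ K2 * B * √X := by
    rw [abs_mul, hsplit]
    calc _ ≤ M * (B * (L * √discArea) * √X + B * (C * L ^ 2) * √X) :=
          mul_le_mul (h.abs_c E hE) ((abs_add_le _ _).trans (add_le_add hc1 hc2)) (abs_nonneg _) hM
      _ = _ := by rw [hK2]; ring
  refine (abs_add_le _ _).trans ((add_le_add hA hcc).trans ?_)
  have hK1n : 0 ≤ K1 := by positivity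
  have hK2n : 0 ≤ K2 := by positivity
  have hsq := Real.sqrt_nonneg X
  have h7 : 0 ≤ (K1 * B + K2 * G + (G + B)) * √X := by positivity
  linarith

lemma integrable_inner_mulV {E : Tri} {B : Matrix (Fin 2) (Fin 2) ℝ}
    {g : Plane → Plane} (hg : MemLp g 2 (volume.restrict (interior E.carrier))) {φ : Plane → ℝ}
    (hφ : IsTest Ω φ) : Integrable (fun x => inner ℝ (mulV B (g x)) (gradient φ x))
      (volume.restrict (interior E.carrier)) := by
  have h1 : MemLp (fun x => mulV B (g x)) 2 (volume.restrict (interior E.carrier)) :=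
    (Matrix.toEuclideanLin B).toContinuousLinearMap.comp_memLp' hg
  have h2 : MemLp (gradient φ) 2 (volume.restrict (interior E.carrier)) :=
    (hφ.memLp_gradient 2).restrict _
  refine (h1.norm.integrable_mul h2.norm).mono' (h1.1.inner h2.1) (.of_forall fun x => ?_)
  exact abs_real_inner_le_norm _ _

/-- The residual identity: by the weak equation the terms with u add up to the load, and what is
left contains only the data and the affine functions p. -/
lemma sum_errorAction (h : ErrorBounds Ω T d ρ L M C u v gu gv p N) {φ : Plane → ℝ}
    (hφ : IsTest Ω φ) : ∑ E ∈ T, errorAction d u gu p E φ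
      = ∑ E ∈ T, ((∫ x in interior E.carrier, (elemResidual d p E).eval x * φ x)
        - ∫ x in interior E.carrier, fderiv ℝ φ x (mulV (d.A E) (p E).grad)) := by
  rw [← sub_eq_zero, ← Finset.sum_sub_distrib, ← h.weak φ hφ]
  refine Finset.sum_congr rfl fun E hE => ?_
  have hpl : MemLp (p E).eval 2 (volume.restrict (interior E.carrier)) :=
    memLp_of_continuous_of_isBounded
      (E.isCompact_carrier.isBounded.subset _root_.interior_subset) (p E).continuous_eval 2
  have hφl : MemLp φ 2 (volume.restrict (interior E.carrier)) := (hφ.memLp_smul 2).restrict _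
  have h1 : ∫ x in interior E.carrier, inner ℝ (mulV (d.A E) (gu x - (p E).grad)) (gradient φ x)
      = (∫ x in interior E.carrier, inner ℝ (mulV (d.A E) (gu x)) (gradient φ x))
        - ∫ x in interior E.carrier, fderiv ℝ φ x (mulV (d.A E) (p E).grad) := by
    simp_rw [← inner_gradient, real_inner_comm _ (gradient φ _)]
    rw [← integral_sub (integrable_inner_mulV (h.memLp_gu E hE) hφ)
      (integrable_inner_mulV (memLp_const (p E).grad) hφ)]
    refine integral_congr_ae (.of_forall fun x => ?_)
    simp only [mulV_sub, inner_sub_left]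
  have hi1 : Integrable (fun x => u x * φ x) (volume.restrict (interior E.carrier)) :=
    (h.memLp_u E hE).integrable_mul hφl
  have hi2 : Integrable (fun x => (p E).eval x * φ x) (volume.restrict (interior E.carrier)) :=
    hpl.integrable_mul hφl
  have h2 : ∫ x in interior E.carrier, (u x - (p E).eval x) * φ x
      = (∫ x in interior E.carrier, u x * φ x)
        - ∫ x in interior E.carrier, (p E).eval x * φ x := by
    rw [← integral_sub hi1 hi2]
    exact integral_congr_ae (.of_forall fun x => by ring)
  have h3 : ∫ x in interior E.carrier, (elemResidual d p E).eval x * φ x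
      = d.f E * (∫ x in interior E.carrier, φ x)
        - d.c E * ∫ x in interior E.carrier, (p E).eval x * φ x := by
    rw [← integral_const_mul, ← integral_const_mul, ← integral_sub
      ((hφl.integrable one_le_two).const_mul _) (hi2.const_mul _)]
    exact integral_congr_ae (.of_forall fun x => by simp [elemResidual_eval]; ring)
  rw [errorAction, h1, h2, h3]
  ring

end ErrorBounds

end AVEM

namespace AVEM

open MeasureTheory Filter Topology
open scoped ContDiff ENNReal

open Tri

/-! ### Bounds for the residuals -/

lemma P1.abs_eval_le (q : P1) {x m : Plane} {R : ℝ} (h : dist x m ≤ R) :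
    |q.eval x| ≤ |q.eval m| + R * ‖q.grad‖ := by
  have h1 : q.eval x = q.eval m + inner ℝ q.grad (x - m) := by rw [← P1.eval_sub]; ring
  rw [h1]
  refine (abs_add_le _ _).trans (add_le_add_right ((abs_real_inner_le_norm _ _).trans ?_) _)
  rw [mul_comm, ← dist_eq_norm]
  exact mul_le_mul_of_nonneg_right h (norm_nonneg _)

/-- The quantity |q(m)| + 2r‖∇q‖ dominates |q| on the support of the bump, and with it both the
product and its scaled gradient. -/
lemma exists_bump_mul_bound : ∃ Cb : ℝ, 0 < Cb ∧ ∀ (m : Plane) (r : ℝ) (q : P1), 0 < r →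
    ContDiff ℝ ∞ (fun x => bump m r x * q.eval x) ∧
    HasCompactSupport (fun x => bump m r x * q.eval x) ∧
    tsupport (fun x => bump m r x * q.eval x) ⊆ Metric.closedBall m (2 * r) ∧
    (∀ x, |bump m r x * q.eval x| ≤ |q.eval m| + 2 * r * ‖q.grad‖) ∧
    ∀ x, r * ‖gradient (fun x => bump m r x * q.eval x) x‖
      ≤ Cb * (|q.eval m| + 2 * r * ‖q.grad‖) := by
  obtain ⟨C, hC, hbd⟩ := exists_gradient_bump_le
  refine ⟨C + 1, by positivity, ?_⟩
  intro m r q hr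
  have hts : tsupport (fun x => bump m r x * q.eval x) ⊆ Metric.closedBall m (2 * r) :=
    (tsupport_mul_subset_left (f := bump m r) (g := q.eval)).trans (tsupport_bump_subset hr)
  have hY : 0 ≤ |q.eval m| + 2 * r * ‖q.grad‖ := by positivity
  refine ⟨(contDiff_bump m r).mul q.contDiff_eval, (hasCompactSupport_bump hr).mul_right, hts,
    fun x => ?_, fun x => ?_⟩
  · rcases le_total (2 * r) (dist x m) with h | h
    · rw [bump_eq_zero hr h, zero_mul, abs_zero]
      exact hY
    · rw [abs_mul, abs_of_nonneg (bump_nonneg x)]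
      exact (mul_le_of_le_one_left (abs_nonneg _) (bump_le_one x)).trans (q.abs_eval_le h)
  · by_cases hx : x ∈ Metric.closedBall m (2 * r)
    · rw [norm_gradient]
      have h1 : fderiv ℝ (fun x => bump m r x * q.eval x) x
          = bump m r x • fderiv ℝ q.eval x + q.eval x • fderiv ℝ (bump m r) x :=
        fderiv_fun_mul ((contDiff_bump m r).differentiable (by simp) x)
          (q.contDiff_eval.differentiable (by simp) x)
      have h2 : ‖fderiv ℝ q.eval x‖ = ‖q.grad‖ := by rw [← norm_gradient, P1.gradient_eval]
      have h3 : ‖fderiv ℝ (fun x => bump m r x * q.eval x) x‖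
          ≤ ‖q.grad‖ + (|q.eval m| + 2 * r * ‖q.grad‖) * (C / r) := by
        rw [h1]
        refine (norm_add_le _ _).trans (add_le_add ?_ ?_)
        · rw [norm_smul, h2, Real.norm_of_nonneg (bump_nonneg x)]
          exact mul_le_of_le_one_left (norm_nonneg _) (bump_le_one x)
        · rw [norm_smul, Real.norm_eq_abs]
          exact mul_le_mul (q.abs_eval_le hx) (hbd m r hr x) (norm_nonneg _) hY
      have h4 := mul_le_mul_of_nonneg_left h3 hr.le
      have h5 : r * (‖q.grad‖ + (|q.eval m| + 2 * r * ‖q.grad‖) * (C / r))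
          = r * ‖q.grad‖ + C * (|q.eval m| + 2 * r * ‖q.grad‖) := by field_simp
      have h6 : 0 ≤ r * ‖q.grad‖ := by positivity
      have h7 := abs_nonneg (q.eval m)
      linarith
    · rw [gradient_eq_zero_of_notMem_tsupport fun h => hx (hts h), norm_zero, mul_zero]
      positivity

/-- The constant 1 has weak gradient zero. -/
lemma IsTest.integral_fderiv_eq_zero {U : Set Plane} (hU : Bornology.IsBounded U)
    {φ : Plane → ℝ} (hφ : IsTest U φ) (a : Plane) : ∫ x in U, fderiv ℝ φ x a = 0 := by
  have h1 := ((⟨0, 1⟩ : P1).hasWeakGrad hU).integral_eq φ hφ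
  simp only [P1.eval, inner_zero_left, zero_add, one_smul, smul_zero, integral_zero,
    neg_zero] at h1
  have h2 := integral_inner (𝕜 := ℝ) (memLp_one_iff_integrable.1 ((hφ.memLp_gradient 1).restrict U)) a
  rw [h1, inner_zero_right] at h2
  rw [← h2]
  refine integral_congr_ae (.of_forall fun x => ?_)
  simp only
  rw [← inner_gradient, real_inner_comm]

lemma IsTest.errorAction_eq_zero {U : Set Plane} {φ : Plane → ℝ} (hφ : IsTest U φ) {K : Tri}
    (hK : Disjoint (interior K.carrier) U) (d : ElemCoeffs) (u : Plane → ℝ) (gu : Plane → Plane)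
    (p : Tri → P1) : errorAction d u gu p K φ = 0 := by
  have hx : ∀ x ∈ interior K.carrier, x ∉ U := fun x hx => Set.disjoint_left.1 hK hx
  rw [errorAction, setIntegral_eq_zero_of_forall_eq_zero, setIntegral_eq_zero_of_forall_eq_zero,
    mul_zero, add_zero]
  · intro x h
    rw [hφ.eq_zero (hx x h), mul_zero]
  · intro x h
    rw [hφ.gradient_eq_zero (hx x h), inner_zero_right]

lemma IsTest.residual_eq_zero {U : Set Plane} {φ : Plane → ℝ} (hφ : IsTest U φ) {K : Tri}
    (hK : Disjoint (interior K.carrier) U) (q : P1) (a : Plane) :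
    (∫ x in interior K.carrier, q.eval x * φ x) - ∫ x in interior K.carrier, fderiv ℝ φ x a
      = 0 := by
  have hx : ∀ x ∈ interior K.carrier, x ∉ U := fun x hx => Set.disjoint_left.1 hK hx
  rw [setIntegral_eq_zero_of_forall_eq_zero, setIntegral_eq_zero_of_forall_eq_zero, sub_zero]
  · intro x h
    rw [← inner_gradient, hφ.gradient_eq_zero (hx x h), inner_zero_left]
  · intro x h
    rw [hφ.eq_zero (hx x h), mul_zero]

/-- The lower bound is quadratic and the upper bound linear in y + 2rg, because (y + 2rg)² ≤ 8(y² +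
r²g²). Cancel one factor. -/
lemma sq_add_le_of_residual {y g r X c K : ℝ} (hr : 0 < r) (hc : 0 < c) (hK : 0 ≤ K)
    (hy : 0 ≤ y) (hg : 0 ≤ g) (hX : 0 ≤ X)
    (h : c * r ^ 2 * (y ^ 2 + r ^ 2 * g ^ 2) ≤ K * (y + 2 * r * g) * X) :
    r ^ 2 * (y + 2 * r * g) ≤ 8 * K / c * X := by
  have h1 : (y + 2 * r * g) ^ 2 ≤ 8 * (y ^ 2 + r ^ 2 * g ^ 2) := by
    nlinarith [sq_nonneg (y - 2 * r * g), sq_nonneg y]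
  rcases (by positivity : 0 ≤ y + 2 * r * g).eq_or_lt with h0 | h0
  · rw [← h0, mul_zero]
    positivity
  · rw [div_mul_eq_mul_div, le_div_iff₀ hc]
    refine le_of_mul_le_mul_right ?_ h0
    have h2 : c * r ^ 2 * (y + 2 * r * g) ^ 2 ≤ c * r ^ 2 * (8 * (y ^ 2 + r ^ 2 * g ^ 2)) :=
      mul_le_mul_of_nonneg_left h1 (by positivity)
    linarith

namespace ErrorBounds

variable {ρ L M C : ℝ}

/-- Test with the residual times a bump at the barycenter. All other elements drop out, and so does
the flux term, since a constant field is paired with the gradient of a function supported inside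
`E`. -/
theorem exists_elemResidual_bound (hρ : 0 < ρ) (hL : 0 < L) (hM : 0 ≤ M) (hC : 0 < C) :
    ∃ K : ℝ, 0 < K ∧ ∀ {T₀ T : Finset Tri} {d : ElemCoeffs} {u v : Plane → ℝ}
      {gu gv : Plane → Plane} {p : Tri → P1} {N : Tri → ℝ}, IsTiling T₀ T →
    ErrorBounds (domain T₀) T d ρ L M C u v gu gv p N → ∀ E ∈ T, ∀ x ∈ E.carrier,
    E.size ^ 2 * |(elemResidual d p E).eval x| ≤ K * √(localError u v gu gv N E) := by
  obtain ⟨K, hK, hact⟩ := abs_errorAction_le (ρ := ρ) hL hM hC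
  obtain ⟨Cb, hCb, hbump⟩ := exists_bump_mul_bound
  set K1 := K * (24 * ρ * Cb + 1) with hK1
  set K2 := 8 * K1 / (discArea / 256) with hK2
  have hd := discArea_pos
  refine ⟨(24 * ρ) ^ 2 * (1 + 24 * ρ) * K2, by positivity, ?_⟩
  intro T₀ T d u v gu gv p N hT h E hE x hx
  have hsh := h.shape E hE
  have hs := size_pos hsh.det_ne
  have h2ρ := hsh.two_le
  set q := elemResidual d p E with hq
  set m := E.center with hm
  -- The support has radius 2r = size/(12ρ), half the radius size/(6ρ) of the inscribed disc.
  set r := E.size / (24 * ρ) with hr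
  have hr0 : 0 < r := by positivity
  have hsr : E.size = 24 * ρ * r := by rw [hr]; field_simp
  obtain ⟨h1, h2, h3, h4, h5⟩ := hbump m r q hr0
  set φ := fun x => bump m r x * q.eval x with hφ
  set Y := |q.eval m| + 2 * r * ‖q.grad‖ with hY
  set X := localError u v gu gv N E with hX
  have hsub : Metric.closedBall m (2 * r) ⊆ interior E.carrier := by
    refine (Metric.closedBall_subset_ball ?_).trans hsh.ball_subset
    rw [hr, ← sub_pos]
    have : E.size / (6 * ρ) - 2 * (E.size / (24 * ρ)) = E.size / (12 * ρ) := by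
      field_simp; norm_num
    rw [this]
    positivity
  have hmE : m ∈ E.carrier :=
    _root_.interior_subset (hsub (Metric.mem_closedBall_self (by positivity)))
  have htest : IsTest (interior E.carrier) φ := ⟨h1, h2, h3.trans hsub⟩
  have hbdd : Bornology.IsBounded (interior E.carrier) :=
    E.isCompact_carrier.isBounded.subset _root_.interior_subset
  have hsum := h.sum_errorAction (htest.mono (hT.interior_subset hE))
  rw [Finset.sum_eq_single_of_mem E hE fun K hK hne =>
      htest.errorAction_eq_zero (hT.disjoint K hK E hE hne) d u gu p,
    Finset.sum_eq_single_of_mem E hE fun K hK hne =>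
      htest.residual_eq_zero (hT.disjoint K hK E hE hne) _ _,
    htest.integral_fderiv_eq_zero hbdd, sub_zero] at hsum
  have hint : ∫ x in interior E.carrier, q.eval x * φ x = ∫ x, bump m r x * q.eval x ^ 2 := by
    rw [setIntegral_eq_integral_of_forall_compl_eq_zero]
    · exact integral_congr_ae (.of_forall fun x => by simp only [hφ]; ring)
    · intro x hx
      rw [htest.eq_zero hx, mul_zero]
  have hlow := le_integral_bump_mul_sq (m := m) hr0 q
  have hup := hact h E hE φ h1 h2 Y h4 (24 * ρ * (Cb * Y)) (fun x => by
    rw [hsr, mul_assoc]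
    exact mul_le_mul_of_nonneg_left (h5 x) (by positivity)) m hmE fun y hy => by
      have : 2 * r ≤ dist y m := by
        rw [hsr] at hy
        nlinarith
      simp only [hφ, bump_eq_zero hr0 this, zero_mul]
  rw [hsum, hint] at hup
  have hmain : discArea / 256 * r ^ 2 * (|q.eval m| ^ 2 + r ^ 2 * ‖q.grad‖ ^ 2)
      ≤ K1 * (|q.eval m| + 2 * r * ‖q.grad‖) * √X := by
    rw [sq_abs]
    refine (hlow.trans ((le_abs_self _).trans hup)).trans (le_of_eq ?_)
    rw [hK1]
    ring
  have hfin := sq_add_le_of_residual hr0 (by positivity) (by positivity) (abs_nonneg _)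
    (norm_nonneg _) (Real.sqrt_nonneg _) hmain
  -- An affine function on `E` is controlled by its value and gradient at the barycenter; the
  -- distance is at most 2·size = 48ρr.
  have hqx : |q.eval x| ≤ (1 + 24 * ρ) * Y := by
    refine (q.abs_eval_le (E.dist_le hx hmE)).trans ?_
    have e1 := abs_nonneg (q.eval m)
    have e2 : 0 ≤ r * ‖q.grad‖ := by positivity
    rw [hsr, hY]
    nlinarith [mul_nonneg hρ.le e1, mul_nonneg hρ.le e2]
  calc E.size ^ 2 * |q.eval x| ≤ E.size ^ 2 * ((1 + 24 * ρ) * Y) := by gcongr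
    _ = (24 * ρ) ^ 2 * (1 + 24 * ρ) * (r ^ 2 * Y) := by rw [hsr]; ring
    _ ≤ (24 * ρ) ^ 2 * (1 + 24 * ρ) * (K2 * √X) := by gcongr
    _ = _ := by ring

end ErrorBounds

end AVEM

namespace AVEM

open MeasureTheory Filter Topology
open scoped ContDiff ENNReal

open Tri

/-! ### Bounds for the jumps -/

/-- A function supported in the disc does not distinguish the element from a half plane, where the
divergence theorem is available. -/
lemma EdgePatch.setIntegral_eq {T : Finset Tri} {E E' : Tri} {p q n : Plane} {r : ℝ}
    (h : EdgePatch T E E' p q n r) {f : Plane → ℝ}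
    (hf : ∀ y ∉ Metric.ball (midpoint ℝ p q) r, f y = 0) :
    ∫ x in interior E.carrier, f x
      = ∫ x in {x | inner ℝ n (x - midpoint ℝ p q) < 0}, f x := by
  have hm : MeasurableSet {x : Plane | inner ℝ n (x - midpoint ℝ p q) < 0} :=
    (isOpen_lt (by fun_prop) continuous_const).measurableSet
  rw [← integral_indicator isOpen_interior.measurableSet, ← integral_indicator hm]
  refine integral_congr_ae (.of_forall fun y => ?_)
  by_cases hy : y ∈ Metric.ball (midpoint ℝ p q) r
  · simp only [Set.indicator, h.mem_iff y hy, Set.mem_ofPred_eq]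
  · simp only [Set.indicator, hf y hy, ite_self]

lemma EdgePatch.setIntegral_eq' {T : Finset Tri} {E E' : Tri} {p q n : Plane} {r : ℝ}
    (h : EdgePatch T E E' p q n r) {f : Plane → ℝ}
    (hf : ∀ y ∉ Metric.ball (midpoint ℝ p q) r, f y = 0) :
    ∫ x in interior E'.carrier, f x
      = ∫ x in {x | inner ℝ (-n) (x - midpoint ℝ p q) < 0}, f x := by
  have hm : MeasurableSet {x : Plane | inner ℝ (-n) (x - midpoint ℝ p q) < 0} :=
    (isOpen_lt (by fun_prop) continuous_const).measurableSet
  rw [← integral_indicator isOpen_interior.measurableSet, ← integral_indicator hm]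
  refine integral_congr_ae (.of_forall fun y => ?_)
  by_cases hy : y ∈ Metric.ball (midpoint ℝ p q) r
  · simp only [Set.indicator, h.mem_iff' y hy, Set.mem_ofPred_eq, inner_neg_left, neg_lt_zero]
  · simp only [Set.indicator, hf y hy, ite_self]

lemma perp_neg (n : Plane) : perp (-n) = -perp n := by
  ext i
  fin_cases i <;> simp [perp]

lemma edgeRadius_eq (ρ : ℝ) (Λ : ℕ) (E : Tri) :
    edgeRadius ρ Λ E = E.size / (2 ^ (Λ + 2) * ρ) := by
  unfold edgeRadius
  rw [pow_succ 2 (Λ + 1)]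
  field_simp

/-- The common edge is long in comparison with `E` and at most twice the size of `E'`. -/
lemma IsAdmissible.size_le {T₀ T : Finset Tri} {E E' : Tri} {Λ : ℕ} {ρ : ℝ}
    (hA : IsAdmissible T₀ T Λ) (hT₀ : IsConforming T₀) (hT : IsTiling T₀ T) (hE : E ∈ T)
    (hsh : E.IsShape ρ) {p q : Plane} (h : s(p, q) ∈ edgesOf T E) (h' : s(p, q) ∈ edgesOf T E') :
    E.size ≤ 2 ^ (Λ + 2) * ρ * E'.size := by
  have h1 := (hA.le_len hT₀ hT hE hsh h).trans (len_le h')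
  have hρ : 0 < ρ := by linarith [hsh.two_le]
  rw [div_le_iff₀ (by positivity)] at h1
  rw [pow_succ]
  linarith

namespace ErrorBounds

variable {ρ L M C : ℝ}

lemma abs_integral_elemResidual_le {E : Tri} {q : P1} {K X B : ℝ} (hE : E.det ≠ 0)
    (hK : 0 ≤ K) (hX : 0 ≤ X) (hB : 0 ≤ B) (h : ∀ x ∈ E.carrier, E.size ^ 2 * |q.eval x| ≤ K * X)
    {φ : Plane → ℝ} (hφ : ∀ x, |φ x| ≤ B) :
    |∫ x in interior E.carrier, q.eval x * φ x| ≤ B * K * discArea * X := by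
  have hs := size_pos hE
  have := norm_setIntegral_le_of_norm_le_const (μ := volume) (s := interior E.carrier)
    (f := fun x => q.eval x * φ x) (C := K * X / E.size ^ 2 * B)
    ((measure_mono _root_.interior_subset).trans_lt E.volume_carrier_lt_top) fun x hx => by
      rw [norm_mul]
      refine mul_le_mul ?_ (hφ x) (norm_nonneg _) (by positivity)
      rw [le_div_iff₀ (by positivity), mul_comm]
      exact h x (_root_.interior_subset hx)
  refine this.trans ?_
  rw [measureReal_congr E.interior_ae_eq]
  calc _ ≤ K * X / E.size ^ 2 * B * (E.size ^ 2 * discArea) :=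
        mul_le_mul_of_nonneg_left E.volume_carrier_le (by positivity)
    _ = _ := by field_simp

open Classical in
-- Test with a bump around the midpoint of the edge. Two elements survive in the residual identity,
-- their element residuals are bounded by `exists_elemResidual_bound`, and the fluxes combine to the
-- jump times the integral of the bump along the edge line.
theorem exists_jump_bound {T₀ : Finset Tri} (hT₀ : IsConforming T₀) (Λ : ℕ) (hρ : 2 ≤ ρ)
    (hL : 0 < L) (hM : 0 ≤ M) (hC : 0 < C) :
    ∃ K : ℝ, 0 < K ∧ ∀ {T : Finset Tri} {d : ElemCoeffs} {u v : Plane → ℝ}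
      {gu gv : Plane → Plane} {N : Tri → ℝ}, IsAdmissible T₀ T Λ → IsTiling T₀ T →
    ErrorBounds (domain T₀) T d ρ L M C u v gu gv (fun E => piNabla E v) N →
    ∀ E ∈ T, ∀ e ∈ edgesOf T E, E.size ^ 2 * jump (domain T₀) T d v e ^ 2
      ≤ K * ∑ E' ∈ T with e ∈ edgesOf T E', localError u v gu gv N E' := by
  obtain ⟨K1, hK1, hres⟩ := exists_elemResidual_bound (ρ := ρ) (by linarith) hL hM hC
  obtain ⟨K2, hK2, hact⟩ := abs_errorAction_le (ρ := ρ) hL hM hC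
  obtain ⟨Cb, hCb, hbump⟩ := exists_gradient_bump_le
  set μ : ℝ := 2 ^ (Λ + 2) * ρ with hμ
  have hρ0 : 0 < ρ := by linarith
  have hμ1 : 1 ≤ μ := by
    have : (1 : ℝ) ≤ 2 ^ (Λ + 2) := one_le_pow₀ one_le_two
    rw [hμ]
    nlinarith
  have hd := discArea_pos
  set K3 := 4 * μ ^ 2 * (1 * K1 * discArea + K2 * (4 * μ ^ 2 * Cb + 1)) with hK3
  have hK3p : 0 < K3 := by positivity
  refine ⟨2 * K3 ^ 2, by positivity, ?_⟩
  intro T d u v gu gv N hA hT h E hE e he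
  induction e using Sym2.ind with | _ p q
  by_cases hΩ : seg s(p, q) ⊆ frontier (domain T₀)
  · rw [jump, if_pos hΩ]
    simp only [ne_eq, OfNat.ofNat_ne_zero, not_false_eq_true, zero_pow, mul_zero]
    exact mul_nonneg (by positivity) (Finset.sum_nonneg fun K hK =>
      h.localError_nonneg (Finset.mem_filter.1 hK).1)
  obtain ⟨E', hE', hne, he'⟩ := exists_neighbour hT₀ hT hE he hΩ
  have hsh := h.shape E hE
  have hsh' := h.shape E' hE'
  have hs := size_pos hsh.det_ne
  have hs' := size_pos hsh'.det_ne
  have hcmp := hA.size_le hT₀ hT hE hsh he he'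
  have hcmp' := hA.size_le hT₀ hT hE' hsh' he' he
  set R := min (edgeRadius ρ Λ E) (edgeRadius ρ Λ E') with hR
  have hR0 : 0 < R := by
    rw [hR, edgeRadius_eq, edgeRadius_eq]
    exact lt_min (by positivity) (by positivity)
  have hpatch := hA.edgePatch hT₀ hT hE hE' hne hsh hsh' he he' hR0 (min_le_left _ _)
    (min_le_right _ _)
  -- One factor μ compares the sizes of the neighbours, the other one the size with the edge radius,
  -- which is size/μ.
  have hRμ : ∀ K : Tri, K.size ≤ μ * E.size → K.size ≤ μ * E'.size → K.size ≤ μ ^ 2 * R := by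
    intro K h1 h2
    rw [hR, edgeRadius_eq, edgeRadius_eq, ← hμ, mul_min_of_nonneg _ _ (by positivity)]
    refine le_min (h1.trans (le_of_eq ?_)) (h2.trans (le_of_eq ?_)) <;> field_simp
  have hRE : E.size ≤ μ ^ 2 * R := hRμ E (by nlinarith) hcmp
  have hRE' : E'.size ≤ μ ^ 2 * R := hRμ E' hcmp' (by nlinarith)
  have hER : R ≤ E.size := (min_le_left _ _).trans (by
    rw [edgeRadius_eq]; exact div_le_self hs.le hμ1)
  have hER' : R ≤ E'.size := (min_le_right _ _).trans (by
    rw [edgeRadius_eq]; exact div_le_self hs'.le hμ1)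
  set n := normal E s(p, q) with hn
  set m := midpoint ℝ p q with hm
  -- The support, a disc of radius 2r, stays strictly inside the patch of radius R.
  set r := R / 4 with hr
  have hr0 : 0 < r := by positivity
  set φ := bump m r with hφ
  have hφ1 : ∀ x, |φ x| ≤ 1 := fun x => by
    rw [hφ, abs_of_nonneg (bump_nonneg x)]
    exact bump_le_one x
  have htest : IsTest (Metric.ball m R) φ := ⟨contDiff_bump m r, hasCompactSupport_bump hr0,
    (tsupport_bump_subset hr0).trans (Metric.closedBall_subset_ball (by rw [hr]; linarith))⟩
  have hmK : ∀ K ∈ T, s(p, q) ∈ edgesOf T K → m ∈ K.carrier := by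
    intro K _ hK
    have h1 := (mem_edgesOf.1 hK).2.2.2.1
    exact K.isClosed_carrier.frontier_subset (h1 (midpoint_mem_segment p q))
  have herr : ∀ K ∈ T, s(p, q) ∈ edgesOf T K → K.size ≤ μ ^ 2 * R → R ≤ K.size →
      |errorAction d u gu (fun E => piNabla E v) K φ|
        ≤ K2 * (4 * μ ^ 2 * Cb + 1) * √(localError u v gu gv N K) := by
    intro K hK he h1 h2
    refine hact h K hK φ htest.1 htest.2.1 1 hφ1 _ (fun x => ?_) m (hmK K hK he) fun y hy => ?_
    · rw [norm_gradient]
      calc K.size * ‖fderiv ℝ φ x‖ ≤ μ ^ 2 * R * (Cb / r) := by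
            gcongr
            exact hbump m r hr0 x
        _ = _ := by rw [hr]; field_simp
    · exact bump_eq_zero hr0 (by rw [hr]; linarith)
  have hresK : ∀ K ∈ T, |∫ x in interior K.carrier,
      (elemResidual d (fun E => piNabla E v) K).eval x * φ x|
        ≤ 1 * K1 * discArea * √(localError u v gu gv N K) := fun K hK =>
    abs_integral_elemResidual_le (h.shape K hK).det_ne hK1.le (Real.sqrt_nonneg _) zero_le_one
      (hres hT h K hK) hφ1
  have hsum := h.sum_errorAction (htest.mono (hpatch.subset_domain hT hE hE'))
  rw [Finset.sum_eq_add_of_mem E E' hE hE' hne.symm fun K hK hKne =>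
      htest.errorAction_eq_zero (hpatch.disjoint hT₀ hT hE hE' hK hKne.1 hKne.2) d u gu _,
    Finset.sum_eq_add_of_mem E E' hE hE' hne.symm fun K hK hKne =>
      htest.residual_eq_zero (hpatch.disjoint hT₀ hT hE hE' hK hKne.1 hKne.2) _ _] at hsum
  have hzero : ∀ a : Plane, ∀ y ∉ Metric.ball m R, fderiv ℝ φ y a = 0 := fun a y hy => by
    rw [← inner_gradient, htest.gradient_eq_zero hy, inner_zero_left]
  set κ := ∫ t : ℝ, φ (m + t • perp n) with hκ
  have hκr : r ≤ κ := le_integral_bump_line hr0 (by rw [norm_perp, hpatch.norm_eq])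
  have hflux : ∀ a, ∫ x in interior E.carrier, fderiv ℝ φ x a = inner ℝ a n * κ := fun a => by
    rw [hpatch.setIntegral_eq (hzero a), integral_halfPlane htest.1 htest.2.1 hpatch.norm_eq,
      real_inner_comm]
  -- For the normal −n the edge line is traversed backwards; the substitution t ↦ −t yields the same
  -- line integral.
  have hflux' : ∀ a, ∫ x in interior E'.carrier, fderiv ℝ φ x a = inner ℝ a (-n) * κ := fun a => by
    rw [hpatch.setIntegral_eq' (hzero a), integral_halfPlane htest.1 htest.2.1
      (by rw [norm_neg, hpatch.norm_eq]), real_inner_comm, perp_neg, hκ,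
      ← integral_neg_eq_self fun t : ℝ => φ (m + t • perp n)]
    simp only [smul_neg, neg_smul]
    rfl
  have hjump : jump (domain T₀) T d v s(p, q)
      = inner ℝ (mulV (d.A E) (piNabla E v).grad) n
        + inner ℝ (mulV (d.A E') (piNabla E' v).grad) (-n) := by
    rw [jump, if_neg hΩ, hpatch.filter_eq hT₀ hT hE hE' he he', Finset.sum_pair hne.symm,
      hpatch.normal_eq']
  rw [hpatch.filter_eq hT₀ hT hE hE' he he', Finset.sum_pair hne.symm]
  set J := jump (domain T₀) T d v s(p, q) with hJ
  rw [hflux, hflux'] at hsum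
  set X := localError u v gu gv N E with hX
  set X' := localError u v gu gv N E' with hX'
  have hXn : 0 ≤ X := h.localError_nonneg hE
  have hXn' : 0 ≤ X' := h.localError_nonneg hE'
  have b1 := abs_le.1 (herr E hE he hRE hER)
  have b2 := abs_le.1 (herr E' hE' he' hRE' hER')
  have b3 := abs_le.1 (hresK E hE)
  have b4 := abs_le.1 (hresK E' hE')
  set S := (1 * K1 * discArea + K2 * (4 * μ ^ 2 * Cb + 1)) * (√X + √X') with hS
  -- Solve the residual identity for the jump term: it equals element residual terms minus error
  -- actions. Afterwards κ ≥ r gives a lower bound of the left side.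
  have hκJ : |J| * κ ≤ S := by
    rw [← abs_of_pos (hr0.trans_le hκr), ← abs_mul, hjump, add_mul, abs_le]
    constructor <;> rw [hS] <;> linarith
  have hrJ : r * |J| ≤ S :=
    (mul_le_mul_of_nonneg_right hκr (abs_nonneg J)).trans (by rw [mul_comm]; exact hκJ)
  have hEJ : E.size * |J| ≤ K3 * (√X + √X') := by
    calc E.size * |J| ≤ μ ^ 2 * R * |J| := by gcongr
      _ = 4 * μ ^ 2 * (r * |J|) := by rw [hr]; ring
      _ ≤ 4 * μ ^ 2 * S := by gcongr
      _ = _ := by rw [hS, hK3]; ring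
  calc E.size ^ 2 * J ^ 2 = (E.size * |J|) ^ 2 := by rw [mul_pow, sq_abs]
    _ ≤ (K3 * (√X + √X')) ^ 2 := pow_le_pow_left₀ (by positivity) hEJ 2
    _ = K3 ^ 2 * (√X + √X') ^ 2 := mul_pow _ _ _
    _ ≤ K3 ^ 2 * (2 * (√X ^ 2 + √X' ^ 2)) := by gcongr; exact add_sq_le
    _ = _ := by rw [Real.sq_sqrt hXn, Real.sq_sqrt hXn']; ring

end ErrorBounds

end AVEM

namespace AVEM

open MeasureTheory Filter Topology
open scoped ContDiff ENNReal

open Tri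

/-! ### The global lower bound -/

lemma IsTiling.integral_domain_eq {T₀ T : Finset Tri} (h : IsTiling T₀ T) {f : Plane → ℝ}
    {F : Tri → Plane → ℝ}
    (hF : ∀ E ∈ T, Integrable (F E) (volume.restrict (interior E.carrier)))
    (hae : ∀ E ∈ T, f =ᵐ[volume.restrict (interior E.carrier)] F E) :
    ∫ x in domain T₀, f x = ∑ E ∈ T, ∫ x in interior E.carrier, F E x := by
  have hint : IntegrableOn f (domain T₀) := by
    rw [integrableOn_congr_set_ae h.domain_ae_eq]
    exact (integrableOn_finset_iUnion (s := T)).2 fun E hE => (hF E hE).congr (hae E hE).symm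
  rw [h.integral_domain hint]
  exact Finset.sum_congr rfl fun E hE => integral_congr_ae (hae E hE)

open Classical in
lemma card_filter_edgesOf_le {T₀ T : Finset Tri} {E : Tri} {Λ : ℕ} {ρ : ℝ}
    (hA : IsAdmissible T₀ T Λ) (hT₀ : IsConforming T₀) (hT : IsTiling T₀ T)
    (hsh : ∀ E ∈ T, E.IsShape ρ) (hE : E ∈ T) {e : Sym2 Plane} (he : e ∈ edgesOf T E)
    (hΩ : ¬ seg e ⊆ frontier (domain T₀)) : (T.filter fun K => e ∈ edgesOf T K).card ≤ 2 := by
  induction e using Sym2.ind with | _ p q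
  obtain ⟨E', hE', hne, he'⟩ := exists_neighbour hT₀ hT hE he hΩ
  have hρ : 0 < ρ := by linarith [(hsh E hE).two_le]
  have hs := size_pos (hsh E hE).det_ne
  have hs' := size_pos (hsh E' hE').det_ne
  have hR0 : 0 < min (edgeRadius ρ Λ E) (edgeRadius ρ Λ E') := by
    rw [edgeRadius_eq, edgeRadius_eq]
    exact lt_min (by positivity) (by positivity)
  have hpatch := hA.edgePatch hT₀ hT hE hE' hne (hsh E hE) (hsh E' hE') he he' hR0
    (min_le_left _ _) (min_le_right _ _)
  rw [hpatch.filter_eq hT₀ hT hE hE' he he']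
  exact Finset.card_le_two

open Classical in
-- Exchange the sums over elements and edges twice. An interior edge belongs to at most two
-- elements, and an element with at most 3(2^Λ + 1) nodes has at most (3(2^Λ + 1) + 1)² edges.
lemma sum_edge_patches_le {T₀ T : Finset Tri} {Λ : ℕ} {ρ : ℝ}
    (hA : IsAdmissible T₀ T Λ) (hT₀ : IsConforming T₀) (hT : IsTiling T₀ T)
    (hsh : ∀ E ∈ T, E.IsShape ρ) {X : Tri → ℝ} (hX : ∀ E ∈ T, 0 ≤ X E) :
    ∑ E ∈ T, ∑ e ∈ edgesOf T E with ¬ seg e ⊆ frontier (domain T₀),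
        ∑ E' ∈ T with e ∈ edgesOf T E', X E'
      ≤ 2 * (3 * (2 ^ Λ + 1) + 1) ^ 2 * ∑ E ∈ T, X E := by
  set 𝓔 := (T.biUnion fun E => edgesOf T E).filter fun e => ¬ seg e ⊆ frontier (domain T₀) with h𝓔
  have hswap : ∀ f : Tri → Sym2 Plane → ℝ,
      ∑ E ∈ T, ∑ e ∈ edgesOf T E with ¬ seg e ⊆ frontier (domain T₀), f E e
        = ∑ e ∈ 𝓔, ∑ E ∈ T with e ∈ edgesOf T E, f E e := by
    intro f
    refine Finset.sum_comm' fun E e => ?_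
    simp only [h𝓔, Finset.mem_filter, Finset.mem_biUnion]
    exact ⟨fun ⟨h1, h2, h3⟩ => ⟨⟨h1, h2⟩, ⟨E, h1, h2⟩, h3⟩, fun ⟨⟨h1, h2⟩, _, h3⟩ => ⟨h1, h2, h3⟩⟩
  rw [hswap]
  calc _ ≤ ∑ e ∈ 𝓔, 2 * ∑ E ∈ T with e ∈ edgesOf T E, X E := by
        refine Finset.sum_le_sum fun e he => ?_
        rw [Finset.sum_const, nsmul_eq_mul]
        refine mul_le_mul_of_nonneg_right ?_
          (Finset.sum_nonneg fun E hE => hX E (Finset.mem_filter.1 hE).1)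
        rw [h𝓔, Finset.mem_filter, Finset.mem_biUnion] at he
        obtain ⟨⟨E, hE, heE⟩, hΩ⟩ := he
        exact_mod_cast card_filter_edgesOf_le hA hT₀ hT hsh hE heE hΩ
    _ = 2 * ∑ E ∈ T, ∑ e ∈ edgesOf T E with ¬ seg e ⊆ frontier (domain T₀), X E := by
        rw [← Finset.mul_sum, hswap fun E _ => X E]
    _ ≤ 2 * ∑ E ∈ T, (3 * (2 ^ Λ + 1) + 1) ^ 2 * X E := by
        refine mul_le_mul_of_nonneg_left (Finset.sum_le_sum fun E hE => ?_) zero_le_two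
        rw [Finset.sum_const, nsmul_eq_mul]
        refine mul_le_mul_of_nonneg_right ?_ (hX E hE)
        have h1 : ((edgesOf T E).filter fun e => ¬ seg e ⊆ frontier (domain T₀)).card
            ≤ (3 * (2 ^ Λ + 1) + 1) ^ 2 :=
          (Finset.card_filter_le _ _).trans ((card_edgesOf_le T E).trans
            (Nat.pow_le_pow_left (Nat.add_le_add_right (hA.card_nodesOf_le hT₀ hT hE) 1) 2))
        exact_mod_cast h1
    _ = _ := by rw [← Finset.mul_sum]; ring

namespace ErrorBounds

variable {ρ L M C : ℝ}

open Classical in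
-- The pointwise residual bound carries size^(−2). Its square is compensated by h_E² and the area of
-- integration, each of order size². For the jumps h_E and the edge length supply the factor size².
theorem exists_etaSq_bound {T₀ : Finset Tri} (hT₀ : IsConforming T₀) (Λ : ℕ) (hρ : 2 ≤ ρ)
    (hL : 0 < L) (hM : 0 ≤ M) (hC : 0 < C) :
    ∃ K : ℝ, 0 < K ∧ ∀ {T : Finset Tri} {d : ElemCoeffs} {u v : Plane → ℝ}
      {gu gv : Plane → Plane} {N : Tri → ℝ}, IsAdmissible T₀ T Λ → IsTiling T₀ T →
    ErrorBounds (domain T₀) T d ρ L M C u v gu gv (fun E => piNabla E v) N →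
    etaSq (domain T₀) T d v ≤ K * ∑ E ∈ T, localError u v gu gv N E := by
  obtain ⟨K1, hK1, hres⟩ := exists_elemResidual_bound (ρ := ρ) (by linarith) hL hM hC
  obtain ⟨K2, hK2, hjump⟩ := exists_jump_bound hT₀ Λ hρ hL hM hC
  have hd := discArea_pos
  set K3 := (K1 * discArea) ^ 2 with hK3
  set K4 := √discArea * K2 with hK4
  refine ⟨K3 + K4 * (2 * (3 * (2 ^ Λ + 1) + 1) ^ 2), by positivity, ?_⟩
  intro T d u v gu gv N hA hT h
  set X := localError u v gu gv N with hX
  have hXn : ∀ E ∈ T, 0 ≤ X E := fun E hE => h.localError_nonneg hE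
  have hloc : ∀ E ∈ T, etaSqLocal (domain T₀) T d v E ≤ K3 * X E
      + K4 * ∑ e ∈ edgesOf T E with ¬ seg e ⊆ frontier (domain T₀),
        ∑ E' ∈ T with e ∈ edgesOf T E', X E' := by
    intro E hE
    have hs := size_pos (h.shape E hE).det_ne
    have hv0 : 0 ≤ volume.real E.carrier := measureReal_nonneg
    refine add_le_add ?_ ?_
    · have h1 := norm_setIntegral_le_of_norm_le_const (μ := volume) (s := E.carrier)
        (f := fun x => (d.f E - d.c E * (piNabla E v).eval x) ^ 2)
        (C := (K1 * √(X E) / E.size ^ 2) ^ 2) E.volume_carrier_lt_top fun x hx => by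
          rw [norm_pow, Real.norm_eq_abs]
          refine pow_le_pow_left₀ (abs_nonneg _) ?_ 2
          rw [le_div_iff₀ (by positivity), mul_comm]
          have := hres hT h E hE x hx
          rwa [elemResidual_eval] at this
      have h2 := (le_abs_self _).trans h1
      rw [Tri.h, Real.sq_sqrt hv0]
      calc _ ≤ volume.real E.carrier * ((K1 * √(X E) / E.size ^ 2) ^ 2 * volume.real E.carrier) :=
            mul_le_mul_of_nonneg_left h2 hv0
        _ = volume.real E.carrier ^ 2 * (K1 ^ 2 * X E / E.size ^ 4) := by
            rw [div_pow, mul_pow, Real.sq_sqrt (hXn E hE)]; ring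
        _ ≤ (E.size ^ 2 * discArea) ^ 2 * (K1 ^ 2 * X E / E.size ^ 4) := by
            have := hXn E hE
            gcongr
            exact E.volume_carrier_le
        _ = _ := by rw [hK3]; field_simp
    · have hterm : ∀ e ∈ edgesOf T E, 1 / 2 * (E.h * (len e * jump (domain T₀) T d v e ^ 2))
          ≤ if ¬ seg e ⊆ frontier (domain T₀) then
              K4 * ∑ E' ∈ T with e ∈ edgesOf T E', X E' else 0 := by
        intro e he
        by_cases hΩ : seg e ⊆ frontier (domain T₀)
        · rw [if_neg (not_not.2 hΩ), jump, if_pos hΩ]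
          simp
        · rw [if_pos hΩ]
          have h1 := hjump hA hT h E hE e he
          have h2 : len e ≤ 2 * E.size := by
            induction e using Sym2.ind with | _ p q
            rw [len_mk]
            exact len_le he
          have h3 : E.h ≤ E.size * √discArea := E.sqrt_volume_le
          have h4 : 0 ≤ len e * jump (domain T₀) T d v e ^ 2 :=
            mul_nonneg Metric.diam_nonneg (sq_nonneg _)
          calc _ ≤ 1 / 2 * (E.size * √discArea * (2 * E.size * jump (domain T₀) T d v e ^ 2)) := by
                gcongr
            _ = √discArea * (E.size ^ 2 * jump (domain T₀) T d v e ^ 2) := by ring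
            _ ≤ √discArea * (K2 * ∑ E' ∈ T with e ∈ edgesOf T E', X E') := by gcongr
            _ = _ := by rw [hK4]; ring
      rw [Finset.mul_sum, Finset.mul_sum, Finset.sum_filter]
      exact Finset.sum_le_sum hterm
  calc etaSq (domain T₀) T d v ≤ _ := Finset.sum_le_sum hloc
    _ = K3 * ∑ E ∈ T, X E + K4 * ∑ E ∈ T,
        ∑ e ∈ edgesOf T E with ¬ seg e ⊆ frontier (domain T₀),
          ∑ E' ∈ T with e ∈ edgesOf T E', X E' := by
        rw [Finset.sum_add_distrib, ← Finset.mul_sum, ← Finset.mul_sum]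
    _ ≤ K3 * ∑ E ∈ T, X E + K4 * (2 * (3 * (2 ^ Λ + 1) + 1) ^ 2 * ∑ E ∈ T, X E) := by
        gcongr
        exact sum_edge_patches_le hA hT₀ hT h.shape hXn
    _ = _ := by ring

end ErrorBounds

/-! ### The weak equation element by element, and the conclusion -/

lemma sum_elementwise_eq {T₀ T : Finset Tri} (hT : IsTiling T₀ T) {D : Coeffs} {d : ElemCoeffs}
    (hDd : D.IsPiecewiseConst T d) {u : Plane → ℝ} (hu : IsWeakSolution (domain T₀) D u)
    {φ : Plane → ℝ} (hφ : IsTest (domain T₀) φ) :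
    ∑ E ∈ T, ((∫ x in interior E.carrier,
        inner ℝ (mulV (d.A E) (weakGrad (domain T₀) u x)) (gradient φ x))
      + d.c E * (∫ x in interior E.carrier, u x * φ x)
      - d.f E * ∫ x in interior E.carrier, φ x) = 0 := by
  have hb := isBounded_domain T₀
  have ho := isOpen_domain T₀
  have hwu := hu.1.memH1.hasWeakGrad
  have hsub : ∀ E ∈ T, volume.restrict (interior E.carrier) ≤ volume.restrict (domain T₀) :=
    fun E hE => Measure.restrict_mono (hT.interior_subset hE) le_rfl
  have hdata : ∀ E ∈ T, ∀ᵐ x ∂volume.restrict (interior E.carrier),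
      D.A x = d.A E ∧ D.c x = d.c E ∧ D.f x = d.f E := fun E hE => by
    rw [restrict_interior]
    exact hDd E hE
  have hgrad : weakGrad (domain T₀) φ =ᵐ[volume.restrict (domain T₀)] gradient φ :=
    (hasWeakGrad_of_contDiff hb hφ.1).weakGrad_ae_eq ho
  have hφl : ∀ E ∈ T, MemLp φ 2 (volume.restrict (interior E.carrier)) := fun E _ =>
    (hφ.memLp_smul 2).restrict _
  have hul : ∀ E ∈ T, MemLp u 2 (volume.restrict (interior E.carrier)) := fun E hE =>
    hwu.memLp.mono_measure (hsub E hE)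
  -- Smooth test functions are admissible in the weak equation; on each element the data are almost
  -- everywhere equal to constants, which can be taken out of the integrals.
  have h := hu.2 φ (hφ.memH10 hb)
  rw [formB, hT.integral_domain_eq (F := fun E x =>
      inner ℝ (mulV (d.A E) (weakGrad (domain T₀) u x)) (gradient φ x)),
    hT.integral_domain_eq (F := fun E x => d.c E * (u x * φ x)),
    hT.integral_domain_eq (F := fun E x => d.f E * φ x)] at h
  · simp only [integral_const_mul] at h
    rw [Finset.sum_sub_distrib, Finset.sum_add_distrib, h, sub_self]
  · exact fun E hE => ((hφl E hE).integrable one_le_two).const_mul _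
  · intro E hE
    filter_upwards [hdata E hE] with x hx
    rw [hx.2.2]
  · intro E hE
    have : Integrable (fun x => u x * φ x) (volume.restrict (interior E.carrier)) :=
      (hul E hE).integrable_mul (hφl E hE)
    exact this.const_mul _
  · intro E hE
    filter_upwards [hdata E hE] with x hx
    rw [hx.2.1, mul_assoc]
  · exact fun E hE => ErrorBounds.integrable_inner_mulV
      (hwu.memLp_grad.mono_measure (hsub E hE)) hφ
  · intro E hE
    filter_upwards [hdata E hE, ae_mono (hsub E hE) hgrad] with x hx hx'
    rw [hx.1, hx']

end AVEM

end

open AVEM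

theorem corollary4p2 (T₀ : Finset Tri) (hT₀ : IsConforming T₀) (Λ : ℕ) (hΛ : 1 ≤ Λ)
    (M cs Cs : ℝ) (hcs : 0 < cs) (hCs : cs ≤ Cs) :
    ∃ capost : ℝ, 0 < capost ∧
      ∀ T : Finset Tri, IsRefinement T₀ T → IsAdmissible T₀ T Λ →
      ∀ (D : Coeffs) (d : ElemCoeffs), D.IsData (domain T₀) M → D.IsPiecewiseConst T d →
      ∀ V : (E : Tri) → Submodule ℝ (E.carrier → ℝ),
        (∀ E ∈ T, IsLocalSpace T E (V E) ∧ IsStable T E (V E) cs Cs) →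
      ∀ γ : ℝ, 0 < γ →
      ∀ u uT : Plane → ℝ, IsWeakSolution (domain T₀) D u →
        IsGalerkin (domain T₀) T d V γ uT →
        capost * etaSq (domain T₀) T d uT
          ≤ semiH1sq (domain T₀) (fun x => u x - uT x) + formS T uT uT := by
  obtain ⟨ρ, L, hρ, hL, hshape⟩ := hT₀.exists_shape
  obtain ⟨C, hC, hloc⟩ := exists_local_bound (ρ := ρ) hcs
  obtain ⟨K, hK, heta⟩ := ErrorBounds.exists_etaSq_bound hT₀ Λ hρ hL (abs_nonneg M) hC
  obtain ⟨P, hP, hpoin⟩ := exists_poincare (isBounded_domain T₀) (isOpen_domain T₀)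
  -- K comes from the estimator bound and 1 + P from replacing the full H¹ norm of the error by the
  -- seminorm. Both are fixed before the mesh and the data.
  refine ⟨(K * (1 + P))⁻¹, by positivity, ?_⟩
  intro T hTr hA D d hD hDd V hV γ _ u uT hu huT
  have hT := hTr.isTiling hT₀
  have ho := isOpen_domain T₀
  have hwu := hu.1.memH1.hasWeakGrad
  have hwv := huT.1.1.memH1.hasWeakGrad
  set gu := weakGrad (domain T₀) u with hgu
  set gv := weakGrad (domain T₀) uT with hgv
  set N : Tri → ℝ := fun E => stab T E (fun x => uT x - (interp E uT).eval x)
    (fun x => uT x - (interp E uT).eval x) with hN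
  have hsub : ∀ E ∈ T, MeasureTheory.volume.restrict (interior E.carrier)
      ≤ MeasureTheory.volume.restrict (domain T₀) :=
    fun E hE => MeasureTheory.Measure.restrict_mono (hT.interior_subset hE) le_rfl
  have hval : ∀ E ∈ T, (∀ i j, |d.A E i j| ≤ M) ∧ 0 ≤ d.c E ∧ d.c E ≤ M := by
    intro E hE
    -- The bounds on the data hold almost everywhere only. As the interior has positive measure,
    -- some point satisfies all of them and transfers them to the element values.
    have hne : MeasureTheory.volume.restrict (interior E.carrier) ≠ 0 := by
      rw [Ne, MeasureTheory.Measure.restrict_eq_zero]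
      exact (isOpen_interior.measure_pos _
        (Tri.interior_nonempty (hshape E (hT.inForest E hE)).1.det_ne)).ne'
    have := MeasureTheory.ae_neBot.2 hne
    have hc := hDd E hE
    rw [← Tri.restrict_interior] at hc
    have hle := MeasureTheory.ae_mono (hsub E hE)
    obtain ⟨x, h1, h2, h3, h4⟩ := (hc.and ((hD.bounded_A.filter_mono hle).and
      ((hD.nonneg_c.filter_mono hle).and (hD.bounded_c.filter_mono hle)))).exists
    rw [h1.1] at h2
    rw [h1.2.1] at h3 h4
    exact ⟨h2, h3, h4⟩
  -- The absolute value of M is used because M is not assumed to be nonnegative.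
  have hbounds : ErrorBounds (domain T₀) T d ρ L |M| C u uT gu gv (fun E => piNabla E uT) N := by
    have hl := fun E hE => hloc T E hE (hshape E (hT.inForest E hE)).1 (V E) Cs (hV E hE).1
      (hV E hE).2 uT (huT.1.2 E hE) gv
      (hwv.mono ho.measurableSet (hT.interior_subset hE)) (N E) rfl
    exact
      { shape := fun E hE => (hshape E (hT.inForest E hE)).1
        size_le := fun E hE => (hshape E (hT.inForest E hE)).2
        abs_A := fun E hE i j => ((hval E hE).1 i j).trans (le_abs_self M)
        abs_c := fun E hE => by
          rw [abs_of_nonneg (hval E hE).2.1]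
          exact (hval E hE).2.2.trans (le_abs_self M)
        memLp_u := fun E hE => hwu.memLp.mono_measure (hsub E hE)
        memLp_v := fun E hE => hwv.memLp.mono_measure (hsub E hE)
        memLp_gu := fun E hE => hwu.memLp_grad.mono_measure (hsub E hE)
        memLp_gv := fun E hE => hwv.memLp_grad.mono_measure (hsub E hE)
        nonneg := fun E hE => Finset.sum_nonneg fun x _ => mul_self_nonneg _
        weak := fun φ hφ => sum_elementwise_eq hT hDd hu hφ
        grad_le := fun E hE => (hl E hE).1
        pairing := fun E hE => (hl E hE).2 }
  have hwe := hwu.sub hwv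
  have hsemi := hwe.semiH1sq_eq ho
  have hp := hpoin _ (hu.1.sub huT.1.1)
  have hi1 : MeasureTheory.IntegrableOn (fun x => ‖gu x - gv x‖ ^ 2) (domain T₀) :=
    hwe.memLp_grad.integrable_norm_pow two_ne_zero
  have hi2 : MeasureTheory.IntegrableOn (fun x => (u x - uT x) ^ 2) (domain T₀) :=
    hwe.memLp.integrable_sq
  -- The local errors add up to the squared H¹ norm of u − u_T on the domain plus the stabilization.
  -- The middle term is then absorbed by `hp`, since u − u_T vanishes on the boundary.
  have hsum : ∑ E ∈ T, localError u uT gu gv N E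
      = semiH1sq (domain T₀) (fun x => u x - uT x)
        + (∫ x in domain T₀, (u x - uT x) ^ 2) + formS T uT uT := by
    rw [hsemi, hT.integral_domain hi1, hT.integral_domain hi2, formS, ← Finset.sum_add_distrib, ← Finset.sum_add_distrib]
    rfl
  have hS : 0 ≤ formS T uT uT :=
    Finset.sum_nonneg fun E hE => Finset.sum_nonneg fun x _ => mul_self_nonneg _
  have hfin := heta hA hT hbounds
  rw [hsum] at hfin
  rw [inv_mul_le_iff₀ (by positivity), mul_assoc]
  refine hfin.trans (mul_le_mul_of_nonneg_left ?_ hK.le)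
  nlinarith [mul_nonneg hP.le hS]
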